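/- **Machine model.** Data are finite binary trees of immutable cells whose leaves are real numbers or $\mathrm{nil}$. A program is a finite table of mutually recursive first-order functions. Its unit-cost steps are: reading or binding a variable (variables hold references, so copying one is not copying a tree), producing $\mathrm{nil}$, $0$ or $1$, allocating or inspecting a cell, adding, subtracting or comparing two reals, and calling a function. Every step takes $O(1)$ time on a pointer machine or RAM with real registers. The size of a data structure is its number of cells and leaves, shared parts being counted with multiplicity. A point of $\mathbb R^d$ is given as the list of its coordinates, a set as a list of its elements in any order without repetition. **Theorem.** There is an absolute constant $c$ such that for every $d\ge 1$ there are a dynamic data structure (a fixed collection of programs `build`, `insert` and `delete` for $A$ and for $B$, `start`, `next`) and a constant $C=C(d)$ such that the following holds for every real $r>0$ and all finite sets $A,B\subset\mathbb R^d$. Write $L(n)=\lfloor\log_2(n+2)\rfloor^{cd}$, and let $n=|A|+|B|$ always refer to the current sets. 1. *Construction.* From $r,A,B$ the data structure is built in at most $C(n+1)L(n)$ steps. 2. *Updates.* Any finite sequence of insertions of points into, and deletions of points from, $A$ or $B$ that follows the construction is carried out in at most $\sum_i C\,L(n_i)$ steps in total, where $n_i$ is the value of $n$ after the $i$-th update;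 that is, the amortized update time is at most $C\,L(n)$. 3. *Size.* At all times (after the construction and after every such sequence of updates) the data structure has size at most $C(n+1)L(n)$. 4. *Enumeration.* At all times every pair $(a,b)\in A\times B$ with $\|a-b\|_\infty\le r$, and no other pair, can be enumerated, each exactly once, with delay at most $C\,L(n)$: the number of steps before the first output, between two consecutive outputs, and between the last output and termination is at most $C\,L(n)$ in the worst case. So, with $\tilde O$ hiding a factor $\log^{O(d)}n$ and $d$ constant: size $\tilde O(n)$, construction time $\tilde O(n)$, amortized update time $\tilde O(1)$, delay $\tilde O(1)$. The same holds (with another collection of programs and another constant $C(d)$) for rectangle containment: here $A$ is a finite set of points of $\mathbb R^d$, $B$ is a finite set of closed axis-aligned boxes $\prod_{i=1}^d[b_i-w_i,\,b_i+w_i]$, each given by its centre $b\in\mathbb R^d$ and a vector $w\in\mathbb R^d$ (updates insert or delete a point or a box), and the pairs to be enumerated are all (point, box) pairs in $A\times B$ such that the point lies in the box. -/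

import Mathlib

namespace DynJoin

/-! ## Machine model

Data are finite binary trees of immutable cells with real numbers and `nil` at the leaves (so a list
is a chain of cells). A program is a finite table of mutually recursive first-order functions.
Every elementary operation costs one step, and it is one of: reading a variable, producing the
constant `nil`, `0` or `1`, allocating a cell, inspecting a cell, adding or subtracting two reals,
comparing two reals, binding a variable, calling a function. A variable holds a reference, so
copying it does not copy the tree. Each step takes constant time on a pointer machine or a RAM with
real registers. There is no free computation, no rounding, and no way to address memory
by arithmetic. -/

/-- The data that programs work on. -/
inductive Val where
  | nil : Val
  | real (x : ℝ) : Val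
  | pair (v w : Val) : Val

/-- The size of a datum: its number of cells and leaves, a subtree that is referred to several times
being counted every time. -/
def Val.size : Val → ℕ
  | .nil => 1
  | .real _ => 1
  | .pair v w => v.size + w.size + 1

/-- A list of data as a datum. -/
def Val.ofList : List Val → Val
  | [] => .nil
  | v :: l => .pair v (Val.ofList l)

/-- Program expressions; variables are de Bruijn indices. -/
inductive Expr where
  | var (i : ℕ) : Expr
  | nil : Expr
  | zero : Expr
  | one : Expr
  | pair (e₁ e₂ : Expr) : Expr
  | add (e₁ e₂ : Expr) : Expr
  | sub (e₁ e₂ : Expr) : Expr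
  /-- Evaluate `e`, push its value on the environment, evaluate `body`. -/
  | bind (e body : Expr) : Expr
  /-- Evaluate `e`; on `nil` continue with `onNil`; on a cell push its two components on the
  environment (the first component becomes variable `0`, the second variable `1`) and
  continue with `onPair`. -/
  | split (e onNil onPair : Expr) : Expr
  /-- Continue with `yes` if the real value of `e₁` is at most that of `e₂`, else with `no`. -/
  | ifLE (e₁ e₂ yes no : Expr) : Expr
  /-- Call the `f`-th function of the program on the value of `e`. -/
  | call (f : ℕ) (e : Expr) : Expr

/-- `Eval P ρ e v t`: with function table `P` (the bodies of the functions, whose argument is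
variable `0`) and in the environment `ρ`, the expression `e` evaluates to `v` in exactly `t` steps.
Expressions that apply an operation to data of the wrong kind, or that run forever, have no
value. -/
inductive Eval (P : List Expr) : List Val → Expr → Val → ℕ → Prop where
  | var {ρ : List Val} {i : ℕ} {v : Val} : ρ[i]? = some v → Eval P ρ (.var i) v 1
  | nil {ρ : List Val} : Eval P ρ .nil .nil 1
  | zero {ρ : List Val} : Eval P ρ .zero (.real 0) 1
  | one {ρ : List Val} : Eval P ρ .one (.real 1) 1
  | pair {ρ : List Val} {e₁ e₂ : Expr} {v₁ v₂ : Val} {t₁ t₂ : ℕ} :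
      Eval P ρ e₁ v₁ t₁ → Eval P ρ e₂ v₂ t₂ →
      Eval P ρ (.pair e₁ e₂) (.pair v₁ v₂) (t₁ + t₂ + 1)
  | add {ρ : List Val} {e₁ e₂ : Expr} {x y : ℝ} {t₁ t₂ : ℕ} :
      Eval P ρ e₁ (.real x) t₁ → Eval P ρ e₂ (.real y) t₂ →
      Eval P ρ (.add e₁ e₂) (.real (x + y)) (t₁ + t₂ + 1)
  | sub {ρ : List Val} {e₁ e₂ : Expr} {x y : ℝ} {t₁ t₂ : ℕ} :
      Eval P ρ e₁ (.real x) t₁ → Eval P ρ e₂ (.real y) t₂ →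
      Eval P ρ (.sub e₁ e₂) (.real (x - y)) (t₁ + t₂ + 1)
  | bind {ρ : List Val} {e body : Expr} {v w : Val} {t₁ t₂ : ℕ} :
      Eval P ρ e v t₁ → Eval P (v :: ρ) body w t₂ →
      Eval P ρ (.bind e body) w (t₁ + t₂ + 1)
  | splitNil {ρ : List Val} {e onNil onPair : Expr} {w : Val} {t₁ t₂ : ℕ} :
      Eval P ρ e .nil t₁ → Eval P ρ onNil w t₂ →
      Eval P ρ (.split e onNil onPair) w (t₁ + t₂ + 1)
  | splitPair {ρ : List Val} {e onNil onPair : Expr} {v₁ v₂ w : Val} {t₁ t₂ : ℕ} :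
      Eval P ρ e (.pair v₁ v₂) t₁ → Eval P (v₁ :: v₂ :: ρ) onPair w t₂ →
      Eval P ρ (.split e onNil onPair) w (t₁ + t₂ + 1)
  | ifYes {ρ : List Val} {e₁ e₂ yes no : Expr} {x y : ℝ} {w : Val} {t₁ t₂ t₃ : ℕ} :
      Eval P ρ e₁ (.real x) t₁ → Eval P ρ e₂ (.real y) t₂ → x ≤ y → Eval P ρ yes w t₃ →
      Eval P ρ (.ifLE e₁ e₂ yes no) w (t₁ + t₂ + t₃ + 1)
  | ifNo {ρ : List Val} {e₁ e₂ yes no : Expr} {x y : ℝ} {w : Val} {t₁ t₂ t₃ : ℕ} :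
      Eval P ρ e₁ (.real x) t₁ → Eval P ρ e₂ (.real y) t₂ → y < x → Eval P ρ no w t₃ →
      Eval P ρ (.ifLE e₁ e₂ yes no) w (t₁ + t₂ + t₃ + 1)
  | call {ρ : List Val} {f : ℕ} {e body : Expr} {v w : Val} {t₁ t₂ : ℕ} :
      Eval P ρ e v t₁ → P[f]? = some body → Eval P [v] body w t₂ →
      Eval P ρ (.call f e) w (t₁ + t₂ + 1)

/-- The value and the number of steps of an expression are unique. -/
theorem Eval.unique {P : List Expr} {ρ : List Val} {e : Expr} {v w : Val} {s t : ℕ}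
    (h : Eval P ρ e v s) (h' : Eval P ρ e w t) : v = w ∧ s = t := by
  induction h generalizing w t with
  | var h₁ => cases h' with | var h₂ => simp_all
  | nil => cases h'; simp
  | zero => cases h'; simp
  | one => cases h'; simp
  | pair _ _ ih₁ ih₂ =>
    cases h' with | pair a b => have := ih₁ a; have := ih₂ b; grind
  | add _ _ ih₁ ih₂ =>
    cases h' with | add a b => have := ih₁ a; have := ih₂ b; grind
  | sub _ _ ih₁ ih₂ =>
    cases h' with | sub a b => have := ih₁ a; have := ih₂ b; grind
  | bind _ _ ih₁ ih₂ =>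
    cases h' with
    | bind a b => obtain ⟨rfl, rfl⟩ := ih₁ a; obtain ⟨rfl, rfl⟩ := ih₂ b; simp
  | splitNil _ _ ih₁ ih₂ =>
    cases h' with
    | splitNil a b => have := ih₁ a; have := ih₂ b; grind
    | splitPair a b => cases (ih₁ a).1
  | splitPair _ _ ih₁ ih₂ =>
    cases h' with
    | splitNil a b => cases (ih₁ a).1
    | splitPair a b =>
      obtain ⟨h₁, rfl⟩ := ih₁ a
      cases h₁
      obtain ⟨rfl, rfl⟩ := ih₂ b
      simp
  | ifYes _ _ hxy _ ih₁ ih₂ ih₃ =>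
    cases h' with
    | ifYes a b _ e => have := ih₁ a; have := ih₂ b; have := ih₃ e; grind
    | ifNo a b hyx e =>
      have := (ih₁ a).1
      have := (ih₂ b).1
      simp_all
      linarith
  | ifNo _ _ hyx _ ih₁ ih₂ ih₃ =>
    cases h' with
    | ifNo a b _ e => have := ih₁ a; have := ih₂ b; have := ih₃ e; grind
    | ifYes a b hxy e =>
      have := (ih₁ a).1
      have := (ih₂ b).1
      simp_all
      linarith
  | call _ hb _ ih₁ ih₂ =>
    cases h' with
    | call a hb' b =>
      obtain ⟨rfl, rfl⟩ := ih₁ a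
      obtain rfl := Option.some.inj (hb.symm.trans hb')
      obtain ⟨rfl, rfl⟩ := ih₂ b
      simp

/-! ## Dynamic instances -/

/-- A single update of a pair of sets. -/
inductive Update (α β : Type) where
  | insertA (a : α) : Update α β
  | deleteA (a : α) : Update α β
  | insertB (b : β) : Update α β
  | deleteB (b : β) : Update α β

/-- The effect of an update on the current pair of sets `(A, B)`. -/
def Update.apply {α β : Type} [DecidableEq α] [DecidableEq β]
    (I : Finset α × Finset β) : Update α β → Finset α × Finset β
  | .insertA a => (insert a I.1, I.2)
  | .deleteA a => (I.1.erase a, I.2)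
  | .insertB b => (I.1, insert b I.2)
  | .deleteB b => (I.1, I.2.erase b)

/-- The size `n = |A| + |B|`. -/
def instSize {α β : Type} (I : Finset α × Finset β) : ℕ := I.1.card + I.2.card

/-- The sum of `f (n)` over the updates in a sequence, where `n` is the size of the instance
right after the respective update. -/
def amortizedBudget {α β : Type} [DecidableEq α] [DecidableEq β] (f : ℕ → ℕ) :
    Finset α × Finset β → List (Update α β) → ℕ
  | _, [] => 0
  | I, u :: us => f (instSize (u.apply I)) + amortizedBudget f (u.apply I) us

/-- `log ^ k n`, shifted so as to be positive for all `n`. -/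
def polylog (k n : ℕ) : ℕ := Nat.log 2 (n + 2) ^ k

/-! ## Dynamic data structures for joins -/

/-- The code of a dynamic data structure with enumeration. -/
structure JoinStructure where
  /-- The function table that all operations share. -/
  prog : List Expr
  /-- Run in the environment `[parameter, list of A, list of B]`, returns the data structure. -/
  build : Expr
  /-- Run in the environment `[data structure, element]`, returns the new data structure;
  likewise the next three. -/
  insertA : Expr
  deleteA : Expr
  insertB : Expr
  deleteB : Expr
  /-- Run in the environment `[data structure]`, returns `nil` or the first answer paired with a
  continuation. -/
  start : Expr
  /-- Run in the environment `[continuation]`, returns `nil` or the next answer paired with a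
  continuation. -/
  next : Expr

namespace JoinStructure

/-- `D.UpdateStep encA encB s u s' t`: the update `u` turns the data structure `s` into `s'` in
`t` steps. -/
def UpdateStep {α β : Type} (D : JoinStructure) (encA : α → Val) (encB : β → Val)
    (s : Val) (u : Update α β) (s' : Val) (t : ℕ) : Prop :=
  match u with
  | .insertA a => Eval D.prog [s, encA a] D.insertA s' t
  | .deleteA a => Eval D.prog [s, encA a] D.deleteA s' t
  | .insertB b => Eval D.prog [s, encB b] D.insertB s' t
  | .deleteB b => Eval D.prog [s, encB b] D.deleteB s' t

/-- A sequence of updates turns `s` into `s'`, in `t` steps in total. -/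
inductive UpdateSteps {α β : Type} (D : JoinStructure) (encA : α → Val) (encB : β → Val) :
    Val → List (Update α β) → Val → ℕ → Prop where
  | nil {s : Val} : UpdateSteps D encA encB s [] s 0
  | cons {s s' s'' : Val} {u : Update α β} {us : List (Update α β)} {t t' : ℕ} :
      D.UpdateStep encA encB s u s' t → UpdateSteps D encA encB s' us s'' t' →
      UpdateSteps D encA encB s (u :: us) s'' (t + t')

/-- `D.EnumFrom δ e s l`: the enumeration that begins by running `e` on `s` and goes on by running
`next` on the respective continuation outputs exactly the list `l` and then stops, and it spends
at most `δ` steps before the first output, between any two consecutive outputs, and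
from the last output to the end. -/
inductive EnumFrom (D : JoinStructure) (δ : ℕ) : Expr → Val → List Val → Prop where
  | finish {e : Expr} {s : Val} {t : ℕ} :
      Eval D.prog [s] e .nil t → t ≤ δ → EnumFrom D δ e s []
  | output {e : Expr} {s s' o : Val} {l : List Val} {t : ℕ} :
      Eval D.prog [s] e (.pair o s') t → t ≤ δ → EnumFrom D δ D.next s' l →
      EnumFrom D δ e s (o :: l)

/-- `D` maintains a pair of finite sets `A`, `B` and enumerates `{(a, b) ∈ A × B | R a b}`, every
pair once. With `n = |A| + |B|` at the respective time: building takes at most `C (n + 1) log ^ k n`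
steps; any sequence of updates after that takes in total at most the sum over the updates of
`C log ^ k n` steps; and at all times the data structure has size at most `C (n + 1) log ^ k n`
and the enumeration has delay at most `C log ^ k n`. The datum `par` is a fixed parameter
that is passed to `build`. -/
def Solves {α β : Type} [DecidableEq α] [DecidableEq β] (D : JoinStructure) (par : Val)
    (encA : α → Val) (encB : β → Val) (R : α → β → Prop) (C k : ℕ) : Prop :=
  ∀ (la : List α) (lb : List β), la.Nodup → lb.Nodup →
    ∃ (s₀ : Val) (t₀ : ℕ),
      Eval D.prog [par, Val.ofList (la.map encA), Val.ofList (lb.map encB)] D.build s₀ t₀ ∧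
      t₀ ≤ C * (la.length + lb.length + 1) * polylog k (la.length + lb.length) ∧
      ∀ us : List (Update α β),
        ∃ (s : Val) (t : ℕ) (A : Finset α) (B : Finset β) (out : List (α × β)),
          us.foldl Update.apply (la.toFinset, lb.toFinset) = (A, B) ∧
          D.UpdateSteps encA encB s₀ us s t ∧
          t ≤ amortizedBudget (fun n => C * polylog k n) (la.toFinset, lb.toFinset) us ∧
          s.size ≤ C * (A.card + B.card + 1) * polylog k (A.card + B.card) ∧
          out.Nodup ∧
          (∀ a b, (a, b) ∈ out ↔ a ∈ A ∧ b ∈ B ∧ R a b) ∧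
          D.EnumFrom (C * polylog k (A.card + B.card)) D.start s
            (out.map fun p => Val.pair (encA p.1) (encB p.2))

end JoinStructure

/-! ## Points and boxes -/

/-- A point of `ℝ ^ d` as the list of its coordinates. -/
def encPoint {d : ℕ} (x : Fin d → ℝ) : Val := Val.ofList ((List.ofFn x).map Val.real)

/-- A box, given by its centre and its vector of half side lengths. -/
abbrev Box (d : ℕ) : Type := (Fin d → ℝ) × (Fin d → ℝ)

/-- The closed axis-parallel box as a set. -/
def Box.toSet {d : ℕ} (b : Box d) : Set (Fin d → ℝ) := Set.Icc (b.1 - b.2) (b.1 + b.2)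

/-- A box as a datum. -/
def encBox {d : ℕ} (b : Box d) : Val := .pair (encPoint b.1) (encPoint b.2)

end DynJoin

/-! A point `a` gets the `2 d` keys `a i, -a i`, and a box with lower bounds `x i` and upper bounds
`y i` gets the keys `x i, -y i`. The point lies in the box iff each key of the box is at most the
corresponding key of the point (`forall₂_le_keyList`). Both halves of the theorem are therefore
instances of `solves`, a statement about dominance in `m = 2 d` coordinates.

Dominance in one coordinate is read off a static search tree in which, on ties, points go right and
boxes go left. If one of the keys `a`, `b` occurs in the tree, then `b ≤ a` exactly if the two
search paths part at some node with the point going right and the box going left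
(`Bst.exists_prefix_iff`), and there is only one such node. So an item is stored at those nodes of
its path where it turns to its own side, and each such node contains a structure for the next
coordinate. In the resulting nested trie a dominating pair meets in exactly one bottom structure
(`exists_matches_iff`, `matches_unique`), and an item occupies only polylogarithmically many places
(`pathNodes_le`). A bottom structure consists of two tries, for points and for boxes, keyed by
identifiers; its output is their product. Every node carries a flag that tells whether there is any
output below it. A traversal with a stack that enters flagged parts only never runs into a dead end,
so its delay is proportional to the height (`nextOk`), in the worst case.

The search trees are never rebalanced. What makes the structure dynamic is that only one partner of
a pair has to occur in the trees: a structure whose trees come from a set `T` can also store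
arbitrary outside items, as long as only pairs with a member in `T` are asked for (`StrOk.outs`).
There are slots of capacities 1, 2, 4, …, and a top structure from the last rebuilding. An inserted
item is stored as an outside item in all structures and then moves through the slots like the carry
of a binary counter (`exists_tick`). Every structure knows the items of all smaller ones, so a pair
is reported once, by the larger of the structures to which its two members belong (`Inv.outs`).
Merging smaller slots does not change what the larger ones know. A deletion removes the item from
all structures and leaves their search trees as they are.

Once all slots are full, the next effective update rebuilds everything. This happens after a number
of effective updates proportional to the size at the last rebuilding, so logarithms, identifiers and
sizes stay comparable to the current ones. A potential that lets every place of a slot prepay its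
way up through the remaining slots covers both the merging and the rebuilding (`exists_tick`,
`State.Ok.exists_finish`). -/

namespace DynJoin

/-! ### Weakest preconditions for the step-counting semantics. -/

/-- `e` evaluates, and value and number of steps satisfy `k`. -/
def WP (P : List Expr) (ρ : List Val) (e : Expr) (k : Val → ℕ → Prop) : Prop :=
  ∃ v t, Eval P ρ e v t ∧ k v t

/-- The `f`-th function evaluates on `v`, and value and number of steps satisfy `k`. -/
def Exec (P : List Expr) (f : ℕ) (v : Val) (k : Val → ℕ → Prop) : Prop :=
  ∃ body, P[f]? = some body ∧ WP P [v] body k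

/-- The `f`-th function maps `v` to `w` in at most `T` steps. -/
def CallLE (P : List Expr) (f : ℕ) (v w : Val) (T : ℕ) : Prop :=
  Exec P f v fun w' t => w' = w ∧ t ≤ T

/-- Case distinction of the `split` instruction. -/
def splitK (v : Val) (kn : Prop) (kp : Val → Val → Prop) : Prop :=
  match v with
  | .nil => kn
  | .pair a b => kp a b
  | .real _ => False

/-- Both data are reals, and these satisfy `k`. -/
def realK (v w : Val) (k : ℝ → ℝ → Prop) : Prop :=
  match v, w with
  | .real x, .real y => k x y
  | _, _ => False

section
variable {P : List Expr} {ρ : List Val} {k : Val → ℕ → Prop}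

@[simp] theorem splitK_nil {kn : Prop} {kp : Val → Val → Prop} : splitK .nil kn kp = kn := rfl
@[simp] theorem splitK_pair {kn : Prop} {kp : Val → Val → Prop} {a b : Val} :
    splitK (.pair a b) kn kp = kp a b := rfl
@[simp] theorem realK_real {x y : ℝ} {k : ℝ → ℝ → Prop} :
    realK (.real x) (.real y) k = k x y := rfl

-- With one equivalence per instruction as a simp rule, simplification executes a program
-- symbolically and accumulates its exact number of steps in the continuation `k`.
@[simp] theorem WP_var {i : ℕ} : WP P ρ (.var i) k ↔ ∃ v, ρ[i]? = some v ∧ k v 1 := by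
  constructor
  · rintro ⟨v, t, h, hk⟩
    cases h with | var h => exact ⟨v, h, hk⟩
  · rintro ⟨v, h, hk⟩
    exact ⟨v, 1, .var h, hk⟩

@[simp] theorem WP_nil : WP P ρ .nil k ↔ k .nil 1 := by
  constructor
  · rintro ⟨v, t, h, hk⟩
    cases h; exact hk
  · exact fun hk => ⟨_, 1, .nil, hk⟩

@[simp] theorem WP_zero : WP P ρ .zero k ↔ k (.real 0) 1 := by
  constructor
  · rintro ⟨v, t, h, hk⟩
    cases h; exact hk
  · exact fun hk => ⟨_, 1, .zero, hk⟩

@[simp] theorem WP_pair {e₁ e₂ : Expr} : WP P ρ (.pair e₁ e₂) k ↔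
    WP P ρ e₁ fun v₁ t₁ => WP P ρ e₂ fun v₂ t₂ => k (.pair v₁ v₂) (t₁ + t₂ + 1) := by
  constructor
  · rintro ⟨v, t, h, hk⟩
    cases h with | pair h₁ h₂ => exact ⟨_, _, h₁, _, _, h₂, hk⟩
  · rintro ⟨_, _, h₁, _, _, h₂, hk⟩
    exact ⟨_, _, .pair h₁ h₂, hk⟩

@[simp] theorem WP_add {e₁ e₂ : Expr} : WP P ρ (.add e₁ e₂) k ↔
    WP P ρ e₁ fun v₁ t₁ => WP P ρ e₂ fun v₂ t₂ =>
      realK v₁ v₂ fun x y => k (.real (x + y)) (t₁ + t₂ + 1) := by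
  constructor
  · rintro ⟨v, t, h, hk⟩
    cases h with | add h₁ h₂ => exact ⟨_, _, h₁, _, _, h₂, hk⟩
  · rintro ⟨v₁, _, h₁, v₂, _, h₂, hk⟩
    cases v₁ <;> cases v₂ <;> try exact hk.elim
    exact ⟨_, _, .add h₁ h₂, hk⟩

@[simp] theorem WP_sub {e₁ e₂ : Expr} : WP P ρ (.sub e₁ e₂) k ↔
    WP P ρ e₁ fun v₁ t₁ => WP P ρ e₂ fun v₂ t₂ =>
      realK v₁ v₂ fun x y => k (.real (x - y)) (t₁ + t₂ + 1) := by
  constructor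
  · rintro ⟨v, t, h, hk⟩
    cases h with | sub h₁ h₂ => exact ⟨_, _, h₁, _, _, h₂, hk⟩
  · rintro ⟨v₁, _, h₁, v₂, _, h₂, hk⟩
    cases v₁ <;> cases v₂ <;> try exact hk.elim
    exact ⟨_, _, .sub h₁ h₂, hk⟩

@[simp] theorem WP_bind {e body : Expr} : WP P ρ (.bind e body) k ↔
    WP P ρ e fun v t₁ => WP P (v :: ρ) body fun w t₂ => k w (t₁ + t₂ + 1) := by
  constructor
  · rintro ⟨v, t, h, hk⟩
    cases h with | bind h₁ h₂ => exact ⟨_, _, h₁, _, _, h₂, hk⟩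
  · rintro ⟨_, _, h₁, _, _, h₂, hk⟩
    exact ⟨_, _, .bind h₁ h₂, hk⟩

@[simp] theorem WP_split {e n p : Expr} : WP P ρ (.split e n p) k ↔
    WP P ρ e fun v t₁ => splitK v (WP P ρ n fun w t₂ => k w (t₁ + t₂ + 1))
      fun a b => WP P (a :: b :: ρ) p fun w t₂ => k w (t₁ + t₂ + 1) := by
  constructor
  · rintro ⟨v, t, h, hk⟩
    cases h with
    | splitNil h₁ h₂ => exact ⟨_, _, h₁, _, _, h₂, hk⟩
    | splitPair h₁ h₂ => exact ⟨_, _, h₁, _, _, h₂, hk⟩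
  · rintro ⟨v, _, h₁, hk⟩
    cases v with
    | nil =>
      obtain ⟨_, _, h₂, hk⟩ := hk
      exact ⟨_, _, .splitNil h₁ h₂, hk⟩
    | real => exact hk.elim
    | pair =>
      obtain ⟨_, _, h₂, hk⟩ := hk
      exact ⟨_, _, .splitPair h₁ h₂, hk⟩

@[simp] theorem WP_ifLE {e₁ e₂ y n : Expr} : WP P ρ (.ifLE e₁ e₂ y n) k ↔
    WP P ρ e₁ fun v₁ t₁ => WP P ρ e₂ fun v₂ t₂ => realK v₁ v₂ fun a b =>
      if a ≤ b then WP P ρ y fun w t₃ => k w (t₁ + t₂ + t₃ + 1)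
      else WP P ρ n fun w t₃ => k w (t₁ + t₂ + t₃ + 1) := by
  constructor
  · rintro ⟨v, t, h, hk⟩
    cases h with
    | ifYes h₁ h₂ hxy h₃ =>
      refine ⟨_, _, h₁, _, _, h₂, ?_⟩
      simp only [realK_real, if_pos hxy]
      exact ⟨_, _, h₃, hk⟩
    | ifNo h₁ h₂ hxy h₃ =>
      refine ⟨_, _, h₁, _, _, h₂, ?_⟩
      simp only [realK_real, if_neg hxy.not_ge]
      exact ⟨_, _, h₃, hk⟩
  · rintro ⟨v₁, _, h₁, v₂, _, h₂, hk⟩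
    cases v₁ <;> cases v₂ <;> try exact hk.elim
    rename_i x y
    simp only [realK_real] at hk
    split_ifs at hk with h
    · obtain ⟨_, _, h₃, hk⟩ := hk
      exact ⟨_, _, .ifYes h₁ h₂ h h₃, hk⟩
    · obtain ⟨_, _, h₃, hk⟩ := hk
      exact ⟨_, _, .ifNo h₁ h₂ (not_le.1 h) h₃, hk⟩

-- Execution stops at `Exec` instead of unfolding the called function, so that recursive calls are
-- left to an induction hypothesis.
@[simp] theorem WP_call {f : ℕ} {e : Expr} : WP P ρ (.call f e) k ↔
    WP P ρ e fun v t₁ => Exec P f v fun w t₂ => k w (t₁ + t₂ + 1) := by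
  constructor
  · rintro ⟨v, t, h, hk⟩
    cases h with | call h₁ hb h₂ => exact ⟨_, _, h₁, _, hb, _, _, h₂, hk⟩
  · rintro ⟨_, _, h₁, _, hb, _, _, h₂, hk⟩
    exact ⟨_, _, .call h₁ hb h₂, hk⟩

/-- Use the specification of a function. -/
theorem CallLE.exec {f : ℕ} {v w : Val} {T : ℕ} (h : CallLE P f v w T)
    (hk : ∀ t ≤ T, k w t) : Exec P f v k := by
  obtain ⟨body, hb, w', t, he, rfl, ht⟩ := h
  exact ⟨body, hb, _, t, he, hk t ht⟩

theorem CallLE.mono {f : ℕ} {v w : Val} {T T' : ℕ} (h : CallLE P f v w T) (hT : T ≤ T') :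
    CallLE P f v w T' :=
  h.exec fun _ ht => ⟨rfl, ht.trans hT⟩

theorem CallLE.of_body {f : ℕ} {v w : Val} {T : ℕ} {body : Expr} (hb : P[f]? = some body)
    (h : WP P [v] body fun w' t => w' = w ∧ t ≤ T) : CallLE P f v w T :=
  ⟨body, hb, h⟩

end

@[simp] theorem Val.ofList_nil : Val.ofList [] = .nil := rfl
@[simp] theorem Val.ofList_cons (v : Val) (l : List Val) :
    Val.ofList (v :: l) = .pair v (Val.ofList l) := rfl

end DynJoin

namespace DynJoin

/-! ## Binary search trees as skeletons -/

/-- A binary search tree of reals. -/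
inductive Bst where
  | nil : Bst
  | node (s : ℝ) (l r : Bst) : Bst

/-- The side that a search takes at a node with key `s`. On a tie a point (`true`) goes to the
right and a box (`false`) goes to the left. -/
noncomputable def turn (side : Bool) (s k : ℝ) : Bool :=
  if side then decide (s ≤ k) else !decide (k ≤ s)

namespace Bst

def toList : Bst → List ℝ
  | nil => []
  | node s l r => l.toList ++ s :: r.toList

def depth : Bst → ℕ
  | nil => 0
  | node _ l r => max l.depth r.depth + 1

/-- The search path of a key. -/
noncomputable def code (side : Bool) (k : ℝ) : Bst → List Bool
  | nil => []
  | node s l r => turn side s k :: if turn side s k then r.code side k else l.code side k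

theorem length_code_le (side : Bool) (k : ℝ) (t : Bst) : (t.code side k).length ≤ t.depth := by
  induction t with
  | nil => simp [code]
  | node s l r ihl ihr =>
    simp only [code, depth, List.length_cons]
    split_ifs <;> omega

/-- A search runs until it falls off the tree, so the paths of one tree form a prefix-free code, and
concatenations of paths can be decoded. -/
theorem code_append_inj {side : Bool} {k k' : ℝ} {t : Bst} {w w' : List Bool}
    (h : t.code side k ++ w = t.code side k' ++ w') : t.code side k = t.code side k' ∧ w = w' := by
  induction t with
  | nil => simpa [code] using h
  | node s l r ihl ihr =>
    simp only [code, List.cons_append, List.cons.injEq] at h ⊢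
    obtain ⟨h₁, h₂⟩ := h
    rw [h₁] at h₂ ⊢
    split_ifs at h₂ ⊢ with h
    · simpa using ihr h₂
    · simpa using ihl h₂

/-- The tie rule decides which of the two keys has to occur. A node with key `y` separates points,
since `y` goes right and `x` goes left there; a node with key `x` separates boxes, since `x` goes
left and `y` goes right. -/
theorem code_ne_of_lt {side : Bool} {x y : ℝ} {t : Bst} (ht : t.toList.Pairwise (· ≤ ·))
    (hxy : x < y) (h : (if side then y else x) ∈ t.toList) : t.code side x ≠ t.code side y := by
  induction t with
  | nil => simp [toList] at h
  | node s l r ihl ihr =>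
    simp only [toList, List.pairwise_append, List.pairwise_cons, List.mem_cons, List.mem_append]
      at ht h
    obtain ⟨hl, ⟨hsr, hr⟩, hls⟩ := ht
    have hl' : ∀ x ∈ l.toList, x ≤ s := fun x hx => hls x hx s (by simp)
    simp only [code, ne_eq, List.cons.injEq, not_and]
    intro h₁ h₂
    rw [← h₁] at h₂
    cases side
    · simp only [turn, Bool.false_eq_true, if_false] at h h₁ h₂ ihl ihr
      by_cases hx : x ≤ s
      · have hy : y ≤ s := by simpa [hx] using h₁
        refine ihl hl ?_ (by simpa [hx] using h₂)
        rcases h with h | h | h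
        · exact h
        · linarith
        · linarith [hsr _ h]
      · refine ihr hr ?_ (by simpa [hx] using h₂)
        rcases h with h | h | h
        · exact absurd (hl' _ h) hx
        · exact absurd h.le hx
        · exact h
    · simp only [turn, if_true] at h h₁ h₂ ihl ihr
      by_cases hx : s ≤ x
      · refine ihr hr ?_ (by simpa [hx] using h₂)
        rcases h with h | h | h
        · linarith [hl' _ h]
        · linarith
        · exact h
      · have hy : ¬ s ≤ y := by simpa [hx] using h₁
        refine ihl hl ?_ (by simpa [hx] using h₂)
        rcases h with h | h | h
        · exact h
        · exact absurd h.ge hy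
        · exact absurd (hsr _ h) hy

theorem eq_of_code_eq {side : Bool} {k k' : ℝ} {t : Bst} (ht : t.toList.Pairwise (· ≤ ·))
    (hk : k ∈ t.toList) (hk' : k' ∈ t.toList) (h : t.code side k = t.code side k') : k = k' := by
  rcases lt_trichotomy k k' with hlt | rfl | hlt
  · exact absurd h (code_ne_of_lt ht hlt (by cases side <;> simpa))
  · rfl
  · exact absurd h.symm (code_ne_of_lt ht hlt (by cases side <;> simpa))

/-- The paths of a point key `a` and a box key `b`, one of which occurs in the tree, part in the
right order iff `b ≤ a`. -/
theorem exists_prefix_iff {a b : ℝ} {t : Bst} (ht : t.toList.Pairwise (· ≤ ·))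
    (h : a ∈ t.toList ∨ b ∈ t.toList) :
    (∃ p, (p ++ [true]) <+: t.code true a ∧ (p ++ [false]) <+: t.code false b) ↔ b ≤ a := by
  constructor
  · rintro ⟨p, ha, hb⟩
    -- Neither the order of the tree nor membership is needed here: at the node `s` where the paths
    -- part, the two turns say `b ≤ s ≤ a`.
    clear ht h
    induction t generalizing p with
    | nil => simp [code] at ha
    | node s l r ihl ihr =>
      cases p with
      | nil =>
        simp only [code, List.nil_append, List.cons_prefix_cons, List.nil_prefix, and_true] at ha hb
        simp only [turn, if_true] at ha
        simp [turn] at hb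
        have := of_decide_eq_true ha.symm
        linarith
      | cons c p =>
        simp only [code, List.cons_append, List.cons_prefix_cons] at ha hb
        obtain ⟨ha, ha'⟩ := ha
        obtain ⟨hb, hb'⟩ := hb
        rw [← ha] at ha'
        rw [← hb] at hb'
        cases c
        · exact ihl p (by simpa using ha') (by simpa using hb')
        · exact ihr p (by simpa using ha') (by simpa using hb')
  · intro hba
    induction t with
    | nil => simp [toList] at h
    | node s l r ihl ihr =>
      simp only [toList, List.pairwise_append, List.pairwise_cons, List.mem_cons, List.mem_append]
        at ht h
      obtain ⟨hl, ⟨hsr, hr⟩, hls⟩ := ht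
      have hl' : ∀ x ∈ l.toList, x ≤ s := fun x hx => hls x hx s (by simp)
      -- Either the paths part at this node, or `b ≤ a` forces both keys to the same side; then the
      -- key known to occur lies in that subtree too, so a leaf cannot be reached before the paths
      -- part.
      by_cases h₁ : s ≤ a
      · by_cases h₂ : b ≤ s
        · exact ⟨[], by simp [code, turn, h₁], by simp [code, turn, h₂]⟩
        · have : a ∈ r.toList ∨ b ∈ r.toList := by
            rcases h with (h | h | h) | (h | h | h)
            · have := hl' _ h; exfalso; linarith
            · exfalso; linarith
            · exact .inl h
            · have := hl' _ h; exfalso; linarith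
            · exfalso; linarith
            · exact .inr h
          obtain ⟨p, hp, hp'⟩ := ihr hr this
          exact ⟨true :: p, by simpa [code, turn, h₁] using hp, by simpa [code, turn, h₂] using hp'⟩
      · have h₂ : b ≤ s := by linarith
        have : a ∈ l.toList ∨ b ∈ l.toList := by
          rcases h with (h | h | h) | (h | h | h)
          · exact .inl h
          · exfalso; linarith
          · have := hsr _ h; exfalso; linarith
          · exact .inr h
          · exfalso; linarith
          · have := hsr _ h; exfalso; linarith
        obtain ⟨p, hp, hp'⟩ := ihl hl this
        exact ⟨false :: p, by simpa [code, turn, h₁] using hp, by simpa [code, turn, h₂] using hp'⟩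

end Bst

/-- Two sequences part only once, after their longest common prefix. This is why no pair is reported
twice. -/
theorem eq_of_prefix_of_prefix {p q c c' : List Bool} (hp : (p ++ [true]) <+: c)
    (hp' : (p ++ [false]) <+: c') (hq : (q ++ [true]) <+: c) (hq' : (q ++ [false]) <+: c') :
    p = q := by
  induction p generalizing q c c' with
  | nil =>
    cases q with
    | nil => rfl
    | cons b q =>
      obtain ⟨w, rfl⟩ := hp
      obtain ⟨w', rfl⟩ := hp'
      simp_all [List.cons_prefix_cons]
  | cons b p ih =>
    obtain ⟨w, rfl⟩ := hp
    obtain ⟨w', rfl⟩ := hp'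
    cases q with
    | nil => simp_all [List.cons_prefix_cons]
    | cons b' q =>
      simp only [List.cons_append, List.cons_prefix_cons] at hq hq'
      obtain ⟨rfl, hq⟩ := hq
      rw [ih (List.prefix_append _ _) (List.prefix_append _ _) hq hq'.2]

/-! ## Tries -/

/-- A binary trie. -/
inductive Trie (α : Type) where
  | nil : Trie α
  | node (o : Option α) (l r : Trie α) : Trie α

namespace Trie
variable {α : Type}

def slot : Trie α → Option α
  | nil => none
  | node o _ _ => o

def left : Trie α → Trie α
  | nil => nil
  | node _ l _ => l

def right : Trie α → Trie α
  | nil => nil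
  | node _ _ r => r

/-- The trie with the given parts, which is `nil` if they are all empty. -/
def mk : Option α → Trie α → Trie α → Trie α
  | none, nil, nil => nil
  | o, l, r => node o l r

def get : List Bool → Trie α → Option α
  | [], t => t.slot
  | b :: k, t => get k (if b then t.right else t.left)

/-- The entry `none` deletes. Rebuilding with `mk` on the way back removes branches that have become
empty. -/
def set (o : Option α) : List Bool → Trie α → Trie α
  | [], t => mk o t.left t.right
  | b :: k, t => mk t.slot (if b then t.left else set o k t.left)
      (if b then set o k t.right else t.right)

def toList : Trie α → List α
  | nil => []
  | node o l r => o.toList ++ l.toList ++ r.toList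

def nodes : Trie α → ℕ
  | nil => 0
  | node _ l r => l.nodes + r.nodes + 1

def ht : Trie α → ℕ
  | nil => 0
  | node _ l r => max l.ht r.ht + 1

/-- No subtree other than `nil` is empty. -/
def Pruned : Trie α → Prop
  | nil => True
  | node o l r => l.Pruned ∧ r.Pruned ∧ (o ≠ none ∨ l ≠ nil ∨ r ≠ nil)

@[simp] theorem get_nil (k : List Bool) : get k (nil : Trie α) = none := by
  induction k with
  | nil => rfl
  | cons b k ih => cases b <;> simpa [get, left, right] using ih

@[simp] theorem slot_mk (o : Option α) (l r : Trie α) : (mk o l r).slot = o := by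
  cases o <;> cases l <;> cases r <;> rfl

@[simp] theorem left_mk (o : Option α) (l r : Trie α) : (mk o l r).left = l := by
  cases o <;> cases l <;> cases r <;> rfl

@[simp] theorem right_mk (o : Option α) (l r : Trie α) : (mk o l r).right = r := by
  cases o <;> cases l <;> cases r <;> rfl

theorem get_set (o : Option α) (k k' : List Bool) (t : Trie α) :
    get k' (set o k t) = if k' = k then o else get k' t := by
  induction k generalizing k' t with
  | nil =>
    cases k' with
    | nil => simp [set, get]
    | cons b k' => simp [set, get]
  | cons b k ih =>
    cases k' with
    | nil => simp [set, get]
    | cons b' k' => cases b <;> cases b' <;> simp [set, get, ih]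

theorem pruned_mk {o : Option α} {l r : Trie α} (hl : l.Pruned) (hr : r.Pruned) :
    (mk o l r).Pruned := by
  cases o <;> cases l <;> cases r <;> simp_all [mk, Pruned]

theorem Pruned.left {t : Trie α} (h : t.Pruned) : t.left.Pruned := by
  cases t with
  | nil => trivial
  | node => exact h.1

theorem Pruned.right {t : Trie α} (h : t.Pruned) : t.right.Pruned := by
  cases t with
  | nil => trivial
  | node => exact h.2.1

theorem Pruned.set {o : Option α} {k : List Bool} {t : Trie α} (h : t.Pruned) :
    (set o k t).Pruned := by
  induction k generalizing t with
  | nil => exact pruned_mk h.left h.right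
  | cons b k ih =>
    refine pruned_mk ?_ ?_ <;> split_ifs
    exacts [h.left, ih h.left, ih h.right, h.right]

/-- In a pruned trie emptiness is visible at the root, which gives a test in constant time. -/
theorem Pruned.toList_eq_nil {t : Trie α} (h : t.Pruned) : t.toList = [] ↔ t = nil := by
  induction t with
  | nil => simp [toList]
  | node o l r ihl ihr =>
    obtain ⟨h₁, h₂, h₃⟩ := h
    simp only [toList, List.append_eq_nil_iff, ihl h₁, ihr h₂, reduceCtorEq, iff_false]
    cases o with
    | none =>
      simp at h₃ ⊢
      tauto
    | some => simp

theorem mem_toList {x : α} {t : Trie α} : x ∈ t.toList ↔ ∃ k, t.get k = some x := by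
  induction t with
  | nil => simp [toList]
  | node o l r ihl ihr =>
    simp only [toList, List.mem_append, Option.mem_toList, ihl, ihr]
    constructor
    · rintro ((h | ⟨k, h⟩) | ⟨k, h⟩)
      · exact ⟨[], by simpa [get, slot] using h⟩
      · exact ⟨false :: k, by simpa [get, left] using h⟩
      · exact ⟨true :: k, by simpa [get, right] using h⟩
    · rintro ⟨_ | ⟨_ | _, k⟩, h⟩
      · exact .inl (.inl (by simpa [get, slot] using h))
      · exact .inl (.inr ⟨k, by simpa [get, left] using h⟩)
      · exact .inr ⟨k, by simpa [get, right] using h⟩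

theorem nodup_toList {t : Trie α}
    (h : ∀ k k' x, t.get k = some x → t.get k' = some x → k = k') : t.toList.Nodup := by
  induction t with
  | nil => simp [toList]
  | node o l r ihl ihr =>
    have hl : l.toList.Nodup := ihl fun k k' x h₁ h₂ => by
      simpa using h (false :: k) (false :: k') x h₁ h₂
    have hr : r.toList.Nodup := ihr fun k k' x h₁ h₂ => by
      simpa using h (true :: k) (true :: k') x h₁ h₂
    have ho : o.toList.Nodup := by cases o <;> simp
    simp only [toList]
    refine List.Nodup.append (List.Nodup.append ho hl ?_) hr ?_
    · intro x hx hx'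
      obtain ⟨k, hk⟩ := mem_toList.1 hx'
      simpa using h [] (false :: k) x (by simpa [get, slot] using hx) hk
    · intro x hx hx'
      obtain ⟨k, hk⟩ := mem_toList.1 hx'
      rcases List.mem_append.1 hx with hx | hx
      · simpa using h [] (true :: k) x (by simpa [get, slot] using hx) hk
      · obtain ⟨k', hk'⟩ := mem_toList.1 hx
        simpa using h (false :: k') (true :: k) x hk' hk

theorem nodes_mk_le (o : Option α) (l r : Trie α) :
    (mk o l r).nodes ≤ l.nodes + r.nodes + 1 := by
  cases o <;> cases l <;> cases r <;> simp [mk, nodes]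

theorem nodes_set_le (o : Option α) (k : List Bool) (t : Trie α) :
    (set o k t).nodes ≤ t.nodes + k.length + 1 := by
  induction k generalizing t with
  | nil =>
    refine (nodes_mk_le _ _ _).trans ?_
    cases t <;> simp [left, right, nodes]
  | cons b k ih =>
    have h₁ := ih t.left
    have h₂ := ih t.right
    refine (nodes_mk_le _ _ _).trans ?_
    cases b <;> cases t <;> simp [left, right, nodes] at h₁ h₂ ⊢ <;> omega

/-- Without a new entry, `mk` yields a node only where there was one before. Hence the cost of
listing a dictionary stays bounded by its initial number of nodes, however many deletions follow. -/
theorem nodes_set_none_le (k : List Bool) (t : Trie α) : (set none k t).nodes ≤ t.nodes := by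
  have key : ∀ (t : Trie α) (o : Option α) (l r : Trie α), (o ≠ none → t.slot ≠ none) →
      l.nodes ≤ t.left.nodes → r.nodes ≤ t.right.nodes → (mk o l r).nodes ≤ t.nodes := by
    intro t o l r ho hl hr
    cases t with
    | nil =>
      cases o <;> cases l <;> cases r <;> simp_all [mk, nodes, left, right, slot]
    | node o' l' r' =>
      refine (nodes_mk_le _ _ _).trans ?_
      simp only [left, right, nodes] at *
      omega
  induction k generalizing t with
  | nil => exact key _ _ _ _ (by simp) le_rfl le_rfl
  | cons b k ih => cases b <;> exact key _ _ _ _ (by simp) (by simp [ih]) (by simp [ih])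

theorem ht_mk_le (o : Option α) (l r : Trie α) : (mk o l r).ht ≤ max l.ht r.ht + 1 := by
  cases o <;> cases l <;> cases r <;> simp [mk, ht]

theorem ht_set_le (o : Option α) (k : List Bool) (t : Trie α) :
    (set o k t).ht ≤ max t.ht (k.length + 1) := by
  induction k generalizing t with
  | nil =>
    refine (ht_mk_le _ _ _).trans ?_
    cases t <;> simp [left, right, ht]
  | cons b k ih =>
    have h₁ := ih t.left
    have h₂ := ih t.right
    refine (ht_mk_le _ _ _).trans ?_
    cases b <;> cases t <;> simp [left, right, ht] at h₁ h₂ ⊢ <;> omega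

end Trie

/-! ## Nested tries -/

/-- A nested trie. A node holds a structure of the next level and two subtrees of its own level. -/
inductive Nest (α : Type) where
  | nil : Nest α
  | base (tA tB : Trie α) : Nest α
  | node (sec l r : Nest α) : Nest α

/-- A bound for the number of places that are visited on the way along the given codes. -/
def pathNodes (n₀ : ℕ) : List (List Bool) → ℕ
  | [] => n₀
  | [] :: _ => 1
  | (_ :: c) :: cs => 1 + pathNodes n₀ cs + pathNodes n₀ (c :: cs)
  termination_by cs => (cs.map List.length).sum + cs.length
  decreasing_by all_goals (simp; try omega)

/-- The item with the given codes belongs to the given position. -/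
def Matches (side : Bool) (pos codes : List (List Bool)) : Prop :=
  List.Forall₂ (fun p c => (p ++ [side]) <+: c) pos codes

/-- In each coordinate the position is the place where the two paths part. -/
theorem matches_unique {pos pos' ca cb : List (List Bool)} (h₁ : Matches true pos ca)
    (h₂ : Matches false pos cb) (h₃ : Matches true pos' ca) (h₄ : Matches false pos' cb) :
    pos = pos' := by
  induction h₁ generalizing pos' cb with
  | nil => cases h₃; rfl
  | cons h hs ih =>
    cases h₂ with
    | cons g gs =>
      cases h₃ with
      | cons h' hs' =>
        cases h₄ with
        | cons g' gs' => rw [eq_of_prefix_of_prefix h g h' g', ih gs hs' gs']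

/-- Each of the at most `h` nodes on the path of one level opens at most one structure of the next
level, so every level contributes a factor of order `h`. -/
theorem pathNodes_le {n₀ h : ℕ} (hn : 1 ≤ n₀) (cs : List (List Bool))
    (hcs : ∀ c ∈ cs, c.length ≤ h) : pathNodes n₀ cs ≤ n₀ * (2 * h + 2) ^ cs.length := by
  induction cs with
  | nil => simp [pathNodes]
  | cons c cs ih =>
    have ih := ih fun c hc => hcs c (by simp [hc])
    have hc : c.length ≤ h := hcs c (by simp)
    set X := n₀ * (2 * h + 2) ^ cs.length with hX
    -- `X` bounds the work in one structure of the next level; `1 ≤ X` absorbs the additive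
    -- constants into the factor `2 * h + 2`.
    have hX1 : 1 ≤ X := Nat.mul_pos hn (by positivity)
    have key : ∀ c : List Bool, pathNodes n₀ (c :: cs) ≤ 1 + c.length * (1 + X) := by
      intro c
      induction c with
      | nil => simp [pathNodes]
      | cons b c ihc =>
        rw [pathNodes, List.length_cons]
        linarith
    refine (key c).trans ?_
    rw [List.length_cons, pow_succ]
    calc 1 + c.length * (1 + X) ≤ 1 + h * (1 + X) := by gcongr
      _ ≤ X + h * (X + X) := by gcongr
      _ ≤ X * (2 * h + 2) := by nlinarith
      _ = _ := by rw [hX]; ring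

namespace Nest
variable {α : Type}

/-- The structure is at the given level. -/
def WF : ℕ → Nest α → Prop
  | _, nil => True
  | m, base tA tB => m = 0 ∧ tA.Pruned ∧ tB.Pruned
  | m, node sec l r => m ≠ 0 ∧ sec.WF (m - 1) ∧ l.WF m ∧ r.WF m

def get : Nest α → List (List Bool) → Bool → List Bool → Option α
  | base tA tB, [], side, id => if side then tA.get id else tB.get id
  | node sec _ _, [] :: pos, side, id => sec.get pos side id
  | node _ l r, (b :: p) :: pos, side, id => if b then r.get (p :: pos) side id
      else l.get (p :: pos) side id
  | _, _, _, _ => none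

def sec : Nest α → Nest α
  | node s _ _ => s
  | _ => nil

def left : Nest α → Nest α
  | node _ l _ => l
  | _ => nil

def right : Nest α → Nest α
  | node _ _ r => r
  | _ => nil

def baseA : Nest α → Trie α
  | base tA _ => tA
  | _ => .nil

def baseB : Nest α → Trie α
  | base _ tB => tB
  | _ => .nil

/-- Change the entry `id` at all positions that the codes match. -/
def upd (side : Bool) (id : List Bool) (o : Option α) : List (List Bool) → Nest α → Nest α
  | [], v => base (if side then v.baseA.set o id else v.baseA)
      (if side then v.baseB else v.baseB.set o id)
  | [] :: _, v => v
  -- An item enters the structure of the next level exactly where it turns to its own side: right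
  -- for a point, left for a box.
  | (b :: c) :: cs, v => node (if b = side then upd side id o cs v.sec else v.sec)
      (if b then v.left else upd side id o (c :: cs) v.left)
      (if b then upd side id o (c :: cs) v.right else v.right)
  termination_by cs => (cs.map List.length).sum + cs.length
  decreasing_by all_goals (simp; try omega)

/-- The list of all pairs, of a point and a box, that meet somewhere. -/
def outs : Nest α → List (α × α)
  | nil => []
  | base tA tB => tA.toList.flatMap fun x => tB.toList.map fun y => (x, y)
  | node sec l r => sec.outs ++ l.outs ++ r.outs

/-- There is some output. -/
def ne : Nest α → Bool
  | nil => false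
  | base .nil _ => false
  | base _ .nil => false
  | base _ _ => true
  | node sec l r => sec.ne || l.ne || r.ne

/-- At the bottom the heights of both tries are added, since the search for one output may descend
in the first and then in the second. The summand 2 makes every expansion of a stack frame lower the
height strictly. -/
def ht : Nest α → ℕ
  | nil => 0
  | base tA tB => tA.ht + tB.ht + 2
  | node sec l r => max sec.ht (max l.ht r.ht) + 1

/-- The tries at the bottom have height at most `g`. -/
def BaseLe (g : ℕ) : Nest α → Prop
  | nil => True
  | base tA tB => tA.ht ≤ g ∧ tB.ht ≤ g
  | node sec l r => sec.BaseLe g ∧ l.BaseLe g ∧ r.BaseLe g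

@[simp] theorem get_nil (pos : List (List Bool)) (side : Bool) (id : List Bool) :
    get (nil : Nest α) pos side id = none := by
  unfold get; rfl

/-- This includes `nil`, whose parts are `nil`, so that an update can lay out missing nodes as it
goes. -/
theorem WF.parts {m : ℕ} {v : Nest α} (h : v.WF (m + 1)) :
    v.sec.WF m ∧ v.left.WF (m + 1) ∧ v.right.WF (m + 1) := by
  cases v with
  | nil => simp [sec, left, right, WF]
  | base => simp [WF] at h
  | node => simpa [sec, left, right, WF] using h

theorem WF.upd {side : Bool} {id : List Bool} {o : Option α} {cs : List (List Bool)} {v : Nest α}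
    (h : v.WF cs.length) : (v.upd side id o cs).WF cs.length := by
  induction cs generalizing v with
  | nil =>
    cases v with
    | nil =>
      have : (Trie.nil : Trie α).Pruned := trivial
      cases side <;> simp [Nest.upd, WF, baseA, baseB, this.set, this]
    | base =>
      obtain ⟨_, h₁, h₂⟩ := h
      cases side <;> simp [Nest.upd, WF, baseA, baseB, h₁.set, h₂.set, h₁, h₂]
    | node => simp [WF] at h
  | cons c cs ih =>
    induction c generalizing v with
    | nil => simpa [Nest.upd] using h
    | cons b c ihc =>
      obtain ⟨h₁, h₂, h₃⟩ := WF.parts h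
      have h₁' := ih h₁
      have h₂' := ihc h₂
      have h₃' := ihc h₃
      simp only [List.length_cons] at h₂' h₃' ⊢
      rw [Nest.upd]
      refine ⟨by simp, ?_, ?_, ?_⟩ <;> split_ifs <;> assumption

/-- The full functional specification of `upd`. The induction runs over the levels and, within a
level, over the bits of the first code. -/
theorem get_upd {side side' : Bool} {id id' : List Bool} {o : Option α} {cs pos : List (List Bool)}
    {v : Nest α} (h : v.WF cs.length) [Decidable (side' = side ∧ id' = id ∧ Matches side pos cs)] :
    (v.upd side id o cs).get pos side' id' =
      if side' = side ∧ id' = id ∧ Matches side pos cs then o else v.get pos side' id' := by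
  classical
  induction cs generalizing v pos with
  | nil =>
    cases pos with
    | nil =>
      have : Matches side [] [] := .nil
      simp only [this, and_true]
      cases v with
      | nil => cases side <;> cases side' <;> simp [Nest.upd, get, baseA, baseB, Trie.get_set]
      | base => cases side <;> cases side' <;> simp [Nest.upd, get, baseA, baseB, Trie.get_set]
      | node => simp [WF] at h
    | cons p pos =>
      have : ¬ Matches side (p :: pos) [] := fun h => by cases h
      simp only [this, and_false, if_false]
      cases v with
      | nil => simp [Nest.upd, get]
      | base => simp [Nest.upd, get]
      | node => simp [WF] at h
  | cons c cs ih =>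
    induction c generalizing v pos with
    | nil =>
      have : ¬ Matches side pos ([] :: cs) := fun h => by cases h; simp_all
      simp [Nest.upd, this]
    | cons b c ihc =>
      obtain ⟨h₁, h₂, h₃⟩ := WF.parts h
      rw [Nest.upd]
      -- Reading from `nil` gives the same as reading from a node with three empty parts, so `v` may
      -- be treated as a node.
      have hv : v.get pos side' id' = (node v.sec v.left v.right).get pos side' id' := by
        cases v with
        | nil =>
          rcases pos with _ | ⟨_ | ⟨b, p⟩, pos⟩ <;> simp [get, sec, left, right]
        | base => simp [WF] at h
        | node => rfl
      rw [hv]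
      rcases pos with _ | ⟨_ | ⟨b', p⟩, pos⟩
      · have : ¬ Matches side [] ((b :: c) :: cs) := fun h => by cases h
        simp [get, this]
      · have : Matches side ([] :: pos) ((b :: c) :: cs) ↔ b = side ∧ Matches side pos cs := by
          simp [Matches, List.forall₂_cons, eq_comm]
        simp only [get]
        by_cases hb : b = side
        · rw [if_pos hb, ih h₁]
          refine if_congr ?_ rfl rfl
          rw [this]
          tauto
        · simp [this, hb]
      · have : Matches side ((b' :: p) :: pos) ((b :: c) :: cs) ↔
            b' = b ∧ Matches side (p :: pos) (c :: cs) := by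
          simp [Matches, List.forall₂_cons, List.cons_prefix_cons, and_assoc]
        simp only [get, this]
        cases b <;> cases b' <;> simp [ihc h₂, ihc h₃]

theorem WF.length_eq {m : ℕ} {v : Nest α} (h : v.WF m) {pos : List (List Bool)} {side : Bool}
    {id : List Bool} {x : α} (hx : v.get pos side id = some x) : pos.length = m := by
  induction v generalizing m pos with
  | nil => simp at hx
  | base =>
    cases pos with
    | nil => exact h.1.symm
    | cons => simp [get] at hx
  | node s l r ihs ihl ihr =>
    obtain ⟨hm, hs, hl, hr⟩ := h
    rcases pos with _ | ⟨_ | ⟨_ | _, p⟩, pos⟩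
    · simp [get] at hx
    · have := ihs hs hx
      simp only [List.length_cons]
      omega
    · simpa using ihl hl (pos := p :: pos) (by simpa [get] using hx)
    · simpa using ihr hr (pos := p :: pos) (by simpa [get] using hx)

theorem mem_outs {m : ℕ} {v : Nest α} (hv : v.WF m) {x y : α} : (x, y) ∈ v.outs ↔
    ∃ pos id id', v.get pos true id = some x ∧ v.get pos false id' = some y := by
  induction v generalizing m with
  | nil => simp [outs]
  | base tA tB =>
    simp only [outs, List.mem_flatMap, List.mem_map, Trie.mem_toList, Prod.mk.injEq]
    constructor
    · rintro ⟨_, ⟨k, hk⟩, _, ⟨k', hk'⟩, rfl, rfl⟩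
      exact ⟨[], k, k', by simpa [get] using hk, by simpa [get] using hk'⟩
    · rintro ⟨_ | _, k, k', hk, hk'⟩
      · exact ⟨x, ⟨k, by simpa [get] using hk⟩, y, ⟨k', by simpa [get] using hk'⟩, rfl, rfl⟩
      · simp [get] at hk
  | node s l r ihs ihl ihr =>
    obtain ⟨hm, hs, hl, hr⟩ := hv
    simp only [outs, List.mem_append, ihs hs, ihl hl, ihr hr]
    constructor
    · rintro ((⟨pos, h⟩ | ⟨pos, k, k', h, h'⟩) | ⟨pos, k, k', h, h'⟩)
      · exact ⟨[] :: pos, by simpa [get] using h⟩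
      · cases pos with
        | nil => exact absurd (hl.length_eq h).symm hm
        | cons p pos => exact ⟨(false :: p) :: pos, k, k', by simpa [get] using ⟨h, h'⟩⟩
      · cases pos with
        | nil => exact absurd (hr.length_eq h).symm hm
        | cons p pos => exact ⟨(true :: p) :: pos, k, k', by simpa [get] using ⟨h, h'⟩⟩
    · rintro ⟨_ | ⟨_ | ⟨_ | _, p⟩, pos⟩, k, k', h, h'⟩
      · simp [get] at h
      · exact .inl (.inl ⟨pos, k, k', by simpa [get] using ⟨h, h'⟩⟩)
      · exact .inl (.inr ⟨p :: pos, k, k', by simpa [get] using ⟨h, h'⟩⟩)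
      · exact .inr ⟨p :: pos, k, k', by simpa [get] using ⟨h, h'⟩⟩

/-- By `h₁` no item is repeated within a bottom trie; by `h₂` two items meet at no more than one
position. The three parts of a node contribute positions that begin differently, so their outputs
are disjoint. -/
theorem nodup_outs {m : ℕ} {v : Nest α} (hv : v.WF m)
    (h₁ : ∀ pos side id id' x, v.get pos side id = some x → v.get pos side id' = some x → id = id')
    (h₂ : ∀ pos pos' i j i' j' x y, v.get pos true i = some x → v.get pos false j = some y →
      v.get pos' true i' = some x → v.get pos' false j' = some y → pos = pos') :
    v.outs.Nodup := by
  induction v generalizing m with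
  | nil => simp [outs]
  | base tA tB =>
    have hA : tA.toList.Nodup := Trie.nodup_toList fun k k' x h h' => by
      simpa using h₁ [] true k k' x (by simpa [get] using h) (by simpa [get] using h')
    have hB : tB.toList.Nodup := Trie.nodup_toList fun k k' x h h' => by
      simpa using h₁ [] false k k' x (by simpa [get] using h) (by simpa [get] using h')
    exact List.Nodup.product hA hB
  | node s l r ihs ihl ihr =>
    obtain ⟨hm, hs, hl, hr⟩ := hv
    have hs' : s.outs.Nodup := ihs hs
      (fun pos side id id' x h h' => h₁ ([] :: pos) side id id' x (by simpa [get] using h)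
        (by simpa [get] using h'))
      (fun pos pos' i j i' j' x y h h' g g' => by
        simpa using h₂ ([] :: pos) ([] :: pos') i j i' j' x y (by simpa [get] using h)
          (by simpa [get] using h') (by simpa [get] using g) (by simpa [get] using g'))
    -- A position in a child becomes a position of the node by putting the branch bit in front; both
    -- hypotheses are inherited by the children in this way.
    have sub : ∀ (b : Bool) {pos side id x}, (if b then r else l).get pos side id = some x →
        ∃ p ps, pos = p :: ps ∧ (node s l r).get ((b :: p) :: ps) side id = some x := by
      intro b pos side id x h
      cases pos with
      | nil => cases b <;> simp at h <;> [exact absurd (hl.length_eq h).symm hm;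
          exact absurd (hr.length_eq h).symm hm]
      | cons p ps => exact ⟨p, ps, rfl, by cases b <;> simpa [get] using h⟩
    have ch : ∀ b : Bool, (∀ pos side id id' x, (if b then r else l).get pos side id = some x →
          (if b then r else l).get pos side id' = some x → id = id') ∧
        ∀ pos pos' i j i' j' x y, (if b then r else l).get pos true i = some x →
          (if b then r else l).get pos false j = some y →
          (if b then r else l).get pos' true i' = some x →
          (if b then r else l).get pos' false j' = some y → pos = pos' := by
      intro b
      constructor
      · intro pos side id id' x h h'
        obtain ⟨p, ps, rfl, e₁⟩ := sub b h
        obtain ⟨p', ps', e, e₂⟩ := sub b h'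
        cases e
        exact h₁ _ _ _ _ _ e₁ e₂
      · intro pos pos' i j i' j' x y h h' g g'
        obtain ⟨p, ps, rfl, e₁⟩ := sub b h
        obtain ⟨p', ps', e, e₂⟩ := sub b h'
        cases e
        obtain ⟨q, qs, rfl, e₃⟩ := sub b g
        obtain ⟨q', qs', e, e₄⟩ := sub b g'
        cases e
        simpa using h₂ _ _ _ _ _ _ _ _ e₁ e₂ e₃ e₄
    have hl' : l.outs.Nodup := ihl hl (by simpa using (ch false).1) (by simpa using (ch false).2)
    have hr' : r.outs.Nodup := ihr hr (by simpa using (ch true).1) (by simpa using (ch true).2)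
    simp only [outs]
    refine List.Nodup.append (List.Nodup.append hs' hl' ?_) hr' ?_
    · rintro ⟨x, y⟩ h h'
      obtain ⟨pos, i, j, h, g⟩ := (mem_outs hs).1 h
      obtain ⟨pos', i', j', h', g'⟩ := (mem_outs hl).1 h'
      obtain ⟨p, ps, rfl, e₁⟩ := sub false (by simpa using h')
      obtain ⟨_, _, e, e₂⟩ := sub false (by simpa using g')
      cases e
      simpa using h₂ ([] :: pos) _ i j i' j' x y (by simpa [get] using h)
        (by simpa [get] using g) e₁ e₂
    · rintro ⟨x, y⟩ h h'
      obtain ⟨pos', i', j', h', g'⟩ := (mem_outs hr).1 h'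
      obtain ⟨p, ps, rfl, e₁⟩ := sub true (by simpa using h')
      obtain ⟨_, _, e, e₂⟩ := sub true (by simpa using g')
      cases e
      rcases List.mem_append.1 h with h | h
      · obtain ⟨pos, i, j, h, g⟩ := (mem_outs hs).1 h
        simpa using h₂ ([] :: pos) _ i j i' j' x y (by simpa [get] using h)
          (by simpa [get] using g) e₁ e₂
      · obtain ⟨pos, i, j, h, g⟩ := (mem_outs hl).1 h
        obtain ⟨q, qs, rfl, e₃⟩ := sub false (by simpa using h)
        obtain ⟨_, _, e, e₄⟩ := sub false (by simpa using g)
        cases e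
        simpa using h₂ _ _ _ _ _ _ _ _ e₃ e₄ e₁ e₂

/-- The local test for emptiness is exact because the bottom tries are pruned. -/
theorem ne_iff {m : ℕ} {v : Nest α} (hv : v.WF m) : v.ne = true ↔ v.outs ≠ [] := by
  induction v generalizing m with
  | nil => simp [ne, outs]
  | base tA tB =>
    obtain ⟨_, hA, hB⟩ := hv
    have hA := hA.toList_eq_nil
    have hB := hB.toList_eq_nil
    cases tA with
    | nil => simp [ne, outs, Trie.toList]
    | node oA lA rA =>
      cases tB with
      | nil => simp [ne, outs, Trie.toList]
      | node oB lB rB =>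
        simp only [ne, outs, ne_eq, List.flatMap_eq_nil_iff, List.map_eq_nil_iff, hB,
          true_iff, not_forall, reduceCtorEq, exists_prop, not_false_eq_true, and_true]
        simpa using List.exists_mem_of_ne_nil _ (mt hA.1 (by simp))
  | node s l r ihs ihl ihr =>
    obtain ⟨hm, hs, hl, hr⟩ := hv
    simp only [ne, Bool.or_eq_true, ihs hs, ihl hl, ihr hr, outs]
    simp only [ne_eq, List.append_eq_nil_iff]
    tauto

theorem BaseLe.upd {g : ℕ} {side : Bool} {id : List Bool} {o : Option α} {cs : List (List Bool)}
    {v : Nest α} (hv : v.BaseLe g) (hg : id.length + 1 ≤ g) : (v.upd side id o cs).BaseLe g := by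
  induction cs generalizing v with
  | nil =>
    have hA := Trie.ht_set_le o id v.baseA
    have hB := Trie.ht_set_le o id v.baseB
    have : v.baseA.ht ≤ g ∧ v.baseB.ht ≤ g := by
      cases v <;> simp_all [baseA, baseB, BaseLe, Trie.ht]
    simp only [Nest.upd, BaseLe]
    cases side <;> simp <;> omega
  | cons c cs ih =>
    induction c generalizing v with
    | nil => simpa [Nest.upd]
    | cons b c ihc =>
      have : v.sec.BaseLe g ∧ v.left.BaseLe g ∧ v.right.BaseLe g := by
        cases v <;> simp_all [sec, left, right, BaseLe]
      rw [Nest.upd, BaseLe]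
      refine ⟨?_, ?_, ?_⟩ <;> split_ifs
      exacts [ih this.1, this.1, this.2.1, ihc this.2.1, ihc this.2.2, this.2.2]

/-- A maximum and not a sum, so that heights do not accumulate over a sequence of updates. -/
theorem ht_upd_le {g : ℕ} (side : Bool) {id : List Bool} (o : Option α) (cs : List (List Bool))
    {v : Nest α} (hv : v.BaseLe g) (hg : id.length + 1 ≤ g) :
    (v.upd side id o cs).ht ≤ max v.ht ((cs.map List.length).sum + 2 * g + 2) := by
  induction cs generalizing v with
  | nil =>
    have hA := Trie.ht_set_le o id v.baseA
    have hB := Trie.ht_set_le o id v.baseB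
    have : v.baseA.ht ≤ g ∧ v.baseB.ht ≤ g := by
      cases v <;> simp_all [baseA, baseB, BaseLe, Trie.ht]
    simp only [Nest.upd, ht]
    cases side <;> simp <;> omega
  | cons c cs ih =>
    induction c generalizing v with
    | nil => simp [Nest.upd]
    | cons b c ihc =>
      have : v.sec.BaseLe g ∧ v.left.BaseLe g ∧ v.right.BaseLe g := by
        cases v <;> simp_all [sec, left, right, BaseLe]
      have h₁ := ih this.1
      have h₂ := ihc this.2.1
      have h₃ := ihc this.2.2
      have : v.sec.ht ≤ v.ht - 1 ∧ v.left.ht ≤ v.ht - 1 ∧ v.right.ht ≤ v.ht - 1 := by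
        cases v <;> simp [sec, left, right, ht]
      simp only [List.map_cons, List.sum_cons, List.length_cons] at h₂ h₃ ⊢
      rw [Nest.upd, ht]
      split_ifs <;> omega

end Nest
end DynJoin

namespace DynJoin

/-! ## The program -/

namespace Code
open DynJoin.Expr

/-- A datum that is not `nil`, for `true`. -/
def tt : Expr := pair nil nil

/-- Open a cell. -/
def cell (e body : Expr) : Expr := split e nil body

def fst (e : Expr) : Expr := split e nil (var 0)
def snd (e : Expr) : Expr := split e nil (var 1)
-- On a trie `(slot, (l, r))` and on a bottom structure `(flag, (tA, tB))`, `left` and `right` are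
-- the last two parts. On a node `(flag, (sec, (l, r)))`, `left` is the structure of the next level,
-- and the primed versions are the subtrees.
def left (e : Expr) : Expr := fst (snd e)
def right (e : Expr) : Expr := snd (snd e)
def left' (e : Expr) : Expr := fst (snd (snd e))
def right' (e : Expr) : Expr := snd (snd (snd e))

/-- The first component of a cell satisfies `k`, where `nil` has the components `nil`. -/
def fstK (v : Val) (k : Val → Prop) : Prop :=
  match v with
  | .nil => k .nil
  | .pair a _ => k a
  | .real _ => False

/-- The second component of a cell satisfies `k`, where `nil` has the components `nil`. -/
def sndK (v : Val) (k : Val → Prop) : Prop :=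
  match v with
  | .nil => k .nil
  | .pair _ b => k b
  | .real _ => False

@[simp] theorem fstK_nil {k : Val → Prop} : fstK .nil k = k .nil := rfl
@[simp] theorem fstK_pair {k : Val → Prop} {a b : Val} : fstK (.pair a b) k = k a := rfl
@[simp] theorem sndK_nil {k : Val → Prop} : sndK .nil k = k .nil := rfl
@[simp] theorem sndK_pair {k : Val → Prop} {a b : Val} : sndK (.pair a b) k = k b := rfl

@[simp] theorem WP_fst {P : List Expr} {ρ : List Val} {e : Expr} {k : Val → ℕ → Prop} :
    WP P ρ (fst e) k ↔ WP P ρ e fun v t => fstK v fun a => k a (t + 2) := by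
  simp only [fst, WP_split]
  refine exists_congr fun v => ?_
  cases v <;> simp [fstK, splitK, add_assoc]

@[simp] theorem WP_snd {P : List Expr} {ρ : List Val} {e : Expr} {k : Val → ℕ → Prop} :
    WP P ρ (snd e) k ↔ WP P ρ e fun v t => sndK v fun a => k a (t + 2) := by
  simp only [snd, WP_split]
  refine exists_congr fun v => ?_
  cases v <;> simp [sndK, splitK, add_assoc]

/-- Indices into the function table; their order has to agree with the list `prog`. -/
abbrev keyA := 0
abbrev keyB := 1
abbrev code := 2
abbrev codes := 3
abbrev mk := 4
abbrev tset := 5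
abbrev tget := 6
abbrev flat := 7
abbrev mkBase := 8
abbrev mkNode := 9
abbrev upd := 10
abbrev halve := 11
abbrev merge := 12
abbrev sort := 13
abbrev bst := 14
abbrev keysOf := 15
abbrev col := 16
abbrev skel := 17
abbrev eqk := 18
abbrev lookup := 19
abbrev find := 20
abbrev low := 21
abbrev del := 22
abbrev mapLow := 23
abbrev mapDel := 24
abbrev add := 25
abbrev addAll := 26
abbrev build := 27
abbrev flatAll := 28
abbrev inc := 29
abbrev label := 30
abbrev slots := 31
abbrev full := 32
abbrev tick := 33
abbrev rebuild := 34
abbrev finish := 35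
abbrev ins := 36
abbrev rem := 37
abbrev el := 38
abbrev wrap := 39
abbrev frames := 40
abbrev next := 41

/-- The argument is a parameter and the list of coordinates of a point. -/
def bKeyA : Expr :=
  cell (var 0) <| cell (var 1) <|
    pair (var 0) (pair (sub zero (var 0)) (call keyA (pair (var 2) (var 1))))

/-- The argument is a side, a key and a search tree. -/
def bCode : Expr :=
  cell (var 0) <| cell (var 1) <| cell (var 1) <| cell (var 1) <|
    split (var 6)
      (ifLE (var 4) (var 2) (pair nil (call code (pair (var 6) (pair (var 4) (var 0)))))
        (pair tt (call code (pair (var 6) (pair (var 4) (var 1))))))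
      (ifLE (var 4) (var 6) (pair tt (call code (pair (var 8) (pair (var 6) (var 3)))))
        (pair nil (call code (pair (var 8) (pair (var 6) (var 2))))))

/-- The argument is a side, a list of keys and a list of search trees. -/
def bCodes : Expr :=
  cell (var 0) <| cell (var 1) <| cell (var 0) <|
    split (var 3)
      (pair nil (call codes (pair (var 4) (pair (var 1) nil))))
      (pair (call code (pair (var 6) (pair (var 2) (var 0))))
        (call codes (pair (var 6) (pair (var 3) (var 1)))))

/-- The argument is an entry and two tries. -/
def bMk : Expr :=
  cell (var 0) <| cell (var 1) <|
    split (var 2)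
      (split (var 0)
        (split (var 1) nil (pair (var 4) (pair (var 2) (var 3))))
        (pair (var 4) (pair (var 2) (var 3))))
      (pair (var 4) (pair (var 2) (var 3)))

/-- The argument is a trie, a list of codes and an entry. -/
def bTset : Expr :=
  cell (var 0) <| cell (var 1) <|
    split (var 0)
      (call mk (pair (var 1) (pair (left (var 2)) (right (var 2))))) <|
    split (var 0)
      (call tset (pair (var 4) (pair (var 1) (var 3)))) <|
    split (var 0)
      (call mk (pair (fst (var 6)) (pair
        (call tset (pair (left (var 6)) (pair (pair (var 1) (var 3)) (var 5)))) (right (var 6)))))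
      (call mk (pair (fst (var 8)) (pair (left (var 8))
        (call tset (pair (right (var 8)) (pair (pair (var 3) (var 5)) (var 7)))))))

/-- The argument is a trie and a list of codes. -/
def bTget : Expr :=
  cell (var 0) <|
    split (var 1) (fst (var 0)) <|
    split (var 0) (call tget (pair (var 2) (var 1))) <|
    split (var 0)
      (call tget (pair (left (var 4)) (pair (var 1) (var 3))))
      (call tget (pair (right (var 6)) (pair (var 3) (var 5))))

/-- The argument is a trie and a list, to which the entries of the trie are added. -/
def bFlat : Expr :=
  cell (var 0) <|
    split (var 0) (var 1) <|
    cell (var 1) <|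
    bind (call flat (pair (var 1) (var 5))) <|
    bind (call flat (pair (var 1) (var 0))) <|
    split (var 4) (var 0) (pair (var 6) (var 2))

/-- The argument are two tries. -/
def bMkBase : Expr :=
  cell (var 0) <|
    split (var 0) (pair nil (pair (var 0) (var 1))) <|
    split (var 3) (pair nil (pair (var 2) (var 3))) <|
    pair (pair tt nil) (pair (var 4) (var 5))

/-- The argument are three nested tries. -/
def bMkNode : Expr :=
  cell (var 0) <| cell (var 1) <|
    pair (split (fst (var 2)) (split (fst (var 0)) (split (fst (var 1)) nil tt) tt) tt)
      (pair (var 2) (pair (var 0) (var 1)))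

/-- The argument is a nested trie, a list of codes, a side, the code of an identifier, an entry. -/
def bUpd : Expr :=
  cell (var 0) <| cell (var 1) <|
    split (var 0)
      (cell (var 1) <| cell (var 1) <|
        split (var 2)
          (call mkBase (pair (left (var 6))
            (call tset (pair (right (var 6)) (pair (var 0) (var 1))))))
          (call mkBase (pair (call tset (pair (left (var 8)) (pair (var 2) (var 3))))
            (right (var 8))))) <|
    split (var 0) (var 4) <|
    split (var 0)
      (call mkNode (pair
        (split (fst (var 5))
          (call upd (pair (left (var 6)) (pair (var 3) (var 5)))) (left (var 8)))
        (pair (call upd (pair (left' (var 6)) (pair (pair (var 1) (var 3)) (var 5))))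
          (right' (var 6)))))
      (call mkNode (pair
        (split (fst (var 7)) (left (var 8))
          (call upd (pair (left (var 10)) (pair (var 7) (var 9)))))
        (pair (left' (var 8))
          (call upd (pair (right' (var 8)) (pair (pair (var 3) (var 5)) (var 7)))))))

/-- The argument is a list, which is divided evenly. -/
def bHalve : Expr :=
  split (var 0) (pair nil nil) <|
    bind (call halve (var 1)) <| cell (var 0) <| pair (pair (var 3) (var 1)) (var 0)

/-- The argument are two sorted lists. -/
def bMerge : Expr :=
  cell (var 0) <|
    split (var 0) (var 1) <|
    split (var 3) (var 2) <|
    ifLE (var 2) (var 0)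
      (pair (var 2) (call merge (pair (var 3) (var 5))))
      (pair (var 0) (call merge (pair (var 4) (var 1))))

/-- The argument is a list of reals. -/
def bSort : Expr :=
  split (var 0) nil <|
    split (var 1) (var 2) <|
    bind (call halve (var 4)) <| cell (var 0) <|
    call merge (pair (call sort (var 0)) (call sort (var 1)))

/-- The argument is a list and a sorted list of reals. The result is a search tree for the first
reals of the latter, as many as the former has elements, and the rest. -/
def bBst : Expr :=
  cell (var 0) <|
    split (var 0) (pair nil (var 1)) <|
    bind (call halve (var 1)) <| cell (var 0) <|
    bind (call bst (pair (var 0) (var 6))) <| cell (var 0) <| cell (var 1) <|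
    bind (call bst (pair (var 6) (var 1))) <| cell (var 0) <|
    pair (pair (var 3) (pair (var 5) (var 0))) (var 1)

/-- The argument is a list of items. -/
def bKeysOf : Expr :=
  split (var 0) nil (pair (fst (snd (fst (var 0)))) (call keysOf (var 1)))

/-- The argument is a list of lists, the result are the heads and the tails. -/
def bCol : Expr :=
  split (var 0) (pair nil nil) <|
    split (var 0) (pair nil nil) <|
    bind (call col (var 3)) <| cell (var 0) <|
    pair (pair (var 3) (var 0)) (pair (var 4) (var 1))

/-- The argument is a list of lists of keys. -/
def bSkel : Expr :=
  split (var 0) nil <|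
    split (var 0) nil <|
    bind (call col (var 4)) <| cell (var 0) <|
    bind (call sort (var 0)) <|
    pair (fst (call bst (pair (var 0) (var 0)))) (call skel (var 2))

/-- The argument are two lists of reals. -/
def bEqk : Expr :=
  cell (var 0) <|
    split (var 0) tt <|
    cell (var 3) <|
    ifLE (var 2) (var 0) (ifLE (var 0) (var 2) (call eqk (pair (var 3) (var 1))) nil) nil

/-- Accessors for an element `(side, (keys, payload))`, followed by those for a structure
`(skeleton, (dictionary, (P, Q)))`. -/
def side (e : Expr) : Expr := fst e
def keys (e : Expr) : Expr := fst (snd e)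
def pay (e : Expr) : Expr := snd (snd e)
def wU (e : Expr) : Expr := fst e
def wD (e : Expr) : Expr := fst (snd e)
def wP (e : Expr) : Expr := fst (snd (snd e))
def wQ (e : Expr) : Expr := snd (snd (snd e))

/-- The codes of the element `e` with respect to the structure `w`. -/
def codesOf (w e : Expr) : Expr := call codes (pair (side e) (pair (keys e) (wU w)))

/-- The argument is a structure and an element. -/
def bLookup : Expr :=
  cell (var 0) <|
    bind (call tget (pair (wD (var 0))
      (pair (pair (side (var 1)) nil) (codesOf (var 0) (var 1))))) <|
    split (var 0) nil <|
    split (call eqk (pair (keys (var 0)) (keys (var 4)))) nil (var 4)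

/-- The argument is a list of optional structures and an element. -/
def bFind : Expr :=
  cell (var 0) <|
    split (var 0) nil <|
    split (var 0) (call find (pair (var 1) (var 3))) <|
    bind (call lookup (pair (var 2) (var 5))) <|
    split (var 0) (call find (pair (var 4) (var 6))) (var 2)

/-- The argument is a structure and an item. -/
def bLow : Expr :=
  cell (var 0) <|
    bind (codesOf (var 0) (fst (var 1))) <|
    bind (pair (side (fst (var 2))) (pair (pair (snd (var 2)) nil) (var 2))) <|
    split (fst (var 0))
      (pair (wU (var 2)) (pair (wD (var 2)) (pair (wP (var 2))
        (call upd (pair (wQ (var 2)) (pair (var 1) (var 0)))))))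
      (pair (wU (var 4)) (pair (wD (var 4)) (pair
        (call upd (pair (wP (var 4)) (pair (var 3) (var 2)))) (wQ (var 4)))))

/-- The argument is a structure and an item. -/
def bDel : Expr :=
  cell (var 0) <|
    bind (codesOf (var 0) (fst (var 1))) <|
    bind (pair (side (fst (var 2))) (pair (pair (snd (var 2)) nil) nil)) <|
    pair (wU (var 2)) (pair
      (split (call lookup (pair (var 2) (fst (var 3)))) (wD (var 2))
        (call tset (pair (wD (var 4)) (pair (pair (pair (fst (var 2)) nil) (var 3)) nil))))
      (pair (call upd (pair (wP (var 2)) (pair (var 1) (var 0))))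
        (call upd (pair (wQ (var 2)) (pair (var 1) (var 0))))))

/-- The argument is a list of optional structures and an item. -/
def bMap (self f : ℕ) : Expr :=
  cell (var 0) <|
    split (var 0) nil <|
    split (var 0) (pair nil (call self (pair (var 1) (var 3))))
      (pair (call f (pair (var 2) (var 5))) (call self (pair (var 3) (var 5))))

/-- The argument is a structure and an item. -/
def bAdd : Expr :=
  cell (var 0) <|
    bind (codesOf (var 0) (fst (var 1))) <|
    bind (pair (side (fst (var 2))) (pair (pair (snd (var 2)) nil) (var 2))) <|
    pair (wU (var 2)) (pair
      (call tset (pair (wD (var 2)) (pair (pair (pair (fst (var 0)) nil) (var 1)) (var 3))))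
      (pair (call upd (pair (wP (var 2)) (pair (var 1) (var 0))))
        (split (fst (var 0)) (wQ (var 2))
          (call upd (pair (wQ (var 4)) (pair (var 3) (var 2)))))))

/-- The argument is a list of items and a structure. -/
def bAddAll : Expr :=
  cell (var 0) <|
    split (var 0) (var 1) (call addAll (pair (var 1) (call add (pair (var 3) (var 0)))))

/-- The argument is a list of items. -/
def bBuild : Expr :=
  call addAll (pair (var 0) (pair (call skel (call keysOf (var 0))) (pair nil (pair nil nil))))

/-- The argument is a list of optional structures, and a list to which their items are added. -/
def bFlatAll : Expr :=
  cell (var 0) <|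
    split (var 0) (var 1) <|
    split (var 0) (call flatAll (pair (var 1) (var 3)))
      (call flatAll (pair (var 3) (call flat (pair (wD (var 2)) (var 5)))))

/-- The argument is a binary number. -/
def bInc : Expr :=
  split (var 0) (pair tt nil) <|
    split (var 0) (pair tt (var 1)) (pair nil (call inc (var 3)))

/-- The argument is a list of items, and a number with which a new numbering begins. -/
def bLabel : Expr :=
  cell (var 0) <|
    split (var 0) (pair nil (var 1)) <|
    bind (call label (pair (var 1) (call inc (var 3)))) <| cell (var 0) <|
    pair (pair (pair (fst (var 3)) (var 6)) (var 0)) (var 1)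

/-- The argument is a list. -/
def bSlots : Expr :=
  split (var 0) nil <|
    -- One empty slot per halving until a single element is left: the length of the result is the
    -- binary logarithm of the length of the list.
    split (var 1) nil (pair nil (call slots (snd (call halve (var 4)))))

/-- The argument is a list of optional structures. -/
def bFull : Expr :=
  split (var 0) tt <| split (var 0) nil (call full (var 3))

/-- The argument is a list of items and a list of optional structures. -/
def bTick : Expr :=
  cell (var 0) <| cell (var 1) <|
    -- As in incrementing a binary number: the first empty slot takes all that is carried, and an
    -- occupied slot is emptied into the carry.
    split (var 0) (pair (call build (var 2)) (var 1))
      (pair nil (call tick (pair (call flat (pair (wD (var 2)) (var 4))) (var 3))))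

/-- The argument is a parameter and a list of items. -/
def bRebuild : Expr :=
  cell (var 0) <|
    bind (call label (pair (var 1) nil)) <| cell (var 0) <|
    pair (var 3) (pair (var 1)
      (pair (call build (var 0)) (call slots (snd (call halve (var 0))))))

/-- The argument is a list of items and a state. -/
def bFinish : Expr :=
  cell (var 0) <|
    split (call full (snd (snd (snd (var 1)))))
      (pair (fst (var 1)) (pair (fst (snd (var 1))) (pair (fst (snd (snd (var 1))))
        (call tick (pair (var 0) (snd (snd (snd (var 1)))))))))
      (call rebuild (pair (fst (var 3)) (call flatAll (pair (snd (snd (var 3))) (var 2)))))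

/-- The argument is a state and an element. -/
def bIns : Expr :=
  cell (var 0) <|
    split (call find (pair (snd (snd (var 0))) (var 1)))
      (bind (pair (var 1) (fst (snd (var 0)))) <|
        call finish (pair (pair (var 0) nil) (pair (fst (var 1)) (pair
          (call inc (fst (snd (var 1)))) (call mapLow (pair (snd (snd (var 1))) (var 0)))))))
      (var 2)

/-- The argument is a state and an element. -/
def bRem : Expr :=
  cell (var 0) <|
    split (call find (pair (snd (snd (var 0))) (var 1)))
      (var 0)
      (bind (pair (var 0) (var 1)) <|
        call finish (pair nil (pair (fst (var 3)) (pair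
          (fst (snd (var 3))) (call mapDel (pair (snd (snd (var 3))) (var 0)))))))

/-- The argument is a side, a parameter, and a point or box. -/
def bEl : Expr :=
  cell (var 0) <| cell (var 1) <|
    split (var 2) (pair nil (pair (call keyB (pair (var 0) (var 1))) (var 1)))
      (pair tt (pair (call keyA (pair (var 2) (var 3))) (var 3)))

/-- The argument is a side, a parameter, a list of points or boxes, and a list to which the items
for these are added. -/
def bWrap : Expr :=
  cell (var 0) <| cell (var 1) <| cell (var 1) <|
    split (var 0) (var 1) <|
    call wrap (pair (var 6) (pair (var 4) (pair (var 1)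
      (pair (pair (call el (pair (var 6) (pair (var 4) (var 0)))) nil) (var 3)))))

/-- The argument is a list of optional structures. -/
def bFrames : Expr :=
  split (var 0) nil <|
    split (var 0) (call frames (var 1)) <|
    bind (call frames (var 3)) <|
    bind (split (fst (wQ (var 3))) (var 0) (pair (pair nil (wQ (var 5))) (var 2))) <|
    split (fst (wP (var 4))) (var 0) (pair (pair nil (wP (var 6))) (var 2))

/-- The work on a nested trie. The environment consists of the kind and the rest of the frame, the
frame and the rest of the stack. -/
def bNextTree : Expr :=
  cell (var 1) <| cell (var 0) <|
    split (var 0)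
      (cell (var 3) <| cell (var 1) <|
        bind (split (fst (var 1)) (var 11) (pair (pair nil (var 3)) (var 13))) <|
        bind (split (fst (var 1)) (var 0) (pair (pair nil (var 3)) (var 2))) <|
        call next (split (fst (var 4)) (var 0) (pair (pair nil (var 6)) (var 2))))
      (call next (pair (pair tt (var 5)) (var 9)))

/-- The work on two tries; the environment begins with the two components of the kind and the two
tries. -/
def bNextProd : Expr :=
  cell (var 0) <| cell (var 1) <|
    bind (split (var 1) (var 11) (pair (pair tt (pair (var 3) (var 7))) (var 13))) <|
    bind (split (var 1) (var 0) (pair (pair tt (pair (var 3) (var 8))) (var 2))) <|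
    call next (split (var 4) (var 0) (pair (pair (pair tt nil) (pair (var 6) (var 9))) (var 2)))

/-- The work on an item and a trie; the environment begins with the item and the trie. -/
def bNextRow : Expr :=
  cell (var 3) <| cell (var 1) <|
    bind (split (var 1) (var 13) (pair (pair (pair tt nil) (pair (var 8) (var 3))) (var 15))) <|
    bind (split (var 1) (var 0) (pair (pair (pair tt nil) (pair (var 9) (var 3))) (var 2))) <|
    split (var 4) (call next (var 0))
      (pair (pair (pay (fst (var 10))) (pay (fst (var 6)))) (var 2))

/-- The argument is a stack. -/
def bNext : Expr :=
  split (var 0) nil <| cell (var 0) <|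
    split (var 0) bNextTree <| cell (var 3) <| split (var 2) bNextProd bNextRow

end Code

open Code in
/-- The function table, up to the function that computes the keys of a box. -/
def prog (bKeyB : Expr) : List Expr :=
  [bKeyA, bKeyB, bCode, bCodes, bMk, bTset, bTget, bFlat, bMkBase, bMkNode, bUpd, bHalve, bMerge,
    bSort, bBst, bKeysOf, bCol, bSkel, bEqk, bLookup, bFind, bLow, bDel, bMap mapLow low,
    bMap mapDel del, bAdd, bAddAll, bBuild, bFlatAll, bInc, bLabel, bSlots, bFull, bTick, bRebuild,
    bFinish, bIns, bRem, bEl, bWrap, bFrames, bNext]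

/-! ## Data as values -/

def encBool : Bool → Val
  | false => .nil
  | true => .pair .nil .nil

@[simp] theorem encBool_false : encBool false = .nil := rfl
@[simp] theorem encBool_true : encBool true = .pair .nil .nil := rfl

def encBits (l : List Bool) : Val := .ofList (l.map encBool)
def encCodes (l : List (List Bool)) : Val := .ofList (l.map encBits)
def encReals (l : List ℝ) : Val := .ofList (l.map .real)

@[simp] theorem encBits_nil : encBits [] = .nil := rfl
@[simp] theorem encBits_cons (b : Bool) (l : List Bool) :
    encBits (b :: l) = .pair (encBool b) (encBits l) := rfl
@[simp] theorem encCodes_nil : encCodes [] = .nil := rfl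
@[simp] theorem encCodes_cons (c : List Bool) (l : List (List Bool)) :
    encCodes (c :: l) = .pair (encBits c) (encCodes l) := rfl
@[simp] theorem encReals_nil : encReals [] = .nil := rfl
@[simp] theorem encReals_cons (x : ℝ) (l : List ℝ) :
    encReals (x :: l) = .pair (.real x) (encReals l) := rfl

def Bst.enc : Bst → Val
  | nil => .nil
  | node s l r => .pair (.real s) (.pair l.enc r.enc)

def encSkel (U : List Bst) : Val := .ofList (U.map Bst.enc)

@[simp] theorem encSkel_nil : encSkel [] = .nil := rfl
@[simp] theorem encSkel_cons (t : Bst) (l : List Bst) :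
    encSkel (t :: l) = .pair t.enc (encSkel l) := rfl

/-- A set of elements on two sides, with keys. -/
structure Elems (E : Type) where
  side : E → Bool
  keys : E → List ℝ
  pay : E → Val

/-- An element with an identifier. -/
abbrev Item (E : Type) := E × ℕ

section
variable {E : Type} (σ : Elems E)

def Elems.enc (e : E) : Val := .pair (encBool (σ.side e)) (.pair (encReals (σ.keys e)) (σ.pay e))

def encItem (x : Item E) : Val := .pair (σ.enc x.1) (encBits x.2.bits)

def encItems (l : List (Item E)) : Val := .ofList (l.map (encItem σ))

@[simp] theorem encItems_nil : encItems σ [] = .nil := rfl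
@[simp] theorem encItems_cons (x : Item E) (l : List (Item E)) :
    encItems σ (x :: l) = .pair (encItem σ x) (encItems σ l) := rfl

def encSlot : Option (Item E) → Val
  | none => .nil
  | some x => encItem σ x

@[simp] theorem encSlot_none : encSlot σ none = .nil := rfl
@[simp] theorem encSlot_some (x : Item E) : encSlot σ (some x) = encItem σ x := rfl

def Trie.enc : Trie (Item E) → Val
  | nil => .nil
  | node o l r => .pair (encSlot σ o) (.pair (l.enc) (r.enc))

@[simp] theorem Trie.enc_nil : (Trie.nil : Trie (Item E)).enc σ = .nil := rfl
@[simp] theorem Trie.enc_node (o : Option (Item E)) (l r : Trie (Item E)) :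
    (Trie.node o l r).enc σ = .pair (encSlot σ o) (.pair (l.enc σ) (r.enc σ)) := rfl

/-- A flag other than `nil` also shows the kind of the structure: its first component is a cell at
the bottom and `nil` at a node. The enumeration branches on this. -/
def Nest.flag : Nest (Item E) → Val
  | nil => .nil
  | base tA tB => if (base tA tB).ne then .pair (.pair .nil .nil) .nil else .nil
  | node s l r => if (node s l r).ne then .pair .nil .nil else .nil

def Nest.enc : Nest (Item E) → Val
  | nil => .nil
  | base tA tB => .pair (flag (base tA tB)) (.pair (tA.enc σ) (tB.enc σ))
  | node s l r => .pair (flag (node s l r)) (.pair s.enc (.pair l.enc r.enc))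

end
end DynJoin

/-! ### Values and running times: codes, tries, nested tries. -/

namespace DynJoin

/-- Number of bits and codes. -/
def wt (cs : List (List Bool)) : ℕ := (cs.map List.length).sum + cs.length

@[simp] theorem wt_nil : wt [] = 0 := rfl
@[simp] theorem wt_nil_cons (cs : List (List Bool)) : wt ([] :: cs) = wt cs + 1 := by
  simp [wt]; omega
@[simp] theorem wt_cons_cons (b : Bool) (c : List Bool) (cs : List (List Bool)) :
    wt ((b :: c) :: cs) = wt (c :: cs) + 1 := by
  simp [wt]; omega
theorem wt_cons (c : List Bool) (cs : List (List Bool)) :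
    wt (c :: cs) = c.length + 1 + wt cs := by
  simp [wt]; omega

/-- The search paths of a list of keys. -/
noncomputable def codes (side : Bool) : List ℝ → List Bst → List (List Bool)
  | [], _ => []
  -- The skeleton of an empty set has no trees. Empty paths for missing trees keep the number of
  -- codes equal to the number of keys.
  | _ :: ks, [] => [] :: codes side ks []
  | k :: ks, t :: ts => t.code side k :: codes side ks ts

section
variable {kB : Expr} {E : Type} {σ : Elems E}
open Code

/-- The pattern of the lemmas on calls: `rfl` finds the body in the table, simplification executes
it, known specifications answer the calls inside it through `exec`, and the time bound is arithmetic
with generous constants. -/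
theorem call_code (side : Bool) (k : ℝ) (t : Bst) :
    CallLE (prog kB) code (.pair (encBool side) (.pair (.real k) t.enc))
      (encBits (t.code side k)) (60 * ((t.code side k).length + 1)) := by
  induction t with
  | nil =>
    refine .of_body (body := bCode) rfl ?_
    simp [bCode, cell, Bst.enc, Bst.code]
  | node s l r ihl ihr =>
    refine .of_body (body := bCode) rfl ?_
    cases side
    · by_cases h : k ≤ s
      · simp [bCode, cell, Bst.enc, Bst.code, turn, h]
        refine ihl.exec fun t ht => ?_
        simp
        omega
      · simp [bCode, cell, Bst.enc, Bst.code, turn, h, tt]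
        refine ihr.exec fun t ht => ?_
        simp
        omega
    · by_cases h : s ≤ k
      · simp [bCode, cell, Bst.enc, Bst.code, turn, h, tt]
        refine ihr.exec fun t ht => ?_
        simp
        omega
      · simp [bCode, cell, Bst.enc, Bst.code, turn, h]
        refine ihl.exec fun t ht => ?_
        simp
        omega

theorem call_codes (side : Bool) (ks : List ℝ) (U : List Bst) :
    CallLE (prog kB) Code.codes (.pair (encBool side) (.pair (encReals ks) (encSkel U)))
      (encCodes (codes side ks U)) (100 * (wt (codes side ks U) + 1)) := by
  induction ks generalizing U with
  | nil =>
    refine .of_body (body := bCodes) rfl ?_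
    simp [bCodes, cell, codes]
  | cons k ks ih =>
    refine .of_body (body := bCodes) rfl ?_
    cases U with
    | nil =>
      simp [bCodes, cell, codes]
      refine (ih []).exec fun t ht => ?_
      simp
      omega
    | cons t ts =>
      simp [bCodes, cell, codes]
      refine (call_code side k t).exec fun t' ht => ?_
      simp
      refine (ih ts).exec fun t ht => ?_
      simp [wt_cons]
      omega

theorem call_mk (o : Option (Item E)) (l r : Trie (Item E)) :
    CallLE (prog kB) Code.mk (.pair (encSlot σ o) (.pair (l.enc σ) (r.enc σ)))
      ((Trie.mk o l r).enc σ) 30 := by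
  refine .of_body (body := bMk) rfl ?_
  cases o <;> cases l <;> cases r <;> simp [bMk, cell, Trie.mk, encItem]

set_option maxHeartbeats 800000 in
-- The key is passed as a list of codes and read as their concatenation, so the machine never
-- concatenates; `wt` also counts the boundaries between the codes.
theorem call_tset (cs : List (List Bool)) (o : Option (Item E)) (t : Trie (Item E)) :
    CallLE (prog kB) tset (.pair (t.enc σ) (.pair (encCodes cs) (encSlot σ o)))
      ((t.set o cs.flatten).enc σ) (100 * (wt cs + 1)) := by
  induction cs generalizing t with
  | nil =>
    refine .of_body (body := bTset) rfl ?_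
    have := call_mk (kB := kB) (σ := σ) o t.left t.right
    cases t <;>
    · simp [bTset, cell, Trie.set, Code.left, Code.right, Trie.left, Trie.right] at this ⊢
      refine this.exec fun t ht => ?_
      simp
      omega
  | cons c cs ih =>
    induction c generalizing t with
    | nil =>
      refine .of_body (body := bTset) rfl ?_
      simp [bTset, cell]
      refine (ih t).exec fun t ht => ?_
      simp
      omega
    | cons b c ihc =>
      refine .of_body (body := bTset) rfl ?_
      cases b
      · have h₁ := ihc t.left
        have h₂ := call_mk (kB := kB) (σ := σ) t.slot (t.left.set o (c :: cs).flatten) t.right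
        cases t <;>
        · simp [bTset, cell, Trie.set, Code.left, Code.right, Trie.left, Trie.right, Trie.slot] at h₁ h₂ ⊢
          refine h₁.exec fun t ht => h₂.exec fun t ht => ?_
          simp
          omega
      · have h₁ := ihc t.right
        have h₂ := call_mk (kB := kB) (σ := σ) t.slot t.left (t.right.set o (c :: cs).flatten)
        cases t <;>
        · simp [bTset, cell, Trie.set, Code.left, Code.right, Trie.left, Trie.right, Trie.slot] at h₁ h₂ ⊢
          refine h₁.exec fun t ht => h₂.exec fun t ht => ?_
          simp
          omega

theorem call_tget (cs : List (List Bool)) (t : Trie (Item E)) :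
    CallLE (prog kB) tget (.pair (t.enc σ) (encCodes cs))
      (encSlot σ (t.get cs.flatten)) (100 * (wt cs + 1)) := by
  induction cs generalizing t with
  | nil =>
    refine .of_body (body := bTget) rfl ?_
    cases t <;> simp [bTget, cell, Trie.get, Trie.slot]
  | cons c cs ih =>
    induction c generalizing t with
    | nil =>
      refine .of_body (body := bTget) rfl ?_
      simp [bTget, cell]
      refine (ih t).exec fun t ht => ?_
      simp
      omega
    | cons b c ihc =>
      refine .of_body (body := bTget) rfl ?_
      have h₁ := ihc t.left
      have h₂ := ihc t.right
      cases b <;> cases t <;> simp [bTget, cell, Trie.get, Code.left, Code.right, Trie.left, Trie.right] at h₁ h₂ ⊢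
      · refine h₁.exec fun t ht => ?_
        simp
        omega
      · refine h₁.exec fun t ht => ?_
        simp
        omega
      · refine h₂.exec fun t ht => ?_
        simp
        omega
      · refine h₂.exec fun t ht => ?_
        simp
        omega

theorem call_flat (t : Trie (Item E)) (l : List (Item E)) :
    CallLE (prog kB) flat (.pair (t.enc σ) (encItems σ l)) (encItems σ (t.toList ++ l))
      (60 * (2 * t.nodes + 1)) := by
  induction t generalizing l with
  | nil =>
    refine .of_body (body := bFlat) rfl ?_
    simp [bFlat, cell, Trie.toList]
    omega
  | node o tl tr ihl ihr =>
    refine .of_body (body := bFlat) rfl ?_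
    simp [bFlat, cell]
    refine (ihr _).exec fun t ht => (ihl _).exec fun t ht => ?_
    cases o <;> (simp [Trie.toList, Trie.nodes, encItem]; omega)

theorem call_mkBase (tA tB : Trie (Item E)) :
    CallLE (prog kB) mkBase (.pair (tA.enc σ) (tB.enc σ)) ((Nest.base tA tB).enc σ) 40 := by
  refine .of_body (body := bMkBase) rfl ?_
  cases tA <;> cases tB <;> simp [bMkBase, cell, Nest.enc, Nest.flag, Nest.ne, tt]

theorem Nest.enc_cases (v : Nest (Item E)) :
    v.enc σ = .nil ∧ v.flag = .nil ∨ ∃ b, v.enc σ = .pair v.flag b := by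
  cases v <;> simp [Nest.enc, Nest.flag]

theorem Nest.flag_cases (v : Nest (Item E)) :
    v.ne = false ∧ v.flag = .nil ∨ v.ne = true ∧ ∃ a b, v.flag = .pair a b := by
  cases h : v.ne <;> cases v <;> simp [Nest.flag, h]
  simp [Nest.ne] at h

-- An absent structure is `nil` and reads as having the flag `nil`, so flags are read without a case
-- distinction.
@[simp] theorem fstK_nest {v : Nest (Item E)} {k : Val → Prop} :
    fstK (v.enc σ) k ↔ k v.flag := by
  rcases v.enc_cases (σ := σ) with ⟨h, h'⟩ | ⟨b, h⟩ <;> simp [*]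

theorem Nest.flag_node (s l r : Nest (Item E)) : (node s l r).flag =
    if (s.ne || l.ne || r.ne) = true then .pair .nil .nil else .nil := rfl

theorem call_mkNode (s l r : Nest (Item E)) :
    CallLE (prog kB) mkNode (.pair (s.enc σ) (.pair (l.enc σ) (r.enc σ)))
      ((Nest.node s l r).enc σ) 60 := by
  refine .of_body (body := bMkNode) rfl ?_
  simp [bMkNode, cell, Nest.enc, Nest.flag_node, tt]
  rcases s.flag_cases with ⟨h, h'⟩ | ⟨h, _, _, h'⟩ <;> simp [h, h']
  rcases l.flag_cases with ⟨h, h'⟩ | ⟨h, _, _, h'⟩ <;> simp [h, h']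
  rcases r.flag_cases with ⟨h, h'⟩ | ⟨h, _, _, h'⟩ <;> simp [h, h']

/-- The information on an item that `upd` uses: the side, the code of the identifier, and the new
entry. -/
def encInfo (σ : Elems E) (side : Bool) (id : List Bool) (o : Option (Item E)) : Val :=
  .pair (encBool side) (.pair (encCodes [id]) (encSlot σ o))

/-- The level makes the projection meaningful: on a bottom structure the same expression would look
into a trie. -/
theorem wp_left' {P : List Expr} {ρ : List Val} {i : ℕ} {k : Val → ℕ → Prop}
    {v : Nest (Item E)} {m : ℕ} (hv : v.WF (m + 1)) (hi : ρ[i]? = some (v.enc σ))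
    (hk : ∀ t ≤ 7, k (v.left.enc σ) t) : WP P ρ (left' (.var i)) k := by
  cases v <;> simp [left', hi, Nest.enc, Nest.left, Nest.WF] at hk hv ⊢ <;>
    exact hk _ (by simp)

theorem wp_right' {P : List Expr} {ρ : List Val} {i : ℕ} {k : Val → ℕ → Prop}
    {v : Nest (Item E)} {m : ℕ} (hv : v.WF (m + 1)) (hi : ρ[i]? = some (v.enc σ))
    (hk : ∀ t ≤ 7, k (v.right.enc σ) t) : WP P ρ (right' (.var i)) k := by
  cases v <;> simp [right', hi, Nest.enc, Nest.right, Nest.WF] at hk hv ⊢ <;>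
    exact hk _ (by simp)

theorem wp_sec {P : List Expr} {ρ : List Val} {i : ℕ} {k : Val → ℕ → Prop}
    {v : Nest (Item E)} {m : ℕ} (hv : v.WF (m + 1)) (hi : ρ[i]? = some (v.enc σ))
    (hk : ∀ t ≤ 7, k (v.sec.enc σ) t) : WP P ρ (left (.var i)) k := by
  cases v <;> simp [left, hi, Nest.enc, Nest.sec, Nest.WF] at hk hv ⊢ <;>
    exact hk _ (by simp)

theorem wp_baseA {P : List Expr} {ρ : List Val} {i : ℕ} {k : Val → ℕ → Prop}
    {v : Nest (Item E)} (hv : v.WF 0) (hi : ρ[i]? = some (v.enc σ))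
    (hk : ∀ t ≤ 7, k (v.baseA.enc σ) t) : WP P ρ (left (.var i)) k := by
  cases v <;> simp [left, hi, Nest.enc, Nest.baseA, Nest.WF] at hk hv ⊢ <;>
    exact hk _ (by simp)

theorem wp_baseB {P : List Expr} {ρ : List Val} {i : ℕ} {k : Val → ℕ → Prop}
    {v : Nest (Item E)} (hv : v.WF 0) (hi : ρ[i]? = some (v.enc σ))
    (hk : ∀ t ≤ 7, k (v.baseB.enc σ) t) : WP P ρ (right (.var i)) k := by
  cases v <;> simp [right, hi, Nest.enc, Nest.baseB, Nest.WF] at hk hv ⊢ <;>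
    exact hk _ (by simp)

set_option maxHeartbeats 800000 in
-- Constant time per visited place; a bottom structure has weight `id.length + 2`, which is `wt [id]
-- + 1`, the bound for `tset` there.
theorem call_upd (side : Bool) (id : List Bool) (o : Option (Item E)) (cs : List (List Bool))
    {v : Nest (Item E)} (hv : v.WF cs.length) :
    CallLE (prog kB) upd (.pair (v.enc σ) (.pair (encCodes cs) (encInfo σ side id o)))
      ((v.upd side id o cs).enc σ) (300 * pathNodes (id.length + 2) cs) := by
  induction cs generalizing v with
  | nil =>
    refine .of_body (body := bUpd) rfl ?_
    have h₁ := call_tset (kB := kB) (σ := σ) [id] o v.baseA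
    have h₂ := call_tset (kB := kB) (σ := σ) [id] o v.baseB
    simp only [wt_cons, wt_nil, List.flatten_cons, List.flatten_nil, List.append_nil] at h₁ h₂
    cases side
    · simp [bUpd, cell, encInfo]
      refine wp_baseA hv rfl fun t₁ ht₁ => wp_baseB hv rfl fun t₂ ht₂ => ?_
      refine h₂.exec fun t₃ ht₃ => (call_mkBase _ _).exec fun t₄ ht₄ => ?_
      simp [Nest.upd, pathNodes]
      omega
    · simp [bUpd, cell, encInfo]
      refine wp_baseA hv rfl fun t₁ ht₁ => ?_
      refine h₁.exec fun t₃ ht₃ => wp_baseB hv rfl fun t₂ ht₂ =>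
        (call_mkBase _ _).exec fun t₄ ht₄ => ?_
      simp [Nest.upd, pathNodes]
      omega
  | cons c cs ih =>
    induction c generalizing v with
    | nil =>
      refine .of_body (body := bUpd) rfl ?_
      simp [bUpd, cell, Nest.upd, pathNodes]
    | cons b c ihc =>
      obtain ⟨h₁, h₂, h₃⟩ := hv.parts
      have ih := ih h₁
      have ihl := ihc h₂
      have ihr := ihc h₃
      simp only [encInfo, encCodes_cons, encCodes_nil] at ih ihl ihr
      refine .of_body (body := bUpd) rfl ?_
      rw [pathNodes, Nest.upd]
      cases b
      · cases side
        · simp [bUpd, cell, encInfo]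
          refine wp_sec hv rfl fun t₁ ht₁ => ?_
          refine ih.exec fun t₂ ht₂ => wp_left' hv rfl fun t₃ ht₃ => ?_
          refine ihl.exec fun t₄ ht₄ => wp_right' hv rfl fun t₅ ht₅ =>
            (call_mkNode _ _ _).exec fun t₆ ht₆ => ?_
          simp
          omega
        · simp [bUpd, cell, encInfo]
          refine wp_sec hv rfl fun t₁ ht₁ => wp_left' hv rfl fun t₃ ht₃ => ?_
          refine ihl.exec fun t₄ ht₄ => wp_right' hv rfl fun t₅ ht₅ =>
            (call_mkNode _ _ _).exec fun t₆ ht₆ => ?_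
          simp
          omega
      · cases side
        · simp [bUpd, cell, encInfo]
          refine wp_sec hv rfl fun t₁ ht₁ => wp_left' hv rfl fun t₃ ht₃ =>
            wp_right' hv rfl fun t₅ ht₅ => ?_
          refine ihr.exec fun t₄ ht₄ => (call_mkNode _ _ _).exec fun t₆ ht₆ => ?_
          simp
          omega
        · simp [bUpd, cell, encInfo]
          refine wp_sec hv rfl fun t₁ ht₁ => ?_
          refine ih.exec fun t₂ ht₂ => wp_left' hv rfl fun t₃ ht₃ =>
            wp_right' hv rfl fun t₅ ht₅ => ?_
          refine ihr.exec fun t₄ ht₄ => (call_mkNode _ _ _).exec fun t₆ ht₆ => ?_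
          simp
          omega

end
end DynJoin

/-! ### Sorting, and search trees of logarithmic depth. -/

namespace DynJoin

/-- The elements of a list, dealt out in turn. -/
def halves {α : Type} : List α → List α × List α
  | [] => ([], [])
  | x :: xs => (x :: (halves xs).2, (halves xs).1)

theorem length_halves {α : Type} (l : List α) :
    (halves l).1.length = (l.length + 1) / 2 ∧ (halves l).2.length = l.length / 2 := by
  induction l with
  | nil => simp [halves]
  | cons x xs ih =>
    obtain ⟨h₁, h₂⟩ := ih
    simp only [halves, List.length_cons]
    omega

theorem halves_map {α β : Type} (f : α → β) (l : List α) :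
    halves (l.map f) = ((halves l).1.map f, (halves l).2.map f) := by
  induction l with
  | nil => simp [halves]
  | cons x xs ih => simp [halves, ih]

theorem halves_perm {α : Type} (l : List α) : ((halves l).1 ++ (halves l).2).Perm l := by
  induction l with
  | nil => simp [halves]
  | cons x xs ih =>
    simp only [halves, List.cons_append]
    exact (List.perm_append_comm.trans ih).cons x

section
variable {kB : Expr}
open Code

theorem call_halve (l : List Val) :
    CallLE (prog kB) halve (.ofList l) (.pair (.ofList (halves l).1) (.ofList (halves l).2))
      (20 * (l.length + 1)) := by
  induction l with
  | nil =>
    refine .of_body (body := bHalve) rfl ?_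
    simp [bHalve, halves]
  | cons x xs ih =>
    refine .of_body (body := bHalve) rfl ?_
    simp [bHalve, cell]
    refine ih.exec fun t ht => ?_
    simp [halves]
    omega

theorem call_halve_reals (l : List ℝ) :
    CallLE (prog kB) halve (encReals l) (.pair (encReals (halves l).1) (encReals (halves l).2))
      (20 * (l.length + 1)) := by
  simpa [encReals, halves_map] using call_halve (kB := kB) (l.map .real)

theorem call_merge (l₁ l₂ : List ℝ) :
    CallLE (prog kB) merge (.pair (encReals l₁) (encReals l₂))
      (encReals (l₁.merge l₂ fun a b => decide (a ≤ b))) (30 * (l₁.length + l₂.length + 1)) := by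
  induction l₁ generalizing l₂ with
  | nil =>
    refine .of_body (body := bMerge) rfl ?_
    simp [bMerge, cell]
    omega
  | cons x xs ihx =>
    induction l₂ with
    | nil =>
      refine .of_body (body := bMerge) rfl ?_
      simp [bMerge, cell]
      omega
    | cons y ys ihy =>
      refine .of_body (body := bMerge) rfl ?_
      by_cases h : x ≤ y
      · simp [bMerge, cell, h]
        refine (ihx (y :: ys)).exec fun t ht => ?_
        simp at ht ⊢
        omega
      · simp [bMerge, cell, h]
        refine ihy.exec fun t ht => ?_
        simp at ht ⊢
        omega

/-- Merge sort with `h` rounds of halving. Only the fact that the result is a sorted permutation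
matters later, hence the existential form. -/
theorem exists_sort (h : ℕ) (l : List ℝ) (hl : l.length ≤ 2 ^ h) :
    ∃ l' : List ℝ, l'.Perm l ∧ l'.Pairwise (· ≤ ·) ∧
      CallLE (prog kB) sort (encReals l) (encReals l') (200 * (l.length * h + l.length + 1)) := by
  induction h generalizing l with
  | zero =>
    refine ⟨l, .refl _, ?_, .of_body (body := bSort) rfl ?_⟩
    · rcases l with _ | ⟨x, _ | ⟨y, l⟩⟩ <;> simp at hl ⊢
    · rcases l with _ | ⟨x, _ | ⟨y, l⟩⟩ <;> simp [bSort] at hl ⊢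
  | succ h ih =>
    rcases l with _ | ⟨x, _ | ⟨y, l⟩⟩
    · exact ⟨[], .refl _, by simp, .of_body (body := bSort) rfl (by simp [bSort])⟩
    · refine ⟨[x], .refl _, by simp, .of_body (body := bSort) rfl ?_⟩
      simp [bSort]
      omega
    · set L := x :: y :: l with hL
      obtain ⟨e₁, e₂⟩ := length_halves L
      have h2 : 2 ≤ L.length := by simp [hL]
      rw [pow_succ] at hl
      obtain ⟨l₁, p₁, s₁, c₁⟩ := ih (halves L).1 (by omega)
      obtain ⟨l₂, p₂, s₂, c₂⟩ := ih (halves L).2 (by omega)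
      refine ⟨l₁.merge l₂ fun a b => decide (a ≤ b), ?_, ?_, ?_⟩
      · exact (List.merge_perm_append _).trans ((p₁.append p₂).trans (halves_perm L))
      · exact List.Pairwise.merge s₁ s₂
      · refine .of_body (body := bSort) rfl ?_
        have c₀ := call_halve_reals (kB := kB) L
        rw [hL] at c₀ ⊢
        simp [bSort, cell] at c₀ ⊢
        refine c₀.exec fun t₀ ht₀ => ?_
        simp
        refine c₁.exec fun t₁ ht₁ => c₂.exec fun t₂ ht₂ => (call_merge _ _).exec fun t₃ ht₃ => ?_
        refine ⟨rfl, ?_⟩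
        rw [p₁.length_eq, p₂.length_eq] at ht₃
        have : (halves L).1.length + (halves L).2.length = l.length + 2 := by
          rw [e₁, e₂]; simp [hL]; omega
        -- The products with `h` are atoms for `omega`, so the identity of lengths is also supplied
        -- in multiplied form.
        have := congrArg (· * h) this
        simp only [add_mul] at this
        ring_nf at *
        omega

/-- Only the length of `f` matters: it is the number of reals that the tree consumes from the front
of `l`. One is the root, and the others are divided evenly between the subtrees, which gives depth
at most `h`. -/
theorem exists_bst (h : ℕ) (f : List Val) (l : List ℝ) (hf : f.length ≤ l.length)
    (hh : f.length < 2 ^ h) :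
    ∃ (t : Bst) (l' : List ℝ), t.toList ++ l' = l ∧ t.toList.length = f.length ∧ t.depth ≤ h ∧
      CallLE (prog kB) bst (.pair (.ofList f) (encReals l)) (.pair t.enc (encReals l'))
        (100 * (f.length * h + f.length + 1)) := by
  induction h generalizing f l with
  | zero =>
    have : f = [] := by simpa using hh
    subst this
    refine ⟨.nil, l, by simp [Bst.toList], by simp [Bst.toList], by simp [Bst.depth],
      .of_body (body := bBst) rfl ?_⟩
    simp [bBst, cell, Bst.enc]
  | succ h ih =>
    cases f with
    | nil =>
      refine ⟨.nil, l, by simp [Bst.toList], by simp [Bst.toList], by simp [Bst.depth],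
        .of_body (body := bBst) rfl ?_⟩
      simp [bBst, cell, Bst.enc]
    | cons x fs =>
      obtain ⟨e₁, e₂⟩ := length_halves fs
      simp only [List.length_cons, pow_succ] at hf hh
      obtain ⟨t₁, l₁, r₁, n₁, d₁, c₁⟩ := ih (halves fs).1 l (by omega) (by omega)
      have hl₁ : l.length = (halves fs).1.length + l₁.length := by
        rw [← r₁, List.length_append, n₁]
      cases l₁ with
      | nil => simp at hl₁; omega
      | cons s l₂ =>
        simp only [List.length_cons] at hl₁
        obtain ⟨t₂, l₃, r₂, n₂, d₂, c₂⟩ := ih (halves fs).2 l₂ (by omega) (by omega)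
        refine ⟨.node s t₁ t₂, l₃, ?_, ?_, ?_, ?_⟩
        · simp [Bst.toList, ← r₁, ← r₂]
        · simp [Bst.toList, n₁, n₂, e₁, e₂]; omega
        · simp [Bst.depth]; omega
        · refine .of_body (body := bBst) rfl ?_
          simp [bBst, cell]
          refine (call_halve fs).exec fun t₀ ht₀ => ?_
          simp
          refine c₁.exec fun t₁ ht₁ => ?_
          simp
          refine c₂.exec fun t₂ ht₂ => ?_
          simp [Bst.enc]
          have : (halves fs).1.length + (halves fs).2.length = fs.length := by omega
          have := congrArg (· * h) this
          simp only [add_mul] at this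
          ring_nf at *
          omega

def encLists (ls : List (List ℝ)) : Val := .ofList (ls.map encReals)

@[simp] theorem encLists_nil : encLists [] = .nil := rfl
@[simp] theorem encLists_cons (l : List ℝ) (ls : List (List ℝ)) :
    encLists (l :: ls) = .pair (encReals l) (encLists ls) := rfl

theorem call_keysOf {E : Type} {σ : Elems E} (l : List (Item E)) :
    CallLE (prog kB) keysOf (encItems σ l) (encLists (l.map fun x => σ.keys x.1))
      (20 * (l.length + 1)) := by
  induction l with
  | nil => exact .of_body (body := bKeysOf) rfl (by simp [bKeysOf])
  | cons x xs ih =>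
    refine .of_body (body := bKeysOf) rfl ?_
    simp [bKeysOf, encItem, Elems.enc]
    refine ih.exec fun t ht => ?_
    simp
    omega

theorem call_col (ls : List (List ℝ)) (hls : ∀ l ∈ ls, l ≠ []) :
    CallLE (prog kB) col (encLists ls)
      (.pair (encReals (ls.map fun l => l.head?.getD 0)) (encLists (ls.map List.tail)))
      (40 * (ls.length + 1)) := by
  induction ls with
  | nil => exact .of_body (body := bCol) rfl (by simp [bCol])
  | cons l ls ih =>
    refine .of_body (body := bCol) rfl ?_
    have ih := ih fun l hl => hls l (by simp [hl])
    cases l with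
    | nil => simp at hls
    | cons k ks =>
      simp [bCol, cell]
      refine ih.exec fun t ht => ?_
      simp
      omega

/-- Search trees of small depth for the columns of a list of lists of keys. -/
structure SkelOk (h : ℕ) (ls : List (List ℝ)) (U : List Bst) : Prop where
  sorted : ∀ t ∈ U, t.toList.Pairwise (· ≤ ·)
  depth : ∀ t ∈ U, t.depth ≤ h
  mem : ∀ ks ∈ ls, List.Forall₂ (fun k t => k ∈ t.toList) ks U

theorem Bst.size_enc (t : Bst) : t.enc.size = 4 * t.toList.length + 1 := by
  induction t with
  | nil => simp [Bst.enc, Val.size, Bst.toList]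
  | node s l r ihl ihr =>
    simp [Bst.enc, Val.size, Bst.toList, ihl, ihr]
    omega

/-- One tree per coordinate: the heads of the lists are sorted and made into a tree, and the tails
are treated recursively. The empty list is separate because the number of coordinates cannot be read
from it; it gets no trees. -/
theorem exists_skel (h m : ℕ) (ls : List (List ℝ)) (hls : ∀ l ∈ ls, l.length = m)
    (hh : ls.length < 2 ^ h) :
    ∃ U : List Bst, SkelOk h ls U ∧ (encSkel U).size ≤ 6 * ((m + 1) * (ls.length + 1)) ∧ CallLE (prog kB) skel (encLists ls) (encSkel U)
      (500 * ((m + 1) * (ls.length * h + ls.length + 1))) := by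
  cases ls with
  | nil =>
    refine ⟨[], ⟨by simp, by simp, by simp⟩, ?_, .of_body (body := bSkel) rfl ?_⟩
    · simp [Val.size]
      omega
    simp [bSkel]
    omega
  | cons l₀ ls₀ =>
  induction m generalizing l₀ ls₀ with
  | zero =>
    refine ⟨[], ⟨by simp, by simp, fun ks hks => ?_⟩, ?_, .of_body (body := bSkel) rfl ?_⟩
    · rw [List.length_eq_zero_iff.1 (hls ks hks)]
      exact .nil
    · simp [Val.size]
      omega
    · rw [List.length_eq_zero_iff.1 (hls l₀ (by simp))]
      simp [bSkel]
      omega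
  | succ m ih =>
    set ls := l₀ :: ls₀ with hdef
    have hne : ∀ l ∈ ls, l ≠ [] := fun l hl h0 => by simpa [h0] using hls l hl
    obtain ⟨s, hs, hs', cs⟩ := exists_sort (kB := kB) h (ls.map fun l => l.head?.getD 0)
      (by simpa using hh.le)
    have hslen : s.length = ls.length := by simpa using hs.length_eq
    -- The sorted list measures itself, so the tree consumes all of it and nothing is left over.
    obtain ⟨t, l', ht, htl, htd, ct⟩ := exists_bst (kB := kB) h (s.map .real) s (by simp)
      (by simpa [hslen] using hh)
    have hl' : l' = [] := by
      have := congrArg List.length ht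
      rw [List.length_append, htl] at this
      simpa using this
    subst hl'
    rw [List.append_nil] at ht
    obtain ⟨U, hU, zU, cU⟩ := ih l₀.tail (ls₀.map List.tail)
      (by
        intro l hl
        rw [← List.map_cons, List.mem_map] at hl
        obtain ⟨l', hl', rfl⟩ := hl
        simp [hls l' hl'])
      (by simpa [hdef] using hh)
    have cU' : CallLE (prog kB) skel (encLists (ls.map List.tail)) (encSkel U)
      (500 * ((m + 1) * (ls.length * h + ls.length + 1))) := by simpa [hdef] using cU
    refine ⟨t :: U, ⟨?_, ?_, ?_⟩, ?_, .of_body (body := bSkel) rfl ?_⟩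
    · intro t' ht'
      rcases List.mem_cons.1 ht' with rfl | ht'
      · rwa [ht]
      · exact hU.sorted _ ht'
    · intro t' ht'
      rcases List.mem_cons.1 ht' with rfl | ht'
      · exact htd
      · exact hU.depth _ ht'
    · intro ks hks
      cases ks with
      | nil => exact absurd rfl (hne _ hks)
      | cons k ks =>
        refine .cons ?_ (hU.mem ks ?_)
        · rw [ht, hs.mem_iff]
          exact List.mem_map.2 ⟨_, hks, rfl⟩
        · exact List.mem_map.2 ⟨_, hks, rfl⟩
    · simp only [List.length_cons, List.length_map, encSkel_cons, Val.size, Bst.size_enc,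
        htl, hslen, hdef] at zU ⊢
      nlinarith
    · have c₀ := call_col (kB := kB) ls hne
      have hl₀ : l₀ ≠ [] := hne l₀ (by simp [hdef])
      obtain ⟨k, ks, rfl⟩ := List.exists_cons_of_ne_nil hl₀
      have e : encLists ls = .pair (.pair (.real k) (encReals ks)) (encLists ls₀) := rfl
      rw [e] at c₀ ⊢
      simp [bSkel, cell]
      refine c₀.exec fun t₀ ht₀ => ?_
      simp
      refine cs.exec fun t₁ ht₁ => ?_
      refine ct.exec fun t₂ ht₂ => ?_
      simp
      refine cU'.exec fun t₃ ht₃ => ?_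
      simp only [List.length_map, hslen] at ht₁ ht₂
      simp
      nlinarith

theorem call_eqk (l₁ l₂ : List ℝ) (hl : l₁.length = l₂.length) :
    CallLE (prog kB) eqk (.pair (encReals l₁) (encReals l₂)) (encBool (decide (l₁ = l₂)))
      (30 * (l₁.length + 1)) := by
  induction l₁ generalizing l₂ with
  | nil =>
    cases l₂ with
    | nil => exact .of_body (body := bEqk) rfl (by simp [bEqk, cell, tt])
    | cons => simp at hl
  | cons x xs ih =>
    cases l₂ with
    | nil => simp at hl
    | cons y ys =>
      refine .of_body (body := bEqk) rfl ?_
      by_cases h₁ : x ≤ y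
      · by_cases h₂ : y ≤ x
        · simp [bEqk, cell, le_antisymm h₁ h₂]
          refine (ih ys (by simpa using hl)).exec fun t ht => ?_
          simp
          omega
        · have : x ≠ y := fun h => h₂ h.ge
          simp [bEqk, cell, h₁, h₂, this]
          omega
      · have : x ≠ y := fun h => h₁ h.le
        simp [bEqk, cell, h₁, this]
        omega

end
end DynJoin

/-! ### Codes with respect to a skeleton; units of time and size; contents of nested tries. -/

namespace DynJoin

theorem size_pos (v : Val) : 1 ≤ v.size := by cases v <;> simp [Val.size]

theorem length_codes (side : Bool) (ks : List ℝ) (U : List Bst) :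
    (codes side ks U).length = ks.length := by
  induction ks generalizing U with
  | nil => simp [codes]
  | cons k ks ih => cases U <;> simp [codes, ih]

theorem length_le_of_mem_codes {side : Bool} {ks : List ℝ} {U : List Bst} {h : ℕ}
    (hU : ∀ t ∈ U, t.depth ≤ h) : ∀ c ∈ codes side ks U, c.length ≤ h := by
  induction ks generalizing U with
  | nil => simp [codes]
  | cons k ks ih =>
    cases U with
    | nil =>
      intro c hc
      rcases List.mem_cons.1 hc with rfl | hc
      · simp
      · exact ih (by simp) c hc
    | cons t ts =>
      intro c hc
      rcases List.mem_cons.1 hc with rfl | hc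
      · exact (t.length_code_le side k).trans (hU t (by simp))
      · exact ih (fun t ht => hU t (by simp [ht])) c hc

theorem wt_le {h : ℕ} {cs : List (List Bool)} (hcs : ∀ c ∈ cs, c.length ≤ h) :
    wt cs ≤ cs.length * (h + 1) := by
  induction cs with
  | nil => simp
  | cons c cs ih =>
    have := ih fun c hc => hcs c (by simp [hc])
    have := hcs c (by simp)
    rw [wt_cons, List.length_cons]
    linarith

/-- Prefix-freeness recovers the single paths from their concatenation, and a key that occurs in its
tree is determined by its path. So places in the dictionary identify elements of the skeleton. -/
theorem flatten_codes_inj {side : Bool} {ks ks' : List ℝ} {U : List Bst}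
    (hU : ∀ t ∈ U, t.toList.Pairwise (· ≤ ·)) (h : List.Forall₂ (fun k t => k ∈ t.toList) ks U)
    (h' : List.Forall₂ (fun k t => k ∈ t.toList) ks' U)
    (he : (codes side ks U).flatten = (codes side ks' U).flatten) : ks = ks' := by
  induction h generalizing ks' with
  | nil => cases h'; rfl
  | @cons k t ks U hk hks ih =>
    cases h' with
    | cons hk' hks' =>
      simp only [codes, List.flatten_cons] at he
      obtain ⟨h₁, h₂⟩ := Bst.code_append_inj he
      rw [Bst.eq_of_code_eq (hU t (by simp)) hk hk' h₁,
        ih (fun t ht => hU t (by simp [ht])) hks' h₂]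

/-- A point and a box, one of which belongs to the skeleton, meet at some position iff the point
lies in the box. -/
theorem exists_matches_iff {ka kb : List ℝ} {U : List Bst}
    (hU : ∀ t ∈ U, t.toList.Pairwise (· ≤ ·))
    (h : List.Forall₂ (fun k t => k ∈ t.toList) ka U ∨
      List.Forall₂ (fun k t => k ∈ t.toList) kb U) (hl : ka.length = kb.length) :
    (∃ pos, Matches true pos (codes true ka U) ∧ Matches false pos (codes false kb U)) ↔
      List.Forall₂ (fun b a => b ≤ a) kb ka := by
  induction ka generalizing kb U with
  | nil =>
    obtain rfl : kb = [] := by simpa using hl.symm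
    simp [codes, Matches]
  | cons a ka ih =>
    cases kb with
    | nil => simp at hl
    | cons b kb =>
      cases U with
      | nil => rcases h with h | h <;> cases h
      | cons t U =>
        have ih := ih (kb := kb) (U := U) (fun t ht => hU t (by simp [ht]))
          (by simp only [List.forall₂_cons] at h; tauto) (by simpa using hl)
        rw [List.forall₂_cons, ← ih, ← Bst.exists_prefix_iff (t := t) (hU t (by simp))
          (by simp only [List.forall₂_cons] at h; tauto)]
        constructor
        · rintro ⟨pos, h₁, h₂⟩
          cases h₁ with
          | cons h₁ h₁' => cases h₂ with | cons h₂ h₂' => exact ⟨⟨_, h₁, h₂⟩, _, h₁', h₂'⟩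
        · rintro ⟨⟨p, h₁, h₂⟩, pos, h₁', h₂'⟩
          exact ⟨p :: pos, .cons h₁ h₁', .cons h₂ h₂'⟩

theorem bits_injective : Function.Injective Nat.bits := fun a b h => by
  apply Nat.digits.injective 2
  simp only [Nat.digits_two_eq_bits, h]

/-- The unit of time. -/
def unit (m h : ℕ) : ℕ := (m + 2) * (h + 2) * (2 * h + 2) ^ m

/-- The first product pays for computing and following the codes of an element, the second for an
update of a nested trie. -/
theorem unit_bounds (m h : ℕ) : (m + 2) * (h + 2) ≤ unit m h ∧
    (h + 2) * (2 * h + 2) ^ m ≤ unit m h ∧ 1 ≤ unit m h := by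
  have h1 : 1 ≤ (2 * h + 2) ^ m := Nat.one_le_pow _ _ (by omega)
  refine ⟨Nat.le_mul_of_pos_right _ h1, ?_, ?_⟩
  · rw [unit, mul_assoc]
    exact Nat.le_mul_of_pos_left _ (by omega)
  · exact Nat.mul_pos (by positivity) h1

section
variable {E : Type} (σ : Elems E)

theorem Trie.size_mk_le (o : Option (Item E)) (l r : Trie (Item E)) :
    ((mk o l r).enc σ).size ≤ (encSlot σ o).size + (l.enc σ).size + (r.enc σ).size + 2 := by
  cases o <;> cases l <;> cases r <;> simp [mk, Val.size] <;> omega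

theorem Trie.size_set_le (o : Option (Item E)) (k : List Bool) (t : Trie (Item E)) :
    ((t.set o k).enc σ).size ≤ (t.enc σ).size + 4 * (k.length + 1) + (encSlot σ o).size := by
  have key : ∀ t : Trie (Item E), (encSlot σ t.slot).size + (t.left.enc σ).size +
      (t.right.enc σ).size + 2 ≤ (t.enc σ).size + 4 := by
    intro t
    cases t <;> simp [slot, left, right, Val.size]
    omega
  induction k generalizing t with
  | nil =>
    have := size_pos (encSlot σ t.slot)
    have := key t
    refine (size_mk_le σ _ _ _).trans ?_
    simp
    omega
  | cons b k ih =>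
    have := key t
    have := ih t.left
    have := ih t.right
    refine (size_mk_le σ _ _ _).trans ?_
    simp
    split_ifs <;> omega

theorem Nest.size_flag_le (v : Nest (Item E)) : v.flag.size ≤ 5 := by
  cases v <;> simp [flag, Val.size]
  all_goals split_ifs <;> simp [Val.size]

/-- Every visited place may create a node, even when `o = none`, so growth is bounded in the same
way for insertions and deletions. -/
theorem Nest.size_upd_le (side : Bool) (id : List Bool) (o : Option (Item E))
    (cs : List (List Bool)) (v : Nest (Item E)) :
    ((v.upd side id o cs).enc σ).size ≤
      (v.enc σ).size + (20 + (encSlot σ o).size) * pathNodes (id.length + 2) cs := by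
  set s := (encSlot σ o).size with hs
  induction cs generalizing v with
  | nil =>
    have h₁ := Trie.size_set_le σ o id v.baseA
    have h₂ := Trie.size_set_le σ o id v.baseB
    have h₃ : (v.baseA.enc σ).size + (v.baseB.enc σ).size ≤ (v.enc σ).size + 2 := by
      cases v <;> simp [baseA, baseB, Nest.enc, Val.size]
      omega
    have h₄ := size_flag_le (v.upd side id o [])
    rw [pathNodes]
    simp only [Nest.upd, Nest.enc, Val.size] at h₄ ⊢
    rw [← hs] at h₁ h₂
    cases side <;> simp at h₄ ⊢ <;> nlinarith
  | cons c cs ih =>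
    induction c generalizing v with
    | nil => simp [Nest.upd]
    | cons b c ihc =>
      have h₁ := ih v.sec
      have h₂ := ihc v.left
      have h₃ := ihc v.right
      have h₄ := size_flag_le (v.upd side id o ((b :: c) :: cs))
      have : (v.sec.enc σ).size + (v.left.enc σ).size + (v.right.enc σ).size ≤
          (v.enc σ).size + 2 := by
        cases v <;> simp [sec, left, right, Nest.enc, Val.size]
        omega
      rw [pathNodes]
      rw [Nest.upd] at h₄ ⊢
      simp only [Nest.enc, Val.size]
      ring_nf at *
      split_ifs at * <;> omega

/-- The elements have `m` keys, which determine them, and bounded size. -/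
structure Elems.Ok (m s : ℕ) : Prop where
  length : ∀ e, (σ.keys e).length = m
  inj : ∀ e e', σ.side e = σ.side e' → σ.keys e = σ.keys e' → e = e'
  size : ∀ e, (σ.enc e).size ≤ s

noncomputable def Elems.codes (U : List Bst) (e : E) : List (List Bool) :=
  DynJoin.codes (σ.side e) (σ.keys e) U

/-- The place of an element in the dictionary. -/
noncomputable def Elems.place (U : List Bst) (e : E) : List Bool :=
  ([σ.side e] :: σ.codes U e).flatten

/-- The nested trie `v` holds the items in `S`. -/
structure Holds (m h : ℕ) (U : List Bst) (v : Nest (Item E)) (S : Set (Item E)) : Prop where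
  wf : v.WF m
  base : v.BaseLe (h + 1)
  ht : v.ht ≤ m * h + 2 * h + 4
  get : ∀ pos side id x, v.get pos side id = some x ↔
    x ∈ S ∧ σ.side x.1 = side ∧ id = x.2.bits ∧ Matches side pos (σ.codes U x.1)

/-- A skeleton, a dictionary and two nested tries. -/
structure Str (E : Type) where
  U : List Bst
  dict : Trie (Item E)
  P : Nest (Item E)
  Q : Nest (Item E)

def Str.enc (W : Str E) : Val :=
  .pair (encSkel W.U) (.pair (W.dict.enc σ) (.pair (W.P.enc σ) (W.Q.enc σ)))

/-- The skeleton, the dictionary and the nested tries belong to the set `T`, and the nested tries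
also hold the items of `low`, so as to find all pairs of two items from `T` or of one item from `T`
and one from `low`. -/
structure StrOk (m h : ℕ) (W : Str E) (T low : Set (Item E)) : Prop where
  sorted : ∀ t ∈ W.U, t.toList.Pairwise (· ≤ ·)
  depth : ∀ t ∈ W.U, t.depth ≤ h
  mem : ∀ x ∈ T, List.Forall₂ (fun k t => k ∈ t.toList) (σ.keys x.1) W.U
  dict : ∀ k x, W.dict.get k = some x ↔ x ∈ T ∧ k = σ.place W.U x.1
  -- `P` yields the pairs whose box is in `T`; `Q` yields those whose point is in `T` and whose box
  -- is in `low`.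
  P : Holds σ m h W.U W.P {x | x ∈ T ∨ σ.side x.1 = true ∧ x ∈ low}
  Q : Holds σ m h W.U W.Q {x | σ.side x.1 = true ∧ x ∈ T ∨ σ.side x.1 = false ∧ x ∈ low}

variable {σ} {m s h : ℕ}

/-- Insertion is the case `o = some x` and deletion the case `o = none`. Entries are addressed by
identifier, so by `hS` no other item of `S` may share that of `x`. -/
theorem Holds.upd {U : List Bst} {v : Nest (Item E)} {S S' : Set (Item E)} (hv : Holds σ m h U v S)
    (hσ : σ.Ok m s) (hU : ∀ t ∈ U, t.depth ≤ h) {x : Item E} {o : Option (Item E)}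
    (hx : x.2.bits.length ≤ h) (hS : ∀ y ∈ S, y.2 = x.2 → y = x)
    (ho : ∀ y, y ∈ S' ↔ o = some y ∨ y ∈ S ∧ y ≠ x) (ho' : ∀ y, o = some y → y = x) :
    Holds σ m h U (v.upd (σ.side x.1) x.2.bits o (σ.codes U x.1)) S' := by
  classical
  have hlen : (σ.codes U x.1).length = m := (length_codes _ _ _).trans (hσ.length _)
  have hwf : v.WF (σ.codes U x.1).length := hlen ▸ hv.wf
  have hsum : ((σ.codes U x.1).map List.length).sum ≤ m * h := by
    rw [← hlen, ← smul_eq_mul, ← List.length_map (f := List.length)]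
    refine List.sum_le_card_nsmul _ _ fun n hn => ?_
    obtain ⟨c, hc, rfl⟩ := List.mem_map.1 hn
    exact length_le_of_mem_codes hU c hc
  refine ⟨hlen ▸ hwf.upd, hv.base.upd (by omega), ?_, ?_⟩
  · refine (Nest.ht_upd_le _ _ _ hv.base (by omega)).trans ?_
    have := hv.ht
    omega
  · intro pos side id y
    rw [Nest.get_upd hwf, ho]
    split_ifs with hc
    · obtain ⟨rfl, rfl, hm⟩ := hc
      constructor
      · intro h
        obtain rfl := ho' _ h
        exact ⟨.inl h, rfl, rfl, hm⟩
      · rintro ⟨h | ⟨h, hne⟩, h₁, h₂, h₃⟩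
        · exact h
        · exact absurd (hS y h (bits_injective h₂.symm)) hne
    · rw [hv.get]
      constructor
      · rintro ⟨h, h₁, h₂, h₃⟩
        refine ⟨.inr ⟨h, ?_⟩, h₁, h₂, h₃⟩
        rintro rfl
        exact hc ⟨h₁.symm, h₂, h₁ ▸ h₃⟩
      · rintro ⟨h | ⟨h, hne⟩, h₁, h₂, h₃⟩
        · obtain rfl := ho' _ h
          exact absurd ⟨h₁.symm, h₂, h₁ ▸ h₃⟩ hc
        · exact ⟨h, h₁, h₂, h₃⟩

end
end DynJoin

/-! ### Operations on a single structure. -/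

namespace DynJoin

section
variable {E : Type} (σ : Elems E)

/-- Search for an element. -/
noncomputable def Str.look (W : Str E) (e : E) : Option (Item E) :=
  match W.dict.get (σ.place W.U e) with
  | none => none
  | some y => if σ.keys y.1 = σ.keys e then some y else none

/-- Change the entry for an item in a nested trie. -/
noncomputable def Str.put (W : Str E) (x : Item E) (o : Option (Item E)) (v : Nest (Item E)) :
    Nest (Item E) :=
  v.upd (σ.side x.1) x.2.bits o (σ.codes W.U x.1)

/-- Insert an item only into the nested tries. -/
noncomputable def Str.low (x : Item E) (W : Str E) : Str E :=
  ⟨W.U, W.dict, if σ.side x.1 then W.put σ x (some x) W.P else W.P,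
    if σ.side x.1 then W.Q else W.put σ x (some x) W.Q⟩

/-- Delete an item. -/
noncomputable def Str.del (x : Item E) (W : Str E) : Str E :=
  ⟨W.U, if (W.look σ x.1).isSome then W.dict.set none (σ.place W.U x.1) else W.dict,
    W.put σ x none W.P, W.put σ x none W.Q⟩

/-- Insert an item. -/
noncomputable def Str.add (W : Str E) (x : Item E) : Str E :=
  ⟨W.U, W.dict.set (some x) (σ.place W.U x.1), W.put σ x (some x) W.P,
    if σ.side x.1 then W.put σ x (some x) W.Q else W.Q⟩

variable {σ} {m s h : ℕ} {W : Str E} {T lo : Set (Item E)} {kB : Expr}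

/-- An element outside `T` may have the same place as one in `T`; the comparison of keys rules this
out. The side is already part of the place. -/
theorem StrOk.look_eq_some (hW : StrOk σ m h W T lo) (hσ : σ.Ok m s) {e : E} {y : Item E} :
    W.look σ e = some y ↔ y ∈ T ∧ y.1 = e := by
  constructor
  · intro he
    rw [Str.look] at he
    split at he
    · simp at he
    · rename_i z hz
      split_ifs at he with hk
      obtain rfl := Option.some.inj he
      obtain ⟨hy, hp⟩ := (hW.dict _ _).1 hz
      refine ⟨hy, hσ.inj _ _ ?_ hk⟩
      simp only [Elems.place, List.flatten_cons, List.cons_append, List.cons.injEq] at hp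
      exact hp.1.symm
  · rintro ⟨hy, rfl⟩
    rw [Str.look, (hW.dict _ _).2 ⟨hy, rfl⟩]
    simp

/-- Items in the set agree if they belong to the same element or have the same identifier. -/
def Uniq (S : Set (Item E)) : Prop :=
  ∀ x ∈ S, ∀ y ∈ S, (x.1 = y.1 → x = y) ∧ (x.2 = y.2 → x = y)

/-- The keys of `x` need not occur in the skeleton. This freedom is what lets a static skeleton
serve later insertions. -/
theorem StrOk.low (hW : StrOk σ m h W T lo) (hσ : σ.Ok m s) {x : Item E}
    (hx : x.2.bits.length ≤ h) (hu : Uniq (insert x (T ∪ lo))) :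
    StrOk σ m h (W.low σ x) T (insert x lo) := by
  have hid : ∀ y ∈ T ∪ lo, y.2 = x.2 → y = x := fun y hy => (hu y (.inr hy) x (.inl rfl)).2
  cases hs : σ.side x.1 with
  | true =>
    refine ⟨hW.sorted, hW.depth, hW.mem, hW.dict, ?_, ?_⟩
    · simp only [Str.low, hs, if_true]
      refine hW.P.upd hσ hW.depth hx ?_ ?_ (by simp)
      · rintro y (hy | hy)
        · exact hid y (.inl hy)
        · exact hid y (.inr hy.2)
      · intro y
        simp only [Set.mem_ofPred_eq, Set.mem_insert_iff, Option.some.injEq]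
        by_cases hyx : y = x
        · subst hyx; simp [hs]
        · simp [hyx, eq_comm (a := x)]
    · simp only [Str.low, hs, if_true]
      have : {y | σ.side y.1 = true ∧ y ∈ T ∨ σ.side y.1 = false ∧ y ∈ insert x lo} =
          {y | σ.side y.1 = true ∧ y ∈ T ∨ σ.side y.1 = false ∧ y ∈ lo} := by
        ext y
        by_cases hyx : y = x
        · subst hyx; simp [hs]
        · simp [hyx]
      rw [this]
      exact hW.Q
  | false =>
    refine ⟨hW.sorted, hW.depth, hW.mem, hW.dict, ?_, ?_⟩
    · simp only [Str.low, hs, Bool.false_eq_true, if_false]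
      have : {y | y ∈ T ∨ σ.side y.1 = true ∧ y ∈ insert x lo} =
          {y | y ∈ T ∨ σ.side y.1 = true ∧ y ∈ lo} := by
        ext y
        by_cases hyx : y = x
        · subst hyx; simp [hs]
        · simp [hyx]
      rw [this]
      exact hW.P
    · simp only [Str.low, hs, Bool.false_eq_true, if_false]
      refine hW.Q.upd hσ hW.depth hx ?_ ?_ (by simp)
      · rintro y (hy | hy)
        · exact hid y (.inl hy.2)
        · exact hid y (.inr hy.2)
      · intro y
        simp only [Set.mem_ofPred_eq, Set.mem_insert_iff, Option.some.injEq]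
        by_cases hyx : y = x
        · subst hyx; simp [hs]
        · simp [hyx, eq_comm (a := x)]

theorem StrOk.del (hW : StrOk σ m h W T lo) (hσ : σ.Ok m s) {x : Item E}
    (hx : x.2.bits.length ≤ h) (hu : Uniq (insert x (T ∪ lo))) :
    StrOk σ m h (W.del σ x) (T \ {x}) (lo \ {x}) := by
  have hid : ∀ y ∈ T ∪ lo, y.2 = x.2 → y = x := fun y hy => (hu y (.inr hy) x (.inl rfl)).2
  refine ⟨hW.sorted, hW.depth, fun y hy => hW.mem y hy.1, ?_, ?_, ?_⟩
  · intro k y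
    simp only [Str.del]
    -- The dictionary is changed only if the element is found there; otherwise the place computed
    -- for `x` might belong to a different item of `T`.
    split_ifs with hl
    · obtain ⟨z, hz⟩ := Option.isSome_iff_exists.1 hl
      obtain ⟨hzT, hzx⟩ := (hW.look_eq_some hσ).1 hz
      obtain rfl : z = x := (hu z (.inr (.inl hzT)) x (.inl rfl)).1 hzx
      rw [Trie.get_set]
      split_ifs with hk
      · simp only [false_iff]
        rintro ⟨⟨hy, hyz⟩, hk'⟩
        have h₁ := (hW.dict _ _).2 ⟨hy, rfl⟩
        rw [← hk', hk, (hW.dict _ _).2 ⟨hzT, rfl⟩] at h₁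
        exact hyz (Option.some.inj h₁).symm
      · rw [hW.dict]
        constructor
        · rintro ⟨hy, rfl⟩
          refine ⟨⟨hy, ?_⟩, rfl⟩
          rintro rfl
          exact hk rfl
        · rintro ⟨⟨hy, -⟩, rfl⟩
          exact ⟨hy, rfl⟩
    · have hxT : x ∉ T := fun hxT => by
        rw [(hW.look_eq_some hσ).2 ⟨hxT, rfl⟩] at hl
        simp at hl
      rw [hW.dict, Set.sdiff_singleton_eq_self hxT]
  · refine hW.P.upd hσ hW.depth hx ?_ ?_ (by simp)
    · rintro y (hy | hy)
      · exact hid y (.inl hy)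
      · exact hid y (.inr hy.2)
    · intro y
      simp only [Set.mem_ofPred_eq, Set.mem_sdiff, Set.mem_singleton_iff, reduceCtorEq, false_or]
      tauto
  · refine hW.Q.upd hσ hW.depth hx ?_ ?_ (by simp)
    · rintro y (hy | hy)
      · exact hid y (.inl hy.2)
      · exact hid y (.inr hy.2)
    · intro y
      simp only [Set.mem_ofPred_eq, Set.mem_sdiff, Set.mem_singleton_iff, reduceCtorEq, false_or]
      tauto

/-- Items join `T` only while a structure is being built, before it knows any outside items. By `hm`
their keys occur in the skeleton, so distinct elements get distinct places. -/
theorem StrOk.add (hW : StrOk σ m h W T ∅) (hσ : σ.Ok m s) {x : Item E}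
    (hx : x.2.bits.length ≤ h) (hu : Uniq (insert x T))
    (hm : List.Forall₂ (fun k t => k ∈ t.toList) (σ.keys x.1) W.U) :
    StrOk σ m h (W.add σ x) (insert x T) ∅ := by
  have hid : ∀ y ∈ T, y.2 = x.2 → y = x := fun y hy => (hu y (.inr hy) x (.inl rfl)).2
  have hm' : ∀ y ∈ insert x T, List.Forall₂ (fun k t => k ∈ t.toList) (σ.keys y.1) W.U := by
    rintro y (rfl | hy)
    · exact hm
    · exact hW.mem y hy
  refine ⟨hW.sorted, hW.depth, hm', ?_, ?_, ?_⟩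
  · intro k y
    simp only [Str.add, Trie.get_set]
    split_ifs with hk
    · subst hk
      rw [Option.some.injEq]
      constructor
      · rintro rfl
        exact ⟨.inl rfl, rfl⟩
      · rintro ⟨hy, hp⟩
        simp only [Elems.place, List.flatten_cons, List.cons_append, List.cons.injEq,
          List.nil_append, Elems.codes] at hp
        obtain ⟨hp₁, hp₂⟩ := hp
        rw [hp₁] at hp₂
        exact (hu x (.inl rfl) y hy).1
          (hσ.inj _ _ hp₁ (flatten_codes_inj hW.sorted hm (hm' y hy) hp₂))
    · rw [hW.dict, Set.mem_insert_iff]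
      constructor
      · rintro ⟨hy, rfl⟩
        exact ⟨.inr hy, rfl⟩
      · rintro ⟨rfl | hy, rfl⟩
        · exact absurd rfl hk
        · exact ⟨hy, rfl⟩
  · refine hW.P.upd hσ hW.depth hx ?_ ?_ (by simp)
    · rintro y (hy | hy)
      · exact hid y hy
      · exact absurd hy.2 (by simp)
    · intro y
      by_cases hyx : y = x
      · simp [hyx]
      · simp [hyx, eq_comm (a := x)]
  · simp only [Str.add]
    split_ifs with hs
    · refine hW.Q.upd hσ hW.depth hx ?_ ?_ (by simp)
      · rintro y (hy | hy)
        · exact hid y hy.2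
        · exact absurd hy.2 (by simp)
      · intro y
        by_cases hyx : y = x
        · simp [hyx, hs]
        · simp [hyx, eq_comm (a := x)]
    · have : {y | σ.side y.1 = true ∧ y ∈ insert x T ∨ σ.side y.1 = false ∧ y ∈ (∅ : Set (Item E))} =
          {y | σ.side y.1 = true ∧ y ∈ T ∨ σ.side y.1 = false ∧ y ∈ (∅ : Set (Item E))} := by
        ext y
        by_cases hyx : y = x
        · simp [hyx, hs]
        · simp [hyx]
      rw [this]
      exact hW.Q

theorem strOk_empty {U : List Bst} (h₁ : ∀ t ∈ U, t.toList.Pairwise (· ≤ ·))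
    (h₂ : ∀ t ∈ U, t.depth ≤ h) : StrOk σ m h ⟨U, .nil, .nil, .nil⟩ ∅ ∅ := by
  refine ⟨h₁, h₂, by simp, by simp, ⟨?_, ?_, ?_, ?_⟩, ⟨?_, ?_, ?_, ?_⟩⟩ <;>
    simp [Nest.WF, Nest.BaseLe, Nest.ht]

section calls
open Code

theorem Elems.Ok.wt_codes_le (hσ : σ.Ok m s) {U : List Bst} (hU : ∀ t ∈ U, t.depth ≤ h) (e : E) :
    wt (σ.codes U e) + (h + 1) + m + 1 ≤ unit m h ∧ (σ.codes U e).length = m ∧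
      ∀ id : List Bool, id.length ≤ h →
        pathNodes (id.length + 2) (σ.codes U e) ≤ unit m h := by
  have hl : (σ.codes U e).length = m := (length_codes _ _ _).trans (hσ.length e)
  have hc := length_le_of_mem_codes (side := σ.side e) (ks := σ.keys e) hU
  have h₁ : wt (σ.codes U e) ≤ m * (h + 1) := hl ▸ wt_le hc
  obtain ⟨u₁, u₂, u₃⟩ := unit_bounds m h
  refine ⟨by nlinarith, hl, fun id hid => ?_⟩
  refine (pathNodes_le (by omega) _ hc).trans (le_trans ?_ u₂)
  rw [show (DynJoin.codes (σ.side e) (σ.keys e) U).length = m from hl]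
  gcongr

theorem call_codesOf (U : List Bst) (e : E) : CallLE (prog kB) Code.codes
    (.pair (encBool (σ.side e)) (.pair (encReals (σ.keys e)) (encSkel U)))
    (encCodes (σ.codes U e)) (100 * (wt (σ.codes U e) + 1)) :=
  call_codes _ _ _

theorem encItem_eq (x : Item E) : encItem σ x = .pair (.pair (encBool (σ.side x.1))
    (.pair (encReals (σ.keys x.1)) (σ.pay x.1))) (encBits x.2.bits) := rfl

theorem call_lookup (hW : StrOk σ m h W T lo) (hσ : σ.Ok m s) (e : E) :
    CallLE (prog kB) lookup (.pair (W.enc σ) (σ.enc e)) (encSlot σ (W.look σ e))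
      (600 * unit m h) := by
  obtain ⟨h₁, h₂, h₃⟩ := hσ.wt_codes_le hW.depth e
  refine .of_body (body := bLookup) rfl ?_
  simp [bLookup, cell, Str.enc, Elems.enc, wD, codesOf, side, keys, wU]
  refine (call_codesOf W.U e).exec fun t₁ ht₁ => ?_
  have ht := call_tget (kB := kB) (σ := σ) ([σ.side e] :: σ.codes W.U e) W.dict
  rw [wt_cons] at ht
  refine ht.exec fun t₂ ht₂ => ?_
  rw [Str.look, show ([σ.side e] :: σ.codes W.U e).flatten = σ.place W.U e from rfl]
  rcases hg : W.dict.get (σ.place W.U e) with _ | y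
  · simp at ht₂ ⊢
    omega
  · simp [encItem_eq]
    refine (call_eqk (σ.keys y.1) (σ.keys e)
      ((hσ.length _).trans (hσ.length _).symm)).exec fun t₃ ht₃ => ?_
    rw [hσ.length] at ht₃
    simp at ht₂
    by_cases hk : σ.keys y.1 = σ.keys e <;> simp [hk, encItem_eq] <;> omega

theorem call_low (hW : StrOk σ m h W T lo) (hσ : σ.Ok m s) (x : Item E)
    (hx : x.2.bits.length ≤ h) :
    CallLE (prog kB) Code.low (.pair (W.enc σ) (encItem σ x)) ((W.low σ x).enc σ)
      (600 * unit m h) := by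
  obtain ⟨h₁, h₂, h₃⟩ := hσ.wt_codes_le hW.depth x.1
  have h₃ := h₃ _ hx
  refine .of_body (body := bLow) rfl ?_
  simp [bLow, cell, Str.enc, encItem_eq, wD, codesOf, side, keys, wU, wP, wQ]
  refine (call_codesOf W.U x.1).exec fun t₁ ht₁ => ?_
  cases hs : σ.side x.1
  · have := call_upd (kB := kB) (σ := σ) (σ.side x.1) x.2.bits (some x) (σ.codes W.U x.1)
      (h₂ ▸ hW.Q.wf)
    simp only [encInfo, hs, encCodes_cons, encCodes_nil, encSlot_some, encItem_eq] at this
    simp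
    refine this.exec fun t₂ ht₂ => ?_
    simp [Str.low, hs, Str.put]
    omega
  · have := call_upd (kB := kB) (σ := σ) (σ.side x.1) x.2.bits (some x) (σ.codes W.U x.1)
      (h₂ ▸ hW.P.wf)
    simp only [encInfo, hs, encCodes_cons, encCodes_nil, encSlot_some, encItem_eq] at this
    simp
    refine this.exec fun t₂ ht₂ => ?_
    simp [Str.low, hs, Str.put]
    omega

theorem call_del (hW : StrOk σ m h W T lo) (hσ : σ.Ok m s) (x : Item E)
    (hx : x.2.bits.length ≤ h) :
    CallLE (prog kB) Code.del (.pair (W.enc σ) (encItem σ x)) ((W.del σ x).enc σ)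
      (2000 * unit m h) := by
  obtain ⟨h₁, h₂, h₃⟩ := hσ.wt_codes_le hW.depth x.1
  have h₃ := h₃ _ hx
  have hP := call_upd (kB := kB) (σ := σ) (σ.side x.1) x.2.bits none (σ.codes W.U x.1)
    (h₂ ▸ hW.P.wf)
  have hQ := call_upd (kB := kB) (σ := σ) (σ.side x.1) x.2.bits none (σ.codes W.U x.1)
    (h₂ ▸ hW.Q.wf)
  have hl := call_lookup (kB := kB) hW hσ x.1
  have ht := call_tset (kB := kB) (σ := σ) ([σ.side x.1] :: σ.codes W.U x.1) none W.dict
  simp only [encInfo, encCodes_cons, encCodes_nil, encSlot_none] at hP hQ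
  simp [wt_cons] at ht
  refine .of_body (body := bDel) rfl ?_
  simp [bDel, cell, Str.enc, encItem_eq, wD, codesOf, side, keys, wU, wP, wQ, Elems.enc] at hl ⊢
  refine (call_codesOf W.U x.1).exec fun t₁ ht₁ => ?_
  refine hl.exec fun t₂ ht₂ => ?_
  rcases hlook : W.look σ x.1 with _ | y
  · simp
    refine hP.exec fun t₃ ht₃ => hQ.exec fun t₄ ht₄ => ?_
    simp [Str.del, hlook, Str.put]
    omega
  · simp [encItem_eq]
    refine ht.exec fun t₅ ht₅ => hP.exec fun t₃ ht₃ => hQ.exec fun t₄ ht₄ => ?_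
    simp [Str.del, hlook, Str.put, Elems.place]
    omega

theorem call_add (hW : StrOk σ m h W T lo) (hσ : σ.Ok m s) (x : Item E)
    (hx : x.2.bits.length ≤ h) :
    CallLE (prog kB) Code.add (.pair (W.enc σ) (encItem σ x)) ((W.add σ x).enc σ)
      (2000 * unit m h) := by
  obtain ⟨h₁, h₂, h₃⟩ := hσ.wt_codes_le hW.depth x.1
  have h₃ := h₃ _ hx
  have hP := call_upd (kB := kB) (σ := σ) (σ.side x.1) x.2.bits (some x) (σ.codes W.U x.1)
    (h₂ ▸ hW.P.wf)
  have hQ := call_upd (kB := kB) (σ := σ) (σ.side x.1) x.2.bits (some x) (σ.codes W.U x.1)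
    (h₂ ▸ hW.Q.wf)
  have ht := call_tset (kB := kB) (σ := σ) ([σ.side x.1] :: σ.codes W.U x.1) (some x) W.dict
  simp only [encInfo, encCodes_cons, encCodes_nil, encSlot_some, encItem_eq] at hP hQ
  simp [wt_cons, encItem_eq] at ht
  refine .of_body (body := bAdd) rfl ?_
  simp [bAdd, cell, Str.enc, encItem_eq, wD, codesOf, side, keys, wU, wP, wQ]
  refine (call_codesOf W.U x.1).exec fun t₁ ht₁ => ?_
  refine ht.exec fun t₅ ht₅ => hP.exec fun t₃ ht₃ => ?_
  cases hs : σ.side x.1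
  · simp
    simp [Str.add, hs, Str.put, Elems.place]
    omega
  · rw [hs] at hQ
    simp at hQ ⊢
    refine hQ.exec fun t₄ ht₄ => ?_
    simp [Str.add, hs, Str.put, Elems.place]
    omega

end calls
end
end DynJoin

/-! ### Growth and construction of structures. -/

namespace DynJoin

theorem size_encBits (l : List Bool) : (encBits l).size ≤ 4 * l.length + 1 := by
  induction l with
  | nil => simp [Val.size]
  | cons b l ih =>
    have : (encBool b).size ≤ 3 := by cases b <;> simp [Val.size]
    simp only [encBits_cons, Val.size, List.length_cons]
    omega

theorem unit_mono (m : ℕ) {h h' : ℕ} (hh : h ≤ h') : unit m h ≤ unit m h' := by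
  unfold unit
  gcongr

/-- The unit of size, for elements of size at most `s`. -/
def sizeUnit (m s h : ℕ) : ℕ := 4 * (s + 4 * h + 30) * unit m h

section
variable {E : Type} {σ : Elems E} {m s h : ℕ} {W : Str E} {T lo : Set (Item E)} {kB : Expr}

theorem Elems.Ok.size_item (hσ : σ.Ok m s) {x : Item E} (hx : x.2.bits.length ≤ h) :
    (encItem σ x).size ≤ s + 4 * h + 2 := by
  have h₁ := hσ.size x.1
  have h₂ := size_encBits x.2.bits
  simp only [encItem, Val.size]
  omega

theorem StrOk.size_put (hW : StrOk σ m h W T lo) (hσ : σ.Ok m s) {x : Item E}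
    (hx : x.2.bits.length ≤ h) {o : Option (Item E)} (ho : ∀ y, o = some y → y = x)
    (v : Nest (Item E)) :
    ((W.put σ x o v).enc σ).size ≤ (v.enc σ).size + (s + 4 * h + 30) * unit m h := by
  have h₁ := Nest.size_upd_le σ (σ.side x.1) x.2.bits o (σ.codes W.U x.1) v
  have h₂ := (hσ.wt_codes_le hW.depth x.1).2.2 _ hx
  have h₃ : (encSlot σ o).size ≤ s + 4 * h + 2 := by
    cases o with
    | none => simp [Val.size]
    | some y =>
      obtain rfl := ho y rfl
      exact hσ.size_item hx
  refine h₁.trans (Nat.add_le_add_left ?_ _)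
  exact Nat.mul_le_mul (by omega) h₂

theorem StrOk.length_place (hW : StrOk σ m h W T lo) (hσ : σ.Ok m s) (e : E) :
    (σ.place W.U e).length + 1 ≤ unit m h := by
  have h₁ := (hσ.wt_codes_le hW.depth e).1
  have : (σ.codes W.U e).flatten.length ≤ wt (σ.codes W.U e) := by
    rw [List.length_flatten, wt]
    omega
  simp only [Elems.place, List.flatten_cons, List.length_append, List.length_singleton]
  omega

theorem StrOk.size_low (hW : StrOk σ m h W T lo) (hσ : σ.Ok m s) {x : Item E}
    (hx : x.2.bits.length ≤ h) :
    ((W.low σ x).enc σ).size ≤ (W.enc σ).size + sizeUnit m s h := by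
  have h₁ := hW.size_put hσ hx (o := some x) (by simp) W.P
  have h₂ := hW.size_put hσ hx (o := some x) (by simp) W.Q
  simp only [Str.low, Str.enc, Val.size, sizeUnit]
  split_ifs <;> nlinarith

/-- A deletion can enlarge the nested tries, as it lays out nodes along the codes even where nothing
is stored. Rebuilding bounds the number of updates for which this is charged. -/
theorem StrOk.size_del (hW : StrOk σ m h W T lo) (hσ : σ.Ok m s) {x : Item E}
    (hx : x.2.bits.length ≤ h) :
    ((W.del σ x).enc σ).size ≤ (W.enc σ).size + sizeUnit m s h := by
  have h₁ := hW.size_put hσ hx (o := none) (by simp) W.P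
  have h₂ := hW.size_put hσ hx (o := none) (by simp) W.Q
  have h₃ := Trie.size_set_le σ none (σ.place W.U x.1) W.dict
  have h₄ := hW.length_place hσ x.1
  simp only [encSlot_none, Val.size] at h₃
  simp only [Str.del, Str.enc, Val.size, sizeUnit]
  split_ifs <;> nlinarith

theorem StrOk.size_add (hW : StrOk σ m h W T lo) (hσ : σ.Ok m s) {x : Item E}
    (hx : x.2.bits.length ≤ h) :
    ((W.add σ x).enc σ).size ≤ (W.enc σ).size + sizeUnit m s h := by
  have h₁ := hW.size_put hσ hx (o := some x) (by simp) W.P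
  have h₂ := hW.size_put hσ hx (o := some x) (by simp) W.Q
  have h₃ := Trie.size_set_le σ (some x) (σ.place W.U x.1) W.dict
  have h₄ := hW.length_place hσ x.1
  have h₅ := hσ.size_item hx
  simp only [encSlot_some] at h₃
  obtain ⟨-, -, hu⟩ := unit_bounds m h
  simp only [Str.add, Str.enc, Val.size, sizeUnit]
  split_ifs <;> nlinarith

theorem Str.nodes_del (x : Item E) (W : Str E) :
    (W.del σ x).dict.nodes ≤ W.dict.nodes := by
  simp only [Str.del]
  split_ifs
  · exact Trie.nodes_set_none_le _ _
  · exact le_rfl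

theorem StrOk.nodes_add (hW : StrOk σ m h W T lo) (hσ : σ.Ok m s) (x : Item E) :
    (W.add σ x).dict.nodes ≤ W.dict.nodes + unit m h := by
  have h₁ := hW.length_place hσ x.1
  have h₂ := Trie.nodes_set_le (some x) (σ.place W.U x.1) W.dict
  simp only [Str.add]
  omega

theorem StrOk.nodup_dict (hW : StrOk σ m h W T lo) : W.dict.toList.Nodup := by
  refine Trie.nodup_toList fun k k' x h h' => ?_
  rw [((hW.dict _ _).1 h).2, ((hW.dict _ _).1 h').2]

theorem StrOk.mem_dict (hW : StrOk σ m h W T lo) {x : Item E} : x ∈ W.dict.toList ↔ x ∈ T := by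
  rw [Trie.mem_toList]
  constructor
  · rintro ⟨k, hk⟩
    exact ((hW.dict _ _).1 hk).1
  · exact fun hx => ⟨_, (hW.dict _ _).2 ⟨hx, rfl⟩⟩

open Code

theorem exists_addAll (hσ : σ.Ok m s) (l : List (Item E)) (W : Str E) {T : Set (Item E)}
    (hW : StrOk σ m h W T ∅) (hx : ∀ x ∈ l, x.2.bits.length ≤ h)
    (hu : Uniq (T ∪ {x | x ∈ l}))
    (hm : ∀ x ∈ l, List.Forall₂ (fun k t => k ∈ t.toList) (σ.keys x.1) W.U) :
    ∃ W' : Str E, CallLE (prog kB) addAll (.pair (encItems σ l) (W.enc σ)) (W'.enc σ)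
        (2100 * unit m h * (l.length + 1)) ∧
      StrOk σ m h W' (T ∪ {x | x ∈ l}) ∅ ∧
      W'.dict.nodes ≤ W.dict.nodes + l.length * unit m h ∧
      (W'.enc σ).size ≤ (W.enc σ).size + l.length * sizeUnit m s h := by
  have hu1 := (unit_bounds m h).2.2
  induction l generalizing W T with
  | nil =>
    refine ⟨W, .of_body (body := bAddAll) rfl ?_, by simpa using hW, by simp, by simp⟩
    simp [bAddAll, cell]
    omega
  | cons x l ih =>
    have e : T ∪ {y | y ∈ x :: l} = insert x T ∪ {y | y ∈ l} := by
      ext y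
      simp only [List.mem_cons, Set.mem_union, Set.mem_ofPred_eq, Set.mem_insert_iff]
      tauto
    rw [e] at hu ⊢
    have hx' := hx x (by simp)
    have hW' := hW.add hσ hx' (fun a ha b hb => hu a (.inl ha) b (.inl hb)) (hm x (by simp))
    obtain ⟨W', c, h₁, h₂, h₃⟩ := ih (W.add σ x) hW' (fun y hy => hx y (by simp [hy])) hu
      (fun y hy => hm y (by simp [hy]))
    have := hW.nodes_add hσ x
    have := hW.size_add hσ hx'
    refine ⟨W', .of_body (body := bAddAll) rfl ?_, h₁, ?_, ?_⟩
    · simp [bAddAll, cell]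
      refine (call_add hW hσ x hx').exec fun t₁ ht₁ => c.exec fun t₂ ht₂ => ?_
      simp
      nlinarith
    · rw [List.length_cons]
      linarith
    · rw [List.length_cons]
      linarith

/-- The skeleton for all items comes first; then the items are added one at a time, each with its
keys already in the skeleton. -/
theorem exists_build (hσ : σ.Ok m s) (l : List (Item E)) (hx : ∀ x ∈ l, x.2.bits.length ≤ h)
    (hu : Uniq {x | x ∈ l}) (hl : l.length < 2 ^ h) :
    ∃ W : Str E, CallLE (prog kB) build (encItems σ l) (W.enc σ)
        (3000 * unit m h * (l.length + 1)) ∧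
      StrOk σ m h W {x | x ∈ l} ∅ ∧
      W.dict.nodes ≤ l.length * unit m h ∧
      (W.enc σ).size ≤ 2 * (l.length + 1) * sizeUnit m s h := by
  obtain ⟨hu1, -, hu3⟩ := unit_bounds m h
  obtain ⟨U, hU, zU, cU⟩ := exists_skel (kB := kB) h m (l.map fun x => σ.keys x.1)
    (by
      intro k hk
      obtain ⟨x, -, rfl⟩ := List.mem_map.1 hk
      exact hσ.length _)
    (by simpa using hl)
  rw [List.length_map] at zU cU
  obtain ⟨W, c, h₁, h₂, h₃⟩ := exists_addAll (kB := kB) hσ l ⟨U, .nil, .nil, .nil⟩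
    (strOk_empty (σ := σ) (m := m) hU.sorted hU.depth) hx (by simpa using hu)
    (fun x hx => hU.mem _ (List.mem_map.2 ⟨x, hx, rfl⟩))
  refine ⟨W, .of_body (body := bBuild) rfl ?_, by simpa using h₁, by simpa [Trie.nodes] using h₂, ?_⟩
  · simp [bBuild]
    refine (call_keysOf l).exec fun t₁ ht₁ => cU.exec fun t₂ ht₂ => c.exec fun t₃ ht₃ => ?_
    have : (m + 1) * (l.length * h + l.length + 1) ≤ unit m h * (l.length + 1) := by
      refine le_trans ?_ (Nat.mul_le_mul_right _ hu1)
      nlinarith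
    simp
    nlinarith
  · have : (m + 1) * (l.length + 1) ≤ unit m h * (l.length + 1) := by
      refine Nat.mul_le_mul_right _ (le_trans ?_ hu1)
      nlinarith
    simp only [Str.enc, Trie.enc_nil, Nest.enc, Val.size] at h₃
    refine h₃.trans ?_
    have : 12 * unit m h ≤ sizeUnit m s h := by
      unfold sizeUnit
      exact Nat.mul_le_mul_right _ (by omega)
    nlinarith

/-! ## Lists of structures -/

def encStrs (σ : Elems E) : List (Option (Str E)) → Val
  | [] => .nil
  | none :: ws => .pair .nil (encStrs σ ws)
  | some W :: ws => .pair (W.enc σ) (encStrs σ ws)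

/-- All structures in the list are in order. -/
def AllOk (σ : Elems E) (m h : ℕ) (ws : List (Option (Str E))) : Prop :=
  ∀ W, some W ∈ ws → ∃ T lo, StrOk σ m h W T lo

noncomputable def findIn (σ : Elems E) (e : E) : List (Option (Str E)) → Option (Item E)
  | [] => none
  | none :: ws => findIn σ e ws
  | some W :: ws => match W.look σ e with
    | none => findIn σ e ws
    | some y => some y

theorem AllOk.tail {w : Option (Str E)} {ws : List (Option (Str E))} (h' : AllOk σ m h (w :: ws)) :
    AllOk σ m h ws := fun W hW => h' W (by simp [hW])

theorem call_find (hσ : σ.Ok m s) (e : E) {ws : List (Option (Str E))} (hws : AllOk σ m h ws) :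
    CallLE (prog kB) find (.pair (encStrs σ ws) (σ.enc e)) (encSlot σ (findIn σ e ws))
      (700 * unit m h * (ws.length + 1)) := by
  have hu1 := (unit_bounds m h).2.2
  induction ws with
  | nil =>
    refine .of_body (body := bFind) rfl ?_
    simp [bFind, cell, encStrs, findIn]
    omega
  | cons w ws ih =>
    have ih := ih hws.tail
    refine .of_body (body := bFind) rfl ?_
    cases w with
    | none =>
      simp [bFind, cell, encStrs, findIn]
      refine ih.exec fun t ht => ?_
      simp
      nlinarith
    | some W =>
      obtain ⟨T, lo, hW⟩ := hws W (by simp)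
      have hl := call_lookup (kB := kB) hW hσ e
      simp only [Str.enc] at hl
      simp [bFind, cell, encStrs, findIn, Str.enc]
      refine hl.exec fun t₁ ht₁ => ?_
      rcases W.look σ e with _ | y
      · simp
        refine ih.exec fun t ht => ?_
        simp
        nlinarith
      · simp [encItem_eq]
        nlinarith

theorem call_map {fm f c : ℕ} (hp : (prog kB)[fm]? = some (bMap fm f)) (g : Str E → Str E)
    {x : Item E} {ws : List (Option (Str E))}
    (hws : ∀ W, some W ∈ ws → CallLE (prog kB) f (.pair (W.enc σ) (encItem σ x)) ((g W).enc σ) c) :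
    CallLE (prog kB) fm (.pair (encStrs σ ws) (encItem σ x)) (encStrs σ (ws.map (Option.map g)))
      ((c + 30) * (ws.length + 1)) := by
  induction ws with
  | nil =>
    refine .of_body hp ?_
    simp [bMap, cell, encStrs]
  | cons w ws ih =>
    have ih := ih fun W hW => hws W (by simp [hW])
    refine .of_body hp ?_
    cases w with
    | none =>
      simp [bMap, cell, encStrs]
      refine ih.exec fun t ht => ?_
      simp
      nlinarith
    | some W =>
      have hW := hws W (by simp)
      simp only [Str.enc] at hW
      simp [bMap, cell, encStrs, Str.enc]
      refine hW.exec fun t₁ ht₁ => ih.exec fun t ht => ?_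
      simp
      nlinarith

/-- All items of the structures, added to a list. -/
def flatIn : List (Option (Str E)) → List (Item E) → List (Item E)
  | [], acc => acc
  | none :: ws, acc => flatIn ws acc
  | some W :: ws, acc => flatIn ws (W.dict.toList ++ acc)

def sumNodes : List (Option (Str E)) → ℕ
  | [] => 0
  | none :: ws => sumNodes ws
  | some W :: ws => W.dict.nodes + sumNodes ws

theorem call_flatAll (ws : List (Option (Str E))) (acc : List (Item E)) :
    CallLE (prog kB) flatAll (.pair (encStrs σ ws) (encItems σ acc)) (encItems σ (flatIn ws acc))
      (120 * (sumNodes ws + ws.length + 1)) := by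
  induction ws generalizing acc with
  | nil =>
    refine .of_body (body := bFlatAll) rfl ?_
    simp [bFlatAll, cell, encStrs, flatIn]
    omega
  | cons w ws ih =>
    refine .of_body (body := bFlatAll) rfl ?_
    cases w with
    | none =>
      simp [bFlatAll, cell, encStrs, flatIn]
      refine (ih acc).exec fun t ht => ?_
      simp [sumNodes]
      omega
    | some W =>
      simp [bFlatAll, cell, encStrs, flatIn, Str.enc, wD]
      refine (call_flat W.dict acc).exec fun t₁ ht₁ => (ih _).exec fun t ht => ?_
      simp [sumNodes]
      omega

theorem call_full (ws : List (Option (Str E))) :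
    CallLE (prog kB) full (encStrs σ ws) (encBool (ws.all Option.isSome))
      (20 * (ws.length + 1)) := by
  induction ws with
  | nil =>
    refine .of_body (body := bFull) rfl ?_
    simp [bFull, encStrs, tt]
  | cons w ws ih =>
    refine .of_body (body := bFull) rfl ?_
    cases w with
    | none =>
      simp [bFull, encStrs]
      omega
    | some W =>
      simp [bFull, encStrs, Str.enc]
      refine ih.exec fun t ht => ?_
      simp
      omega

theorem call_slots (l : List (Item E)) :
    CallLE (prog kB) slots (encItems σ l) (encStrs σ (.replicate (Nat.log 2 l.length) none))
      (100 * (l.length + 1)) := by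
  induction hn : l.length using Nat.strong_induction_on generalizing l with
  | _ n ih =>
    subst hn
    refine .of_body (body := bSlots) rfl ?_
    rcases l with _ | ⟨x, _ | ⟨y, l⟩⟩
    · simp [bSlots, encStrs]
    · simp [bSlots, encStrs]
    · have c₀ := call_halve (kB := kB) ((x :: y :: l).map (encItem σ))
      have hlen := (length_halves (x :: y :: l)).2
      have ih := ih _ (by rw [hlen]; simp; omega) (halves (x :: y :: l)).2 rfl
      rw [halves_map] at c₀
      have hlog : Nat.log 2 (x :: y :: l).length = Nat.log 2 (halves (x :: y :: l)).2.length + 1 := by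
        rw [hlen, Nat.log_of_one_lt_of_le (by simp) (by simp)]
      rw [hlog]
      simp [bSlots, encItems, encStrs, List.replicate_succ] at c₀ ih ⊢
      refine c₀.exec fun t₀ ht₀ => ?_
      simp
      refine ih.exec fun t₁ ht₁ => ?_
      simp at hlen ⊢
      omega

theorem call_inc (n : ℕ) : CallLE (prog kB) inc (encBits n.bits) (encBits (n + 1).bits)
    (20 * (n.bits.length + 1)) := by
  induction n using Nat.strong_induction_on with
  | _ n ih =>
    refine .of_body (body := bInc) rfl ?_
    rcases Nat.even_or_odd' n with ⟨k, rfl | rfl⟩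
    · rcases Nat.eq_zero_or_pos k with rfl | hk
      · simp [bInc, tt]
      · rw [Nat.bit1_bits, Nat.bit0_bits k hk.ne']
        simp [bInc, tt]
        omega
    · rw [show 2 * k + 1 + 1 = 2 * (k + 1) by ring, Nat.bit1_bits, Nat.bit0_bits _ (by omega)]
      simp [bInc]
      refine (ih k (by omega)).exec fun t ht => ?_
      simp
      omega

/-- New identifiers. -/
def relabel : List (Item E) → ℕ → List (Item E)
  | [], _ => []
  | x :: xs, n => (x.1, n) :: relabel xs (n + 1)

theorem call_label (l : List (Item E)) (n : ℕ) (hn : n + l.length < 2 ^ h) :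
    CallLE (prog kB) label (.pair (encItems σ l) (encBits n.bits))
      (.pair (encItems σ (relabel l n)) (encBits (n + l.length).bits))
      (20 * (h + 4) * (l.length + 1)) := by
  induction l generalizing n with
  | nil =>
    refine .of_body (body := bLabel) rfl ?_
    simp [bLabel, cell, relabel]
    omega
  | cons x l ih =>
    have hb : n.bits.length ≤ h := by
      rw [Nat.size_eq_bits_len, Nat.size_le]
      omega
    rw [List.length_cons] at hn
    have ih := ih (n + 1) (by omega)
    rw [show n + 1 + l.length = n + (l.length + 1) by ring] at ih
    refine .of_body (body := bLabel) rfl ?_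
    simp [bLabel, cell, relabel]
    refine (call_inc n).exec fun t₀ ht₀ => ih.exec fun t₁ ht₁ => ?_
    simp [encItem]
    nlinarith

theorem map_fst_relabel (l : List (Item E)) (n : ℕ) :
    (relabel l n).map Prod.fst = l.map Prod.fst := by
  induction l generalizing n with
  | nil => rfl
  | cons x l ih => simp [relabel, ih]

theorem length_relabel (l : List (Item E)) (n : ℕ) : (relabel l n).length = l.length := by
  simpa using congrArg List.length (map_fst_relabel l n)

theorem mem_relabel {l : List (Item E)} {n : ℕ} {x : Item E} (hx : x ∈ relabel l n) :
    n ≤ x.2 ∧ x.2 < n + l.length := by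
  induction l generalizing n with
  | nil => simp [relabel] at hx
  | cons y l ih =>
    rcases List.mem_cons.1 hx with rfl | hx
    · simp
    · have := ih hx
      simp only [List.length_cons]
      omega

theorem uniq_relabel {l : List (Item E)} (hl : (l.map Prod.fst).Nodup) (n : ℕ) :
    Uniq {x | x ∈ relabel l n} ∧ (relabel l n).Nodup := by
  have hl' := hl
  rw [← map_fst_relabel l n] at hl'
  refine ⟨fun x hx y hy => ⟨fun h => List.inj_on_of_nodup_map hl' hx hy h, ?_⟩, hl'.of_map⟩
  clear hl'
  revert x y
  induction l generalizing n with
  | nil => simp [relabel]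
  | cons z l ih =>
    intro x hx y hy he
    have ih := ih (List.nodup_cons.1 hl).2 (n + 1)
    rcases List.mem_cons.1 hx with rfl | hx <;> rcases List.mem_cons.1 hy with rfl | hy
    · rfl
    · have := mem_relabel hy
      simp at he
      omega
    · have := mem_relabel hx
      simp at he
      omega
    · exact ih x hx y hy he

end
end DynJoin

/-! ### The logarithmic method. -/

namespace DynJoin

/-- Used to separate the items of the top structure, which is listed first, from those of the slots.
-/
theorem flatIn_perm {E : Type} (ws : List (Option (Str E))) (l acc : List (Item E)) :
    (flatIn ws (l ++ acc)).Perm (l ++ flatIn ws acc) := by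
  induction ws generalizing acc with
  | nil => exact .refl _
  | cons w ws ih =>
    cases w with
    | none => exact ih acc
    | some W =>
      refine .trans ?_ (ih _)
      have key : ∀ l₁ l₂ : List (Item E), l₁.Perm l₂ → (flatIn ws l₁).Perm (flatIn ws l₂) := by
        clear ih
        induction ws with
        | nil => exact fun _ _ h => h
        | cons w ws ih =>
          cases w with
          | none => exact ih
          | some W => exact fun _ _ h => ih _ _ (h.append_left _)
      refine key _ _ ?_
      rw [← List.append_assoc, ← List.append_assoc]
      exact List.perm_append_comm.append_right _

section
variable {E : Type}

/-- The structures in the list hold disjoint sets of at most `u`, `2 u`, `4 u`, … items, and each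
of them knows the items of `lo` and of the preceding ones. The set of all items is `S`. -/
def Inv (σ : Elems E) (m h : ℕ) : Set (Item E) → ℕ → List (Option (Str E)) → Set (Item E) → Prop
  | lo, _, [], S => S = lo
  | lo, u, none :: ws, S => Inv σ m h lo (2 * u) ws S
  | lo, u, some W :: ws, S => ∃ T : Finset (Item E), T.card ≤ u ∧ Disjoint (T : Set (Item E)) lo ∧
      StrOk σ m h W T lo ∧ W.dict.nodes ≤ u * unit m h ∧ Inv σ m h (lo ∪ T) (2 * u) ws S

variable {σ : Elems E} {m s h u : ℕ} {lo S : Set (Item E)} {ws : List (Option (Str E))} {kB : Expr}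

theorem Inv.subset (hw : Inv σ m h lo u ws S) : lo ⊆ S := by
  induction ws generalizing lo u with
  | nil => exact Eq.ge hw
  | cons w ws ih =>
    cases w with
    | none => exact ih hw
    | some W =>
      obtain ⟨T, -, -, -, -, hw⟩ := hw
      exact Set.subset_union_left.trans (ih hw)

theorem Inv.allOk (hw : Inv σ m h lo u ws S) : AllOk σ m h ws := by
  induction ws generalizing lo u with
  | nil => simp [AllOk]
  | cons w ws ih =>
    intro W hW
    cases w with
    | none => exact ih hw W (by simpa using hW)
    | some W' =>
      obtain ⟨T, -, -, hT, -, hw⟩ := hw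
      rcases List.mem_cons.1 hW with hW | hW
      · cases hW
        exact ⟨_, _, hT⟩
      · exact ih hw W hW

theorem Inv.mem_iff (hw : Inv σ m h lo u ws S) (y : Item E) :
    y ∈ S ↔ y ∈ lo ∨ ∃ W, some W ∈ ws ∧ y ∈ W.dict.toList := by
  induction ws generalizing lo u with
  | nil => simp [show S = lo from hw]
  | cons w ws ih =>
    cases w with
    | none => simpa using ih hw
    | some W =>
      obtain ⟨T, -, -, hT, -, hw⟩ := hw
      rw [ih hw]
      have := hT.mem_dict (x := y)
      simp only [Set.mem_union, List.mem_cons, Option.some.injEq, or_and_right, exists_or,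
        exists_eq_left, this, or_assoc]

theorem AllOk.findIn_isSome (hσ : σ.Ok m s) (hws : AllOk σ m h ws) {e : E} {y : Item E} {W : Str E}
    (hW : some W ∈ ws) (hy : y ∈ W.dict.toList) (he : y.1 = e) : (findIn σ e ws).isSome := by
  induction ws with
  | nil => simp at hW
  | cons w ws ih =>
    cases w with
    | none => exact ih hws.tail (by simpa using hW)
    | some W' =>
      rw [findIn]
      rcases hl : W'.look σ e with _ | z
      · refine ih hws.tail ((List.mem_cons.1 hW).resolve_left fun h => ?_)
        cases h
        obtain ⟨T, lo, hT⟩ := hws W (by simp)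
        rw [(hT.look_eq_some hσ).2 ⟨hT.mem_dict.1 hy, he⟩] at hl
        simp at hl
      · simp

theorem AllOk.findIn_some (hσ : σ.Ok m s) (hws : AllOk σ m h ws) {e : E} {y : Item E}
    (hf : findIn σ e ws = some y) : y.1 = e ∧ ∃ W, some W ∈ ws ∧ y ∈ W.dict.toList := by
  induction ws with
  | nil => simp [findIn] at hf
  | cons w ws ih =>
    cases w with
    | none =>
      obtain ⟨h₁, W, h₂, h₃⟩ := ih hws.tail hf
      exact ⟨h₁, W, by simp [h₂], h₃⟩
    | some W' =>
      rw [findIn] at hf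
      rcases hl : W'.look σ e with _ | z
      · rw [hl] at hf
        obtain ⟨h₁, W, h₂, h₃⟩ := ih hws.tail hf
        exact ⟨h₁, W, by simp [h₂], h₃⟩
      · rw [hl] at hf
        cases hf
        obtain ⟨T, lo, hT⟩ := hws W' (by simp)
        obtain ⟨h₁, h₂⟩ := (hT.look_eq_some hσ).1 hl
        exact ⟨h₂, W', by simp, hT.mem_dict.2 h₁⟩

/-- The new item is placed below all slots: every structure learns about it, and none contains it
yet. -/
theorem Inv.low (hσ : σ.Ok m s) (hw : Inv σ m h lo u ws S) {x : Item E}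
    (hx : x.2.bits.length ≤ h) (hu : Uniq (insert x S)) (hxS : x ∉ S) :
    Inv σ m h (insert x lo) u (ws.map (Option.map (Str.low σ x))) (insert x S) := by
  induction ws generalizing lo u with
  | nil => simp [Inv, show S = lo from hw]
  | cons w ws ih =>
    cases w with
    | none => exact ih hw
    | some W =>
      obtain ⟨T, h₁, h₂, h₃, h₄, hw⟩ := hw
      have hs := hw.subset
      refine ⟨T, h₁, ?_, h₃.low hσ hx fun a ha b hb => hu a ?_ b ?_, h₄, ?_⟩
      · rw [Set.disjoint_insert_right]
        exact ⟨fun hxT => hxS (hs (.inr hxT)), h₂⟩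
      · exact Set.insert_subset_insert ((Set.union_comm _ _).trans_subset hs) ha
      · exact Set.insert_subset_insert ((Set.union_comm _ _).trans_subset hs) hb
      · rw [Set.insert_union]
        exact ih hw

theorem Inv.del (hσ : σ.Ok m s) (hw : Inv σ m h lo u ws S) {x : Item E}
    (hx : x.2.bits.length ≤ h) (hu : Uniq (insert x S)) :
    Inv σ m h (lo \ {x}) u (ws.map (Option.map (Str.del σ x))) (S \ {x}) := by
  classical
  induction ws generalizing lo u with
  | nil => simp [Inv, show S = lo from hw]
  | cons w ws ih =>
    cases w with
    | none => exact ih hw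
    | some W =>
      obtain ⟨T, h₁, h₂, h₃, h₄, hw⟩ := hw
      have hs := hw.subset
      have hd := h₃.del hσ hx fun a ha b hb =>
        hu a (Set.insert_subset_insert ((Set.union_comm _ _).trans_subset hs) ha) b
          (Set.insert_subset_insert ((Set.union_comm _ _).trans_subset hs) hb)
      refine ⟨T.erase x, (Finset.card_erase_le).trans h₁, ?_, ?_, ?_, ?_⟩
      · rw [Finset.coe_erase]
        exact h₂.mono Set.sdiff_subset Set.sdiff_subset
      · rwa [Finset.coe_erase]
      · exact (W.nodes_del x).trans h₄
      · rw [Finset.coe_erase, ← Set.union_sdiff_distrib]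
        exact ih hw

theorem Inv.flatIn {acc : List (Item E)} (hw : Inv σ m h {x | x ∈ acc} u ws S) (ha : acc.Nodup) :
    (flatIn ws acc).Nodup ∧ ∀ x, x ∈ flatIn ws acc ↔ x ∈ S := by
  induction ws generalizing acc u with
  | nil =>
    refine ⟨ha, ?_⟩
    simp [DynJoin.flatIn, show S = _ from hw]
  | cons w ws ih =>
    cases w with
    | none => exact ih hw ha
    | some W =>
      obtain ⟨T, h₁, h₂, h₃, h₄, hw⟩ := hw
      refine ih (u := 2 * u) ?_ ?_
      · convert hw using 1
        ext x
        simp [h₃.mem_dict, or_comm]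
      · refine h₃.nodup_dict.append ha ?_
        intro x hx hx'
        exact Set.disjoint_left.1 h₂ (h₃.mem_dict.1 hx) hx'

/-- A geometric series with sum `u * (2 ^ ws.length - 1)`; the second summand on the left avoids the
subtraction. -/
theorem Inv.sumNodes_le (hw : Inv σ m h lo u ws S) :
    sumNodes ws + u * unit m h ≤ u * 2 ^ ws.length * unit m h := by
  induction ws generalizing lo u with
  | nil => simp [sumNodes]
  | cons w ws ih =>
    cases w with
    | none =>
      have := ih hw
      simp only [sumNodes, List.length_cons, pow_succ]
      nlinarith
    | some W =>
      obtain ⟨T, -, -, -, h₄, hw⟩ := hw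
      have := ih hw
      simp only [sumNodes, List.length_cons, pow_succ]
      nlinarith

/-- The potential. -/
def pot : List (Option (Str E)) → ℕ
  | [] => 0
  -- Among `K` slots an occupied slot number `i`, counted from 0, contributes `2 ^ i * (K - i)`:
  -- each of its `2 ^ i` places prepays the way up through the remaining slots.
  | w :: ws => (if w.isSome then ws.length + 1 else 0) + 2 * pot ws

/-- The number with digits `0` for missing and `1` for present structures. -/
def cnt : List (Option (Str E)) → ℕ
  | [] => 0
  | w :: ws => (if w.isSome then 1 else 0) + 2 * cnt ws

theorem cnt_lt (ws : List (Option (Str E))) : cnt ws < 2 ^ ws.length := by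
  induction ws with
  | nil => simp [cnt]
  | cons w ws ih =>
    simp only [cnt, List.length_cons, pow_succ]
    split_ifs <;> omega

/-- The sum of `2 ^ i * (K - i)` for `i < K`. It is of order `2 ^ K`, enough to pay for a
rebuilding. -/
theorem pot_of_full {ws : List (Option (Str E))} (hw : ws.all Option.isSome = true) :
    pot ws + ws.length + 2 = 2 ^ (ws.length + 1) := by
  induction ws with
  | nil => simp [pot]
  | cons w ws ih =>
    simp only [List.all_cons, Bool.and_eq_true] at hw
    have := ih hw.2
    simp only [pot, hw.1, if_true, List.length_cons] at this ⊢
    rw [pow_succ]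
    omega

@[simp] theorem pot_map (g : Str E → Str E) (ws : List (Option (Str E))) :
    pot (ws.map (Option.map g)) = pot ws := by
  induction ws with
  | nil => rfl
  | cons w ws ih => simp [pot, ih]

@[simp] theorem cnt_map (g : Str E → Str E) (ws : List (Option (Str E))) :
    cnt (ws.map (Option.map g)) = cnt ws := by
  induction ws with
  | nil => rfl
  | cons w ws ih => simp [cnt, ih]

theorem pot_replicate (k : ℕ) : pot (List.replicate k (none : Option (Str E))) = 0 := by
  induction k with
  | zero => rfl
  | succ k ih => simp [List.replicate_succ, pot, ih]

theorem cnt_replicate (k : ℕ) : cnt (List.replicate k (none : Option (Str E))) = 0 := by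
  induction k with
  | zero => rfl
  | succ k ih => simp [List.replicate_succ, cnt, ih]

theorem inv_replicate (k : ℕ) : Inv σ m h lo u (List.replicate k none) lo := by
  induction k generalizing u with
  | zero => rfl
  | succ k ih => exact ih

/-- All structures have size at most `z`. -/
def SizeLe (σ : Elems E) (z : ℕ) (ws : List (Option (Str E))) : Prop :=
  ∀ W, some W ∈ ws → (W.enc σ).size ≤ z

open Code

/-- The binary counter argument. A carry at a slot with `k` slots after it arrives with the
allowance `u * L * (k + 2)`. If the slot is empty, `u * L` pays for building and the rest becomes
the potential of the new structure. If it is occupied, the released `u * L * (k + 1)` joins the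
allowance: `2 * u * L * (k + 1)` goes on with the carry of doubled capacity, and `u * L` pays for
listing the items. -/
theorem exists_tick (hσ : σ.Ok m s) {L z : ℕ} (hL : 7000 * unit m h ≤ L) {carry : List (Item E)}
    (hw : Inv σ m h {x | x ∈ carry} u ws S) (hc : carry.Nodup) (hcu : carry.length ≤ u)
    (hu1 : 1 ≤ u) (hf : ws.all Option.isSome = false) (hS : Uniq S)
    (hb : ∀ x ∈ S, x.2.bits.length ≤ h) (hh : u * 2 ^ ws.length ≤ 2 ^ h) (hz : SizeLe σ z ws)
    (hz' : 2 * (u * 2 ^ ws.length + 1) * sizeUnit m s h ≤ z) :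
    ∃ ws' T, CallLE (prog kB) tick (.pair (encItems σ carry) (encStrs σ ws)) (encStrs σ ws') T ∧
      ws'.length = ws.length ∧ Inv σ m h ∅ u ws' S ∧
      T + u * L * pot ws' ≤ u * L * (pot ws + ws.length + 1) ∧ cnt ws' = cnt ws + 1 ∧
      SizeLe σ z ws' := by
  classical
  have hn1 := (unit_bounds m h).2.2
  induction ws generalizing carry u with
  | nil => simp at hf
  | cons w ws ih =>
    rw [List.length_cons, pow_succ] at hh hz'
    have hp : 1 ≤ 2 ^ ws.length := Nat.one_le_two_pow
    cases w with
    | none =>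
      replace hw : Inv σ m h {x | x ∈ carry} (2 * u) ws S := hw
      have hsub := hw.subset
      obtain ⟨W, c, h₁, h₂, h₃⟩ := exists_build (kB := kB) hσ carry (fun x hx => hb x (hsub hx))
        (fun a ha b hb => hS a (hsub ha) b (hsub hb)) (by nlinarith)
      refine ⟨some W :: ws, 3000 * unit m h * (carry.length + 1) + 20,
        .of_body (body := bTick) rfl ?_, rfl, ?_, ?_, ?_, ?_⟩
      · simp [bTick, cell, encStrs]
        refine c.exec fun t ht => ?_
        simp
        omega
      · refine ⟨carry.toFinset, (List.toFinset_card_le _).trans hcu, by simp, ?_, ?_, ?_⟩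
        · convert h₁ using 1
          ext x; simp
        · exact h₂.trans (by gcongr)
        · convert hw using 1
          ext x; simp
      · simp only [pot, Option.isSome_none, Option.isSome_some, if_true, List.length_cons]
        -- Here `1 ≤ u` gives `u + 1 ≤ 2 * u`, so the factor 7000 leaves room for the constant.
        have : 3000 * unit m h * (carry.length + 1) + 20 ≤ u * L := by
          calc 3000 * unit m h * (carry.length + 1) + 20
              ≤ 3000 * unit m h * (u + 1) + 20 := by gcongr
            _ ≤ u * (7000 * unit m h) := by nlinarith
            _ ≤ u * L := by gcongr
        simp
        nlinarith
      · simp [cnt]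
        omega
      · intro W' hW'
        rcases List.mem_cons.1 hW' with h | h
        · cases h
          refine h₃.trans (le_trans ?_ hz')
          gcongr
          nlinarith
        · exact hz W' (by simp [h])
    | some W =>
      obtain ⟨T, h₁, h₂, h₃, h₄, hw⟩ := hw
      have hlen : W.dict.toList.length ≤ u := by
        rw [← List.toFinset_card_of_nodup h₃.nodup_dict]
        refine le_trans (le_of_eq ?_) h₁
        congr 1
        ext x
        simp [h₃.mem_dict]
      obtain ⟨ws', t, c, k₁, k₂, k₃, k₄, k₅⟩ := ih (u := 2 * u) (carry := W.dict.toList ++ carry)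
        (by
          convert hw using 1
          ext x
          simp [h₃.mem_dict, or_comm])
        (h₃.nodup_dict.append hc fun x hx hx' =>
          Set.disjoint_left.1 h₂ (h₃.mem_dict.1 hx) hx')
        (by simp; omega) (by omega) (by simpa using hf) (le_trans (le_of_eq (by ring)) hh)
        (fun W hW => hz W (by simp [hW])) (le_trans (le_of_eq (by ring)) hz')
      refine ⟨none :: ws', t + 60 * (2 * W.dict.nodes + 1) + 40, .of_body (body := bTick) rfl ?_,
        by simp [k₁], k₂, ?_, ?_, ?_⟩
      · simp [bTick, cell, encStrs, Str.enc, wD]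
        refine (call_flat W.dict carry).exec fun t₁ ht₁ => c.exec fun t₂ ht₂ => ?_
        simp
        omega
      · simp only [pot, Option.isSome_some, List.length_cons, if_true]
        have : 60 * (2 * W.dict.nodes + 1) + 40 ≤ u * L := by
          calc 60 * (2 * W.dict.nodes + 1) + 40
              ≤ 60 * (2 * (u * unit m h) + 1) + 40 := by gcongr
            _ ≤ u * (7000 * unit m h) := by nlinarith
            _ ≤ u * L := by gcongr
        simp
        nlinarith
      · simp [cnt]
        omega
      · intro W' hW'
        exact k₅ W' (by simpa using hW')

end
end DynJoin

/-! ### The whole state: rebuilding, insertion, deletion. -/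

namespace DynJoin

/-- A state of the data structure: the number of items at the last rebuilding, the next
identifier, the structure of the last rebuilding, and the structures of later items. -/
structure State (E : Type) where
  n0 : ℕ
  ctr : ℕ
  top : Str E
  ws : List (Option (Str E))

section
variable {E : Type} {σ : Elems E} {m s : ℕ} {kB : Expr}

/-- The summand 2 gives `2 * (n0 + 2) < 2 ^ h`, so identifiers handed out before the next rebuilding
fit into `h` bits. -/
def State.h (st : State E) : ℕ := Nat.log 2 (st.n0 + 2) + 2

def State.strs (st : State E) : List (Option (Str E)) := some st.top :: st.ws

def State.enc (σ : Elems E) (par : Val) (st : State E) : Val :=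
  .pair par (.pair (encBits st.ctr.bits) (encStrs σ st.strs))

/-- The state is in order and represents the set `X`, except that the items of `carry` are not yet
in any structure and `j` further updates have to be counted. -/
structure State.Ok (σ : Elems E) (m s : ℕ) (st : State E) (carry : List (Item E)) (j : ℕ)
    (X : Finset E) : Prop where
  len : st.ws.length = Nat.log 2 (st.n0 / 2)
  inv : ∃ S' S, Inv σ m st.h {x | x ∈ carry} 1 st.ws S' ∧ Inv σ m st.h S' st.n0 [some st.top] S ∧
    Uniq S ∧ (∀ x ∈ S, x.2 < st.ctr) ∧ ∀ e, e ∈ X ↔ ∃ x ∈ S, x.1 = e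
  ctr : st.ctr ≤ st.n0 + cnt st.ws + j
  le : X.card ≤ st.n0 + cnt st.ws + j
  ge : st.n0 ≤ X.card + cnt st.ws + j
  size : SizeLe σ ((2 * (st.n0 + 2) + cnt st.ws + j) * sizeUnit m s st.h) st.strs

/-- Measured with `h + 1`, because the rebuilding that it pays for may raise `h` by one. -/
def State.pot (m : ℕ) (st : State E) : ℕ := 40000 * unit m (st.h + 1) * DynJoin.pot st.ws

theorem Inv.congr {h u : ℕ} {lo lo' S : Set (Item E)} {ws : List (Option (Str E))}
    (hw : Inv σ m h lo u ws S) (hl : lo = lo') : Inv σ m h lo' u ws S := hl ▸ hw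

theorem State.two_mul_lt (st : State E) : 2 * (st.n0 + 2) < 2 ^ st.h := by
  have := Nat.lt_pow_succ_log_self (b := 2) (by simp) (st.n0 + 2)
  rw [State.h, pow_succ]
  omega

/-- With `n` the size at the last rebuilding, the power of two is the number of counted updates
until the next one. It lies between `n / 4` and `n / 2 + 1`: late enough to pay for the rebuilding,
early enough for the size not to change by more than a constant factor. -/
theorem two_pow_log_half (n : ℕ) :
    2 ^ Nat.log 2 (n / 2) ≤ n / 2 + 1 ∧ n < 4 * 2 ^ Nat.log 2 (n / 2) := by
  have := Nat.lt_pow_succ_log_self (b := 2) (by simp) (n / 2)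
  rw [pow_succ] at this
  refine ⟨?_, by omega⟩
  rcases Nat.eq_zero_or_pos (n / 2) with h | h
  · simp [h]
  · exact (Nat.pow_log_le_self 2 h.ne').trans (by omega)

theorem bits_length_le {n h : ℕ} (hn : n < 2 ^ h) : n.bits.length ≤ h := by
  rwa [Nat.size_eq_bits_len, Nat.size_le]

open Code

/-- The items are numbered anew from 0, so the lengths of identifiers follow the current size and
not the number of all updates so far. -/
theorem exists_rebuild (hσ : σ.Ok m s) (par : Val) (l : List (Item E))
    (hl : (l.map Prod.fst).Nodup) {X : Finset E} (hX : ∀ e, e ∈ X ↔ e ∈ l.map Prod.fst) :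
    ∃ st : State E, CallLE (prog kB) rebuild (.pair par (encItems σ l)) (st.enc σ par)
        (4000 * unit m st.h * (l.length + 1)) ∧
      st.n0 = l.length ∧ st.Ok σ m s [] 0 X ∧ DynJoin.pot st.ws = 0 := by
  classical
  set h := Nat.log 2 (l.length + 2) + 2 with hh
  have hpow : 2 * (l.length + 2) < 2 ^ h := State.two_mul_lt
    (⟨l.length, 0, ⟨[], .nil, .nil, .nil⟩, []⟩ : State E)
  obtain ⟨u₁, -, u₂⟩ := unit_bounds m h
  obtain ⟨huq, hnd⟩ := uniq_relabel hl 0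
  have hlen := length_relabel l 0
  have hid : ∀ x ∈ relabel l 0, x.2 < l.length := fun x hx => by simpa using (mem_relabel hx).2
  obtain ⟨W, c, h₁, h₂, h₃⟩ := exists_build (kB := kB) (h := h) hσ (relabel l 0)
    (fun x hx => bits_length_le (by have := hid x hx; omega)) huq (by omega)
  rw [hlen] at c h₂ h₃
  have hcard : X.card = l.length := by
    rw [← List.length_map (f := Prod.fst), ← List.toFinset_card_of_nodup hl]
    congr 1
    ext e
    rw [hX, List.mem_toFinset]
  refine ⟨⟨l.length, l.length, W, .replicate (Nat.log 2 (l.length / 2)) none⟩,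
    .of_body (body := bRebuild) rfl ?_, rfl, ⟨by simp, ?_, ?_, ?_, ?_, ?_⟩, pot_replicate _⟩
  · have c₀ := call_label (kB := kB) (σ := σ) (h := h) l 0 (by omega)
    have c₁ := call_halve (kB := kB) ((relabel l 0).map (encItem σ))
    have c₂ := call_slots (kB := kB) (σ := σ) (halves (relabel l 0)).2
    have hhalf := (length_halves (relabel l 0)).2
    rw [halves_map] at c₁
    rw [List.length_map, hlen] at c₁
    rw [hhalf, hlen] at c₂
    simp [encItems] at c₀ c₁ c₂ c
    simp [bRebuild, cell, encItems]
    refine c₀.exec fun t₀ ht₀ => ?_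
    simp
    refine c.exec fun t₁ ht₁ => c₁.exec fun t₂ ht₂ => ?_
    simp
    refine c₂.exec fun t₃ ht₃ => ?_
    refine ⟨rfl, ?_⟩
    rw [show State.h _ = h from rfl]
    have : h + 4 ≤ 2 * unit m h := by nlinarith
    have : 20 * (h + 4) * (l.length + 1) ≤ 40 * unit m h * (l.length + 1) :=
      Nat.mul_le_mul_right _ (by omega)
    have : l.length / 2 ≤ l.length := Nat.div_le_self _ _
    nlinarith
  · refine ⟨∅, {x | x ∈ relabel l 0}, ?_, ⟨(relabel l 0).toFinset, ?_, by simp, ?_, h₂, ?_⟩, huq,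
      hid, ?_⟩
    · simpa using inv_replicate _
    · exact (List.toFinset_card_le _).trans hlen.le
    · rw [show ((relabel l 0).toFinset : Set (Item E)) = {x | x ∈ relabel l 0} by ext x; simp]
      exact h₁
    · ext x; simp
    · intro e
      rw [hX, ← map_fst_relabel l 0]
      simp
  · simp
  · simp [hcard]
  · simp [hcard]
  · intro W' hW'
    have : W' = W := by simpa [State.strs, List.mem_replicate] using hW'
    subst this
    refine h₃.trans ?_
    rw [show State.h _ = h from rfl]
    gcongr
    simp only [cnt_replicate]
    omega

/-- If some slot is empty, the carry is absorbed by `tick`. Otherwise this is update number `2 ^ K`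
since the last rebuilding, where `K` is the number of slots, and the potential, now at its maximum,
pays for starting afresh. -/
theorem State.Ok.exists_finish (hσ : σ.Ok m s) (par : Val) {st : State E} {carry : List (Item E)}
    {X : Finset E} (hst : st.Ok σ m s carry 1 X) (hc : carry.Nodup) (hc1 : carry.length ≤ 1) :
    ∃ (st' : State E) (T : ℕ), CallLE (prog kB) finish (.pair (encItems σ carry) (st.enc σ par))
        (st'.enc σ par) T ∧ st'.Ok σ m s [] 0 X ∧
      T + st'.pot m ≤ st.pot m + 80000 * unit m (st.h + 1) * (st.ws.length + 3) := by
  classical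
  obtain ⟨S', S, hw, ht, hS, hid, hX⟩ := hst.inv
  have hpow := st.two_mul_lt
  obtain ⟨hK₁, hK₂⟩ := two_pow_log_half st.n0
  have hcl := cnt_lt st.ws
  have hctr := hst.ctr
  have hle := hst.le
  have hge := hst.ge
  have hKK : st.ws.length < 2 ^ st.ws.length := Nat.lt_two_pow_self
  rw [← hst.len] at hK₁ hK₂
  have hUU : unit m st.h ≤ unit m (st.h + 1) := unit_mono m (by omega)
  have hU1 := (unit_bounds m st.h).2.2
  have hU2 := (unit_bounds m (st.h + 1)).2.2
  have cf := call_full (kB := kB) (σ := σ) st.ws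
  cases hf : st.ws.all Option.isSome with
  | false =>
    obtain ⟨ws', T, c, k₁, k₂, k₃, k₄, k₅⟩ := exists_tick (kB := kB) hσ
      (L := 40000 * unit m (st.h + 1))
      (z := (2 * (st.n0 + 2) + cnt st.ws + 1) * sizeUnit m s st.h) (by omega) hw hc hc1 le_rfl hf
      (fun a ha b hb => hS a (ht.subset ha) b (ht.subset hb))
      (fun x hx => bits_length_le (by have := hid x (ht.subset hx); omega)) (by omega)
      (fun W hW => hst.size W (by simp [State.strs, hW])) (by gcongr; omega)
    refine ⟨⟨st.n0, st.ctr, st.top, ws'⟩, T + 20 * (st.ws.length + 1) + 100,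
      .of_body (body := bFinish) rfl ?_,
      ⟨k₁.trans hst.len, ⟨S', S, k₂.congr (by simp), ht, hS, hid, hX⟩, ?_, ?_, ?_, ?_⟩, ?_⟩
    · rw [hf] at cf
      simp [bFinish, cell, State.enc, State.strs, encStrs, Str.enc] at cf ⊢
      refine cf.exec fun t₁ ht₁ => ?_
      simp
      refine c.exec fun t₂ ht₂ => ?_
      simp
      omega
    · simp only [k₄]; omega
    · simp only [k₄]; omega
    · simp only [k₄]; omega
    · intro W hW
      simp only [k₄, add_zero]
      rcases List.mem_cons.1 hW with h | h
      · exact hst.size W (by simp [State.strs, h])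
      · exact k₅ W h
    · rw [one_mul] at k₃
      simp only [State.pot, show State.h ⟨st.n0, st.ctr, st.top, ws'⟩ = st.h from rfl]
      linarith [Nat.mul_le_mul (Nat.le_mul_of_pos_right 40000 hU2) (le_refl (st.ws.length + 5)),
        Nat.mul_le_mul hUU (le_refl (st.ws.length + 5))]
  | true =>
    have hU2 := (unit_bounds m (st.h + 1)).2.2
    obtain ⟨T, t₁, t₂, t₃, t₄, t₅⟩ := ht
    have t₅ : S = S' ∪ T := t₅
    obtain ⟨f₁, f₂⟩ := hw.flatIn hc
    set l := flatIn st.strs carry with hl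
    have hperm : l.Perm (st.top.dict.toList ++ flatIn st.ws carry) := flatIn_perm _ _ _
    have hmem : ∀ x, x ∈ l ↔ x ∈ S := by
      intro x
      rw [hperm.mem_iff, List.mem_append, f₂, t₃.mem_dict, t₅, Set.mem_union, or_comm]
    have hnd : l.Nodup := by
      rw [hperm.nodup_iff]
      refine t₃.nodup_dict.append f₁ fun x hx hx' => ?_
      exact Set.disjoint_left.1 t₂ (t₃.mem_dict.1 hx) ((f₂ x).1 hx')
    have hlnd : (l.map Prod.fst).Nodup := by
      refine hnd.map_on fun x hx y hy => ?_
      exact (hS x ((hmem x).1 hx) y ((hmem y).1 hy)).1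
    have hXl : ∀ e, e ∈ X ↔ e ∈ l.map Prod.fst := by
      intro e
      rw [hX, List.mem_map]
      exact exists_congr fun x => by rw [hmem]
    obtain ⟨st', c, r₁, r₂, r₃⟩ := exists_rebuild (kB := kB) hσ par l hlnd hXl
    have hcard : X.card = l.length := by
      rw [← List.length_map (f := Prod.fst), ← List.toFinset_card_of_nodup hlnd]
      congr 1
      ext e
      rw [hXl, List.mem_toFinset]
    -- The size has at most doubled, up to an additive constant that the shift by 2 under the
    -- logarithm absorbs.
    have hh : st'.h ≤ st.h + 1 := by
      rw [State.h, State.h, r₁, ← hcard]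
      have : Nat.log 2 (X.card + 2) ≤ Nat.log 2 ((st.n0 + 2) * 2) := Nat.log_mono_right (by omega)
      rw [Nat.log_mul_base (by simp) (by omega)] at this
      omega
    have hUU' : unit m st'.h ≤ unit m (st.h + 1) := unit_mono m hh
    have cfl := call_flatAll (kB := kB) (σ := σ) st.strs carry
    have hsum := hw.sumNodes_le
    have hpot := pot_of_full hf
    rw [one_mul, one_mul] at hsum
    refine ⟨st', 20 * (st.ws.length + 1) + 120 * (sumNodes st.strs + st.strs.length + 1) +
      4000 * unit m st'.h * (l.length + 1) + 100, .of_body (body := bFinish) rfl ?_, r₂, ?_⟩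
    · rw [hf] at cf
      rw [← hl] at cfl
      simp [bFinish, cell, State.enc, State.strs, encStrs, Str.enc] at cf c cfl ⊢
      refine cf.exec fun t₁ ht₁ => ?_
      simp
      refine cfl.exec fun t₂ ht₂ => c.exec fun t₃ ht₃ => ?_
      simp
      omega
    · simp only [State.pot, r₃, State.strs, sumNodes, List.length_cons]
      rw [pow_succ] at hpot
      set K := st.ws.length
      set U := unit m (st.h + 1)
      have e₁ : sumNodes st.ws + st.top.dict.nodes ≤ 5 * 2 ^ K * U := by
        calc _ ≤ 2 ^ K * unit m st.h + st.n0 * unit m st.h := by omega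
          _ ≤ 2 ^ K * U + (4 * 2 ^ K) * U := by gcongr
          _ = _ := by ring
      have e₂ : 4000 * unit m st'.h * (l.length + 1) ≤ 4000 * U * (5 * 2 ^ K + 1) := by
        gcongr
        omega
      -- Half of the allowance of this update rounds the potential of the full slots up to `2 * 2 ^
      -- K + 1`, which pays for listing and rebuilding; the other half covers the remaining steps.
      have e₃ : 40000 * U * DynJoin.pot st.ws + 40000 * U * (K + 3) =
          40000 * U * (2 * 2 ^ K + 1) := by
        rw [← mul_add]
        congr 1
        omega
      nlinarith

theorem State.mem_iff_of_inv {st : State E} {S' S : Set (Item E)}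
    (hw : Inv σ m st.h {x | x ∈ ([] : List (Item E))} 1 st.ws S')
    (ht : Inv σ m st.h S' st.n0 [some st.top] S) (y : Item E) :
    y ∈ S ↔ ∃ W, some W ∈ st.strs ∧ y ∈ W.dict.toList := by
  rw [ht.mem_iff, hw.mem_iff]
  simp [State.strs, or_and_right, exists_or, or_comm]

theorem State.find_spec (hσ : σ.Ok m s) {st : State E} {X : Finset E} {S' S : Set (Item E)}
    (hw : Inv σ m st.h {x | x ∈ ([] : List (Item E))} 1 st.ws S')
    (ht : Inv σ m st.h S' st.n0 [some st.top] S) (hX : ∀ e, e ∈ X ↔ ∃ x ∈ S, x.1 = e) (e : E) :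
    AllOk σ m st.h st.strs ∧ (findIn σ e st.strs = none → e ∉ X) ∧
      ∀ y, findIn σ e st.strs = some y → y ∈ S ∧ y.1 = e := by
  have hok : AllOk σ m st.h st.strs := by
    intro W hW
    rcases List.mem_cons.1 hW with h | h
    · exact ht.allOk W (by simp [h])
    · exact hw.allOk W h
  have hmem := State.mem_iff_of_inv hw ht
  refine ⟨hok, ?_, ?_⟩
  · intro hn he
    obtain ⟨x, hx, hxe⟩ := (hX e).1 he
    obtain ⟨W, hW, hxW⟩ := (hmem x).1 hx
    have := hok.findIn_isSome hσ hW hxW hxe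
    simp [hn] at this
  · intro y hy
    obtain ⟨h₁, W, h₂, h₃⟩ := hok.findIn_some hσ hy
    exact ⟨(hmem y).2 ⟨W, h₂, h₃⟩, h₁⟩

theorem SizeLe.map {z z' : ℕ} {g : Str E → Str E} {ws : List (Option (Str E))}
    (hw : SizeLe σ z ws)
    (hg : ∀ W, some W ∈ ws → ((g W).enc σ).size ≤ (W.enc σ).size + z') :
    SizeLe σ (z + z') (ws.map (Option.map g)) := by
  intro W hW
  obtain ⟨w, hw', hWw⟩ := List.mem_map.1 hW
  cases w with
  | none => simp at hWw
  | some W' =>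
    cases hWw
    exact (hg W' hw').trans (Nat.add_le_add_right (hw W' hw') _)

/-- An element that is already present leaves the state as it is. A new one first becomes an outside
item of every structure, under a fresh identifier, and is then the carry of `finish`. -/
theorem State.Ok.exists_ins [DecidableEq E] (hσ : σ.Ok m s) (par : Val) {st : State E}
    {X : Finset E} (hst : st.Ok σ m s [] 0 X) (e : E) :
    ∃ (st' : State E) (T : ℕ), CallLE (prog kB) ins (.pair (st.enc σ par) (σ.enc e))
        (st'.enc σ par) T ∧ st'.Ok σ m s [] 0 (insert e X) ∧
      T + st'.pot m ≤ st.pot m + 100000 * unit m (st.h + 1) * (st.ws.length + 3) := by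
  obtain ⟨S', S, hw, ht, hS, hid, hX⟩ := hst.inv
  obtain ⟨hok, hn, hs⟩ := State.find_spec hσ hw ht hX e
  have hUU : unit m st.h ≤ unit m (st.h + 1) := unit_mono m (by omega)
  obtain ⟨hU2, -, hU1⟩ := unit_bounds m st.h
  have cf := call_find (kB := kB) hσ e hok
  rcases hf : findIn σ e st.strs with _ | y
  · have heX := hn hf
    have hpow := st.two_mul_lt
    have hcl := cnt_lt st.ws
    obtain ⟨hK₁, hK₂⟩ := two_pow_log_half st.n0
    rw [← hst.len] at hK₁ hK₂
    have hctr := hst.ctr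
    set x : Item E := (e, st.ctr) with hx
    have hxS : x ∉ S := fun h => by have := hid x h; simp [hx] at this
    have hxb : x.2.bits.length ≤ st.h := bits_length_le (by simp only [hx]; omega)
    have hu : Uniq (insert x S) := by
      have key : ∀ y ∈ S, y.1 ≠ e ∧ y.2 ≠ st.ctr := fun y hy =>
        ⟨fun h => heX ((hX e).2 ⟨y, hy, h⟩), (hid y hy).ne⟩
      rintro a (rfl | ha) b (rfl | hb)
      · simp
      · exact ⟨fun h => absurd h.symm (key b hb).1, fun h => absurd h.symm (key b hb).2⟩
      · exact ⟨fun h => absurd h (key a ha).1, fun h => absurd h (key a ha).2⟩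
      · exact hS a ha b hb
    have hsub := ht.subset
    have hxS' : x ∉ S' := fun h => hxS (hsub h)
    have hw' := hw.low hσ hxb (fun a ha b hb =>
      hu a (Set.insert_subset_insert hsub ha) b (Set.insert_subset_insert hsub hb)) hxS'
    have ht' := ht.low hσ hxb hu hxS
    let st₁ : State E :=
      ⟨st.n0, st.ctr + 1, st.top.low σ x, st.ws.map (Option.map (Str.low σ x))⟩
    have hstrs : st₁.strs = st.strs.map (Option.map (Str.low σ x)) := rfl
    have hok₁ : st₁.Ok σ m s [x] 1 (insert e X) := by
      refine ⟨by simpa [st₁] using hst.len, ⟨insert x S', insert x S, hw'.congr (by simp), ht', hu,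
        ?_, ?_⟩, ?_, ?_, ?_, ?_⟩
      · rintro y (rfl | hy)
        · simp [hx, st₁]
        · have := hid y hy
          simp only [st₁]
          omega
      · intro e'
        rw [Finset.mem_insert, hX]
        simp [hx, eq_comm]
      · simp only [st₁, cnt_map]; omega
      · have := hst.le
        rw [Finset.card_insert_of_notMem heX]
        simp only [st₁, cnt_map]; omega
      · have := hst.ge
        rw [Finset.card_insert_of_notMem heX]
        simp only [st₁, cnt_map]; omega
      · rw [hstrs]
        have := hst.size.map (g := Str.low σ x) (z' := sizeUnit m s st.h) fun W hW => by
          obtain ⟨T, lo, hT⟩ := hok W hW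
          exact hT.size_low hσ hxb
        convert this using 1
        simp only [st₁, cnt_map, show State.h ⟨st.n0, st.ctr + 1, st.top.low σ x,
          st.ws.map (Option.map (Str.low σ x))⟩ = st.h from rfl]
        ring
    obtain ⟨st', T, c, k₁, k₂⟩ := hok₁.exists_finish (kB := kB) hσ par (by simp) (by simp)
    have cm := call_map (σ := σ) (kB := kB) (fm := mapLow) (f := Code.low) rfl (Str.low σ x)
      (x := x) (c := 600 * unit m st.h) (ws := st.strs) fun W hW => by
        obtain ⟨T, lo, hT⟩ := hok W hW
        exact call_low hT hσ x hxb
    have ci := call_inc (kB := kB) st.ctr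
    rw [← hstrs] at cm
    refine ⟨st', T + 700 * unit m st.h * (st.ws.length + 2) +
      (600 * unit m st.h + 30) * (st.ws.length + 2) + 20 * (st.h + 1) + 100,
      .of_body (body := bIns) rfl ?_, k₁, ?_⟩
    · rw [hf] at cf
      simp [bIns, cell, State.enc] at cf cm c ⊢
      refine cf.exec fun t₁ ht₁ => ?_
      simp
      refine ci.exec fun t₂ ht₂ => cm.exec fun t₃ ht₃ => c.exec fun t₄ ht₄ => ?_
      simp [State.strs] at ht₁ ht₃ hxb ⊢
      have : st.ctr.bits.length ≤ st.h := hxb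
      nlinarith
    · simp only [State.pot, st₁, pot_map, List.length_map, show State.h ⟨st.n0, st.ctr + 1,
        st.top.low σ x, st.ws.map (Option.map (Str.low σ x))⟩ = st.h from rfl] at k₂ ⊢
      nlinarith
  · obtain ⟨hy, hye⟩ := hs y hf
    have heX : e ∈ X := (hX e).2 ⟨y, hy, hye⟩
    rw [Finset.insert_eq_of_mem heX]
    refine ⟨st, 700 * unit m st.h * (st.ws.length + 2) + 100, .of_body (body := bIns) rfl ?_, hst,
      ?_⟩
    · rw [hf] at cf
      simp [bIns, cell, State.enc] at cf ⊢
      refine cf.exec fun t₁ ht₁ => ?_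
      simp [State.strs] at ht₁
      simp [encItem]
      nlinarith
    · nlinarith

/-- An actual deletion also runs `finish`, with an empty carry. So deletions advance the counter
and, like insertions, bring the next rebuilding nearer. -/
theorem State.Ok.exists_rem [DecidableEq E] (hσ : σ.Ok m s) (par : Val) {st : State E}
    {X : Finset E} (hst : st.Ok σ m s [] 0 X) (e : E) :
    ∃ (st' : State E) (T : ℕ), CallLE (prog kB) rem (.pair (st.enc σ par) (σ.enc e))
        (st'.enc σ par) T ∧ st'.Ok σ m s [] 0 (X.erase e) ∧
      T + st'.pot m ≤ st.pot m + 100000 * unit m (st.h + 1) * (st.ws.length + 3) := by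
  obtain ⟨S', S, hw, ht, hS, hid, hX⟩ := hst.inv
  obtain ⟨hok, hn, hs⟩ := State.find_spec hσ hw ht hX e
  have hUU : unit m st.h ≤ unit m (st.h + 1) := unit_mono m (by omega)
  obtain ⟨hU2, -, hU1⟩ := unit_bounds m st.h
  have cf := call_find (kB := kB) hσ e hok
  rcases hf : findIn σ e st.strs with _ | x
  · have heX := hn hf
    rw [Finset.erase_eq_of_notMem heX]
    refine ⟨st, 700 * unit m st.h * (st.ws.length + 2) + 100, .of_body (body := bRem) rfl ?_, hst,
      ?_⟩
    · rw [hf] at cf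
      simp [bRem, cell, State.enc] at cf ⊢
      refine cf.exec fun t₁ ht₁ => ?_
      simp [State.strs] at ht₁
      simp
      nlinarith
    · nlinarith
  · obtain ⟨hxS, rfl⟩ := hs x hf
    have heX : x.1 ∈ X := (hX _).2 ⟨x, hxS, rfl⟩
    have hpow := st.two_mul_lt
    have hcl := cnt_lt st.ws
    obtain ⟨hK₁, hK₂⟩ := two_pow_log_half st.n0
    rw [← hst.len] at hK₁ hK₂
    have hctr := hst.ctr
    have hxb : x.2.bits.length ≤ st.h := bits_length_le (by have := hid x hxS; omega)
    have hu : Uniq (insert x S) := by rwa [Set.insert_eq_of_mem hxS]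
    have hsub := ht.subset
    have hw' := hw.del hσ hxb (fun a ha b hb =>
      hu a (Set.insert_subset_insert hsub ha) b (Set.insert_subset_insert hsub hb))
    have ht' := ht.del hσ hxb hu
    let st₁ : State E :=
      ⟨st.n0, st.ctr, st.top.del σ x, st.ws.map (Option.map (Str.del σ x))⟩
    have hstrs : st₁.strs = st.strs.map (Option.map (Str.del σ x)) := rfl
    have hcard := Finset.card_erase_add_one heX
    have hok₁ : st₁.Ok σ m s [] 1 (X.erase x.1) := by
      refine ⟨by simpa [st₁] using hst.len, ⟨S' \ {x}, S \ {x}, hw'.congr (by simp), ht',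
        fun a ha b hb => hS a ha.1 b hb.1, fun y hy => hid y hy.1, ?_⟩, ?_, ?_, ?_, ?_⟩
      · intro e'
        rw [Finset.mem_erase, hX]
        constructor
        · rintro ⟨h₁, y, hy, rfl⟩
          refine ⟨y, ⟨hy, ?_⟩, rfl⟩
          rintro rfl
          exact h₁ rfl
        · rintro ⟨y, ⟨hy, hyx⟩, rfl⟩
          exact ⟨fun h => hyx ((hS y hy x hxS).1 h), y, hy, rfl⟩
      · simp only [st₁, cnt_map]; omega
      · have := hst.le
        simp only [st₁, cnt_map]; omega
      · have := hst.ge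
        simp only [st₁, cnt_map]; omega
      · rw [hstrs]
        have := hst.size.map (g := Str.del σ x) (z' := sizeUnit m s st.h) fun W hW => by
          obtain ⟨T, lo, hT⟩ := hok W hW
          exact hT.size_del hσ hxb
        convert this using 1
        simp only [st₁, cnt_map, show State.h ⟨st.n0, st.ctr, st.top.del σ x,
          st.ws.map (Option.map (Str.del σ x))⟩ = st.h from rfl]
        ring
    obtain ⟨st', T, c, k₁, k₂⟩ := hok₁.exists_finish (kB := kB) hσ par (by simp) (by simp)
    have cm := call_map (σ := σ) (kB := kB) (fm := mapDel) (f := Code.del) rfl (Str.del σ x)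
      (x := x) (c := 2000 * unit m st.h) (ws := st.strs) fun W hW => by
        obtain ⟨T, lo, hT⟩ := hok W hW
        exact call_del hT hσ x hxb
    rw [← hstrs] at cm
    refine ⟨st', T + 700 * unit m st.h * (st.ws.length + 2) +
      (2000 * unit m st.h + 30) * (st.ws.length + 2) + 100,
      .of_body (body := bRem) rfl ?_, k₁, ?_⟩
    · rw [hf] at cf
      simp [bRem, cell, State.enc, encItem_eq] at cf cm c ⊢
      refine cf.exec fun t₁ ht₁ => ?_
      simp
      refine cm.exec fun t₃ ht₃ => c.exec fun t₄ ht₄ => ?_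
      simp [State.strs] at ht₁ ht₃ ⊢
      nlinarith
    · simp only [State.pot, st₁, pot_map, List.length_map, show State.h ⟨st.n0, st.ctr,
        st.top.del σ x, st.ws.map (Option.map (Str.del σ x))⟩ = st.h from rfl] at k₂ ⊢
      nlinarith

end
end DynJoin

namespace DynJoin

/-! ## Enumeration -/

/-- A part of the work that is left: the pairs of a nested trie, all pairs of items from two tries,
all pairs of an item and an item from a trie. -/
inductive Frame (α : Type) where
  | tree (v : Nest α) : Frame α
  | prod (tA tB : Trie α) : Frame α
  | row (x : α) (t : Trie α) : Frame α

namespace Frame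

def outs {α : Type} : Frame α → List (α × α)
  | tree v => v.outs
  | prod tA tB => tA.toList.flatMap fun x => tB.toList.map fun y => (x, y)
  | row x t => t.toList.map fun y => (x, y)

/-- There is no work without output. -/
def Good {α : Type} : Frame α → Prop
  | tree v => v.ne = true ∧ ∃ m, v.WF m
  | prod tA tB => tA.Pruned ∧ tB.Pruned ∧ tA ≠ .nil ∧ tB ≠ .nil
  | row _ t => t.Pruned ∧ t ≠ .nil

def ht {α : Type} : Frame α → ℕ
  | tree v => v.ht
  | prod tA tB => tA.ht + tB.ht + 1
  | row _ t => t.ht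

def enc {E : Type} (σ : Elems E) : Frame (Item E) → Val
  | tree v => .pair .nil (v.enc σ)
  | prod tA tB => .pair (.pair .nil .nil) (.pair (tA.enc σ) (tB.enc σ))
  | row x t => .pair (.pair (.pair .nil .nil) .nil) (.pair (encItem σ x) (t.enc σ))

end Frame

section
variable {E : Type} {σ : Elems E} {m s h B : ℕ} {kB : Expr}

def encStack (σ : Elems E) (fs : List (Frame (Item E))) : Val := .ofList (fs.map (Frame.enc σ))

@[simp] theorem encStack_nil : encStack σ [] = .nil := rfl
@[simp] theorem encStack_cons (f : Frame (Item E)) (fs : List (Frame (Item E))) :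
    encStack σ (f :: fs) = .pair (f.enc σ) (encStack σ fs) := rfl

/-- All work in the stack is good and not too high. -/
def GoodStack (B : ℕ) (fs : List (Frame (Item E))) : Prop := ∀ f ∈ fs, f.Good ∧ f.ht ≤ B

theorem goodStack_cons {f : Frame (Item E)} {fs : List (Frame (Item E))} :
    GoodStack B (f :: fs) ↔ (f.Good ∧ f.ht ≤ B) ∧ GoodStack B fs := by
  simp [GoodStack]

def pushTree (v : Nest (Item E)) (fs : List (Frame (Item E))) : List (Frame (Item E)) :=
  if v.ne then .tree v :: fs else fs

theorem outs_pushTree {v : Nest (Item E)} (hv : v.WF m) (fs : List (Frame (Item E))) :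
    (pushTree v fs).flatMap Frame.outs = v.outs ++ fs.flatMap Frame.outs := by
  have := Nest.ne_iff hv
  rw [pushTree]
  split_ifs with h
  · simp [Frame.outs]
  · rw [this, not_not] at h
    simp [h]

theorem GoodStack.pushTree {v : Nest (Item E)} {fs : List (Frame (Item E))} (hf : GoodStack B fs)
    (hv : v.WF m) (hB : v.ht ≤ B) : GoodStack B (pushTree v fs) := by
  rw [DynJoin.pushTree]
  split_ifs with h
  · exact goodStack_cons.2 ⟨⟨⟨h, m, hv⟩, hB⟩, hf⟩
  · exact hf

def pushProd (tA tB : Trie (Item E)) (fs : List (Frame (Item E))) : List (Frame (Item E)) :=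
  match tA with
  | .nil => fs
  | .node o l r => .prod (.node o l r) tB :: fs

def pushRow (o : Option (Item E)) (t : Trie (Item E)) (fs : List (Frame (Item E))) :
    List (Frame (Item E)) :=
  match o with
  | none => fs
  | some x => .row x t :: fs

def pushRow' (x : Item E) (t : Trie (Item E)) (fs : List (Frame (Item E))) :
    List (Frame (Item E)) :=
  match t with
  | .nil => fs
  | .node o l r => .row x (.node o l r) :: fs

open Code

/-- The function `next` works on the stack. -/
def NextOk (σ : Elems E) (P : List Expr) (B : ℕ) (fs : List (Frame (Item E))) (T : ℕ) : Prop :=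
  ∃ x y fs', CallLE P next (encStack σ fs)
      (.pair (.pair (σ.pay x.1) (σ.pay y.1)) (encStack σ fs')) T ∧
    fs.flatMap Frame.outs = (x, y) :: fs'.flatMap Frame.outs ∧ GoodStack B fs'

theorem NextOk.of_le {P : List Expr} {fs fs' : List (Frame (Item E))} {T T' : ℕ}
    (hn : NextOk σ P B fs T)
    (hc : ∀ v, CallLE P next (encStack σ fs) v T → CallLE P next (encStack σ fs') v T')
    (ho : fs'.flatMap Frame.outs = fs.flatMap Frame.outs) : NextOk σ P B fs' T' := by
  obtain ⟨x, y, fs'', h₁, h₂, h₃⟩ := hn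
  exact ⟨x, y, fs'', hc _ h₁, ho.trans h₂, h₃⟩

/-- A nonempty pruned trie has an entry at its root or a nonempty child, so the search for an output
only descends. The time depends on the height of the top frame and not on the rest of the stack. -/
theorem nextOk_row (x : Item E) (t : Trie (Item E)) (fs : List (Frame (Item E)))
    (hf : GoodStack B (.row x t :: fs)) : NextOk σ (prog kB) B (.row x t :: fs) (100 * t.ht) := by
  induction t generalizing fs with
  | nil => simp [goodStack_cons, Frame.Good] at hf
  | node o l r ihl ihr =>
    obtain ⟨⟨⟨⟨hl, hr, hn⟩, -⟩, hB⟩, hfs⟩ := goodStack_cons.1 hf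
    simp only [Frame.ht, Trie.ht] at hB
    have hlB : GoodStack B (pushRow' x l (pushRow' x r fs)) := by
      have : GoodStack B (pushRow' x r fs) := by
        cases r with
        | nil => exact hfs
        | node => exact goodStack_cons.2 ⟨⟨⟨hr, by simp⟩, by simp only [Frame.ht]; omega⟩, hfs⟩
      cases l with
      | nil => exact this
      | node => exact goodStack_cons.2 ⟨⟨⟨hl, by simp⟩, by simp only [Frame.ht]; omega⟩, this⟩
    have ho : (pushRow' x l (pushRow' x r fs)).flatMap Frame.outs =
        (l.toList ++ r.toList).map (fun y => (x, y)) ++ fs.flatMap Frame.outs := by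
      cases l <;> cases r <;> simp [pushRow', Frame.outs, Trie.toList]
    cases o with
    | some y =>
      refine ⟨x, y, pushRow' x l (pushRow' x r fs), .of_body (body := bNext) rfl ?_, ?_, hlB⟩
      · simp only [Trie.ht]
        simp [bNext, cell, Frame.enc]
        simp [bNextRow, cell, encItem, pay, tt, Elems.enc]
        cases l <;> cases r <;> simp [pushRow', Frame.enc, encItem, Elems.enc] <;> omega
      · rw [ho]
        simp [Frame.outs, Trie.toList]
    | none =>
      have hT : NextOk σ (prog kB) B (pushRow' x l (pushRow' x r fs)) (100 * max l.ht r.ht) := by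
        cases l with
        | nil =>
          cases r with
          | nil => simp at hn
          | node => simpa [pushRow', Trie.ht] using ihr fs hlB
        | node =>
          obtain ⟨a, b, fs', h₁, h₂⟩ := ihl _ hlB
          exact ⟨a, b, fs', h₁.mono (by gcongr; exact le_max_left _ _), h₂⟩
      refine hT.of_le (fun v hv => .of_body (body := bNext) rfl ?_) ?_
      · simp only [Trie.ht]
        simp [bNext, cell, Frame.enc]
        simp [bNextRow, cell, tt]
        cases l <;> cases r <;>
          (simp [pushRow', Frame.enc] at hv ⊢
           refine hv.exec fun t ht => ?_
           simp
           omega)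
      · rw [ho]
        simp [Frame.outs, Trie.toList]

/-- A descent in `tA` to some point, then a descent in `tB` with that point fixed; the heights add
up. -/
theorem nextOk_prod (tA tB : Trie (Item E)) (fs : List (Frame (Item E)))
    (hf : GoodStack B (.prod tA tB :: fs)) :
    NextOk σ (prog kB) B (.prod tA tB :: fs) (100 * (tA.ht + tB.ht)) := by
  induction tA generalizing fs with
  | nil => simp [goodStack_cons, Frame.Good] at hf
  | node o l r ihl ihr =>
    obtain ⟨⟨⟨⟨hl, hr, hn⟩, hp, -, hB0⟩, hB⟩, hfs⟩ := goodStack_cons.1 hf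
    simp only [Frame.ht, Trie.ht] at hB
    have hlB : GoodStack B (pushProd l tB (pushProd r tB fs)) := by
      have : GoodStack B (pushProd r tB fs) := by
        cases r with
        | nil => exact hfs
        | node => exact goodStack_cons.2 ⟨⟨⟨hr, hp, by simp, hB0⟩, by simp only [Frame.ht]; omega⟩, hfs⟩
      cases l with
      | nil => exact this
      | node => exact goodStack_cons.2 ⟨⟨⟨hl, hp, by simp, hB0⟩, by simp only [Frame.ht]; omega⟩, this⟩
    have ho : (pushRow o tB (pushProd l tB (pushProd r tB fs))).flatMap Frame.outs =
        (Frame.prod (Trie.node o l r) tB :: fs).flatMap Frame.outs := by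
      cases o <;> cases l <;> cases r <;> simp [pushProd, pushRow, Frame.outs, Trie.toList]
    have hT : NextOk σ (prog kB) B (pushRow o tB (pushProd l tB (pushProd r tB fs)))
        (100 * (max l.ht r.ht + tB.ht)) := by
      cases o with
      | some x =>
        obtain ⟨a, b, fs', h₁, h₂⟩ := nextOk_row (σ := σ) (kB := kB) x tB
          (pushProd l tB (pushProd r tB fs))
          (goodStack_cons.2 ⟨⟨⟨hp, hB0⟩, by simp only [Frame.ht]; omega⟩, hlB⟩)
        exact ⟨a, b, fs', h₁.mono (by gcongr; exact Nat.le_add_left _ _), h₂⟩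
      | none =>
        cases l with
        | nil =>
          cases r with
          | nil => simp at hn
          | node => simpa [pushProd, pushRow, Trie.ht] using ihr fs hlB
        | node =>
          obtain ⟨a, b, fs', h₁, h₂⟩ := ihl _ hlB
          exact ⟨a, b, fs', h₁.mono (by gcongr; exact le_max_left _ _), h₂⟩
    refine hT.of_le (fun v hv => .of_body (body := bNext) rfl ?_) ho.symm
    simp only [Trie.ht]
    simp [bNext, cell, Frame.enc]
    simp [bNextProd, cell, tt]
    cases o <;> cases l <;> cases r <;>
      (simp [pushProd, pushRow, Frame.enc, encItem] at hv ⊢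
       refine hv.exec fun t ht => ?_
       simp
       omega)

/-- A flagged node has a flagged part, and only flagged parts are pushed, so each step lowers the
height of the top frame and none is wasted. -/
theorem nextOk_tree (v : Nest (Item E)) (fs : List (Frame (Item E)))
    (hf : GoodStack B (.tree v :: fs)) :
    NextOk σ (prog kB) B (.tree v :: fs) (100 * v.ht) := by
  induction v generalizing fs with
  | nil => simp [goodStack_cons, Frame.Good, Nest.ne] at hf
  | base tA tB =>
    obtain ⟨⟨⟨hne, m, hw⟩, hB⟩, hfs⟩ := goodStack_cons.1 hf
    simp only [Frame.ht, Nest.ht] at hB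
    have hT := nextOk_prod (σ := σ) (kB := kB) (B := B) tA tB fs (goodStack_cons.2
      ⟨⟨⟨hw.2.1, hw.2.2, by rintro rfl; simp [Nest.ne] at hne,
        by rintro rfl; cases tA <;> simp [Nest.ne] at hne⟩, by simp only [Frame.ht]; omega⟩, hfs⟩)
    refine hT.of_le (fun v hv => .of_body (body := bNext) rfl ?_) rfl
    simp [bNext, cell, Frame.enc]
    simp [bNextTree, cell, Frame.enc, tt, Nest.enc, Nest.flag, hne] at hv ⊢
    refine hv.exec fun t ht => ?_
    simp [Nest.ht]
    omega
  | node s l r ihs ihl ihr =>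
    obtain ⟨⟨⟨hne, m, hw⟩, hB⟩, hfs⟩ := goodStack_cons.1 hf
    obtain ⟨hm, hs, hl, hr⟩ := hw
    simp only [Frame.ht, Nest.ht] at hB
    have hg := ((hfs.pushTree hr (by omega)).pushTree hl (by omega)).pushTree hs (by omega)
    have ho : (pushTree s (pushTree l (pushTree r fs))).flatMap Frame.outs =
        (Frame.tree (Nest.node s l r) :: fs).flatMap Frame.outs := by
      rw [outs_pushTree hs, outs_pushTree hl, outs_pushTree hr]
      simp [Frame.outs, Nest.outs]
    have hT : NextOk σ (prog kB) B (pushTree s (pushTree l (pushTree r fs)))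
        (100 * max s.ht (max l.ht r.ht)) := by
      have key : ∀ (v : Nest (Item E)) fs, v.ht ≤ max s.ht (max l.ht r.ht) →
          NextOk σ (prog kB) B (.tree v :: fs) (100 * v.ht) →
          NextOk σ (prog kB) B (.tree v :: fs) (100 * max s.ht (max l.ht r.ht)) := by
        rintro v fs h ⟨a, b, fs', h₁, h₂⟩
        exact ⟨a, b, fs', h₁.mono (by gcongr), h₂⟩
      unfold pushTree at hg ⊢
      split_ifs at hg ⊢ with h₁ h₂ h₃ <;> simp_all [Nest.ne]
    refine hT.of_le (fun v hv => .of_body (body := bNext) rfl ?_) ho.symm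
    simp [Nest.ne] at hne
    simp only [Nest.ht]
    unfold pushTree at hv
    simp [bNext, cell, Frame.enc]
    simp [bNextTree, cell, Nest.enc, Nest.flag_node, hne]
    rcases s.flag_cases with ⟨h₁, h₁'⟩ | ⟨h₁, _, _, h₁'⟩ <;>
    rcases l.flag_cases with ⟨h₂, h₂'⟩ | ⟨h₂, _, _, h₂'⟩ <;>
    rcases r.flag_cases with ⟨h₃, h₃'⟩ | ⟨h₃, _, _, h₃'⟩ <;>
    (simp [h₁, h₁', h₂, h₂', h₃, h₃', Frame.enc] at hv hne ⊢
     try (refine hv.exec fun t ht => ?_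
          simp
          omega))

theorem nextOk (f : Frame (Item E)) (fs : List (Frame (Item E))) (hf : GoodStack B (f :: fs)) :
    NextOk σ (prog kB) B (f :: fs) (100 * B) := by
  have hB := (goodStack_cons.1 hf).1.2
  obtain ⟨a, b, fs', h₁, h₂⟩ : NextOk σ (prog kB) B (f :: fs) (100 * f.ht) := by
    cases f with
    | tree v => exact nextOk_tree v fs hf
    | prod tA tB =>
      obtain ⟨a, b, fs', h₁, h₂⟩ := nextOk_prod (σ := σ) (kB := kB) tA tB fs hf
      exact ⟨a, b, fs', h₁.mono (by gcongr; exact Nat.le_succ _), h₂⟩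
    | row x t => exact nextOk_row x t fs hf
  exact ⟨a, b, fs', h₁.mono (by gcongr), h₂⟩

/-- The expression is arbitrary because the first round runs `start` and the later ones `next`; `c`
is the overhead around the call of `next`, and `2 ≤ c` covers a bare call. -/
theorem enumFrom_of_stack {D : JoinStructure} {c δ : ℕ} (hD : D.prog = prog kB)
    (hnext : D.next = .call next (.var 0)) (hc : 2 ≤ c) (hδ : 100 * (B + 1) + c ≤ δ)
    {fs : List (Frame (Item E))} (hf : GoodStack B fs) (e : Expr) (v : Val)
    (he : ∀ w T, CallLE (prog kB) next (encStack σ fs) w T →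
      ∃ t ≤ T + c, Eval (prog kB) [v] e w t) :
    D.EnumFrom δ e v
      ((fs.flatMap Frame.outs).map fun p => .pair (σ.pay p.1.1) (σ.pay p.2.1)) := by
  induction hn : fs.flatMap Frame.outs generalizing fs e v with
  | nil =>
    cases fs with
    | nil =>
      obtain ⟨t, ht, he⟩ := he .nil 10 (.of_body (body := bNext) rfl (by simp [bNext]))
      exact .finish (hD ▸ he) (by omega)
    | cons f fs =>
      obtain ⟨x, y, fs', -, h₂, -⟩ := nextOk (σ := σ) (kB := kB) f fs hf
      rw [h₂] at hn
      simp at hn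
  | cons p l ih =>
    cases fs with
    | nil => simp at hn
    | cons f fs =>
      obtain ⟨x, y, fs', h₁, h₂, h₃⟩ := nextOk (σ := σ) (kB := kB) f fs hf
      rw [h₂] at hn
      cases hn
      obtain ⟨t, ht, he⟩ := he _ _ h₁
      refine .output (hD ▸ he) (by omega) (ih h₃ _ _ (fun w T hw => ?_) rfl)
      rw [hnext]
      obtain ⟨body, hb, w', t', hev, rfl, ht'⟩ := hw
      exact ⟨_, by omega, .call (.var rfl) hb hev⟩

/-- The initial stack. -/
def framesOf : List (Option (Str E)) → List (Frame (Item E))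
  | [] => []
  | none :: ws => framesOf ws
  | some W :: ws => pushTree W.P (pushTree W.Q (framesOf ws))

theorem call_frames (ws : List (Option (Str E))) :
    CallLE (prog kB) frames (encStrs σ ws) (encStack σ (framesOf ws)) (60 * (ws.length + 1)) := by
  induction ws with
  | nil =>
    refine .of_body (body := bFrames) rfl ?_
    simp [bFrames, encStrs, framesOf]
  | cons w ws ih =>
    refine .of_body (body := bFrames) rfl ?_
    cases w with
    | none =>
      simp [bFrames, encStrs, framesOf]
      refine ih.exec fun t ht => ?_
      simp
      omega
    | some W =>
      simp [bFrames, encStrs, framesOf, Str.enc, wP, wQ, pushTree]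
      refine ih.exec fun t ht => ?_
      rcases W.P.flag_cases with ⟨h₁, h₁'⟩ | ⟨h₁, _, _, h₁'⟩ <;>
      rcases W.Q.flag_cases with ⟨h₂, h₂'⟩ | ⟨h₂, _, _, h₂'⟩ <;>
      (simp [h₁, h₁', h₂, h₂', Frame.enc]
       omega)

/-- The item on the one side and the item on the other side form a pair. -/
def Join (σ : Elems E) (x y : Item E) : Prop :=
  σ.side x.1 = true ∧ σ.side y.1 = false ∧
    List.Forall₂ (fun b a => b ≤ a) (σ.keys y.1) (σ.keys x.1)

theorem Holds.mem_outs {U : List Bst} {v : Nest (Item E)} {S : Set (Item E)}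
    (hv : Holds σ m h U v S) (hσ : σ.Ok m s) (hU : ∀ t ∈ U, t.toList.Pairwise (· ≤ ·))
    {x y : Item E} (hm : List.Forall₂ (fun k t => k ∈ t.toList) (σ.keys x.1) U ∨
      List.Forall₂ (fun k t => k ∈ t.toList) (σ.keys y.1) U) :
    (x, y) ∈ v.outs ↔ x ∈ S ∧ y ∈ S ∧ Join σ x y := by
  rw [Nest.mem_outs hv.wf]
  simp only [hv.get, Join]
  rw [← exists_matches_iff hU hm ((hσ.length _).trans (hσ.length _).symm)]
  constructor
  · rintro ⟨pos, _, _, ⟨h₁, h₂, -, h₃⟩, h₄, h₅, -, h₆⟩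
    rw [Elems.codes, h₂] at h₃
    rw [Elems.codes, h₅] at h₆
    exact ⟨h₁, h₄, h₂, h₅, pos, h₃, h₆⟩
  · rintro ⟨h₁, h₄, h₂, h₅, pos, h₃, h₆⟩
    refine ⟨pos, _, _, ⟨h₁, h₂, rfl, ?_⟩, h₄, h₅, rfl, ?_⟩
    · rwa [Elems.codes, h₂]
    · rwa [Elems.codes, h₅]

theorem Holds.nodup_outs {U : List Bst} {v : Nest (Item E)} {S : Set (Item E)}
    (hv : Holds σ m h U v S) : v.outs.Nodup := by
  refine Nest.nodup_outs hv.wf ?_ ?_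
  · intro pos side id id' x h₁ h₂
    rw [((hv.get _ _ _ _).1 h₁).2.2.1, ((hv.get _ _ _ _).1 h₂).2.2.1]
  · intro pos pos' i j i' j' x y h₁ h₂ h₃ h₄
    exact matches_unique ((hv.get _ _ _ _).1 h₁).2.2.2 ((hv.get _ _ _ _).1 h₂).2.2.2
      ((hv.get _ _ _ _).1 h₃).2.2.2 ((hv.get _ _ _ _).1 h₄).2.2.2

/-- Needs no key in the skeleton. It serves to find out which partner of an output pair is in `T`,
after which `Holds.mem_outs` applies. -/
theorem Holds.mem_of_mem_outs {U : List Bst} {v : Nest (Item E)} {S : Set (Item E)}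
    (hv : Holds σ m h U v S) {x y : Item E} (hxy : (x, y) ∈ v.outs) :
    x ∈ S ∧ σ.side x.1 = true ∧ y ∈ S ∧ σ.side y.1 = false := by
  obtain ⟨pos, i, j, h₁, h₂⟩ := (Nest.mem_outs hv.wf).1 hxy
  have h₁ := (hv.get _ _ _ _).1 h₁
  have h₂ := (hv.get _ _ _ _).1 h₂
  exact ⟨h₁.1, h₁.2.1, h₂.1, h₂.2.1⟩

/-- `P` gives the pairs with box in `T` and `Q` those with point in `T` and box in `lo`. By
disjointness they do not overlap, and together they are the pairs not contained in `lo`. -/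
theorem StrOk.outs {W : Str E} {T lo : Set (Item E)} (hW : StrOk σ m h W T lo) (hσ : σ.Ok m s)
    (hd : Disjoint T lo) : (W.P.outs ++ W.Q.outs).Nodup ∧
      ∀ x y, (x, y) ∈ W.P.outs ++ W.Q.outs ↔
        x ∈ lo ∪ T ∧ y ∈ lo ∪ T ∧ ¬(x ∈ lo ∧ y ∈ lo) ∧ Join σ x y := by
  have hd : ∀ x ∈ T, x ∉ lo := fun x hx => Set.disjoint_left.1 hd hx
  have hP : ∀ x y, (x, y) ∈ W.P.outs ↔ x ∈ lo ∪ T ∧ y ∈ T ∧ Join σ x y := by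
    intro x y
    constructor
    · intro hxy
      obtain ⟨h₁, h₂, h₃, h₄⟩ := hW.P.mem_of_mem_outs hxy
      have hy : y ∈ T := by simpa [h₄] using h₃
      exact ⟨(h₁.imp_right And.right).symm, hy,
        ((hW.P.mem_outs hσ hW.sorted (.inr (hW.mem y hy))).1 hxy).2.2⟩
    · rintro ⟨hx, hy, hj⟩
      exact (hW.P.mem_outs hσ hW.sorted (.inr (hW.mem y hy))).2
        ⟨hx.symm.imp_right fun h => ⟨hj.1, h⟩, .inl hy, hj⟩
  have hQ : ∀ x y, (x, y) ∈ W.Q.outs ↔ x ∈ T ∧ y ∈ lo ∧ Join σ x y := by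
    intro x y
    constructor
    · intro hxy
      obtain ⟨h₁, h₂, h₃, h₄⟩ := hW.Q.mem_of_mem_outs hxy
      have hx : x ∈ T := by simpa [h₂] using h₁
      have hy : y ∈ lo := by simpa [h₄] using h₃
      exact ⟨hx, hy, ((hW.Q.mem_outs hσ hW.sorted (.inl (hW.mem x hx))).1 hxy).2.2⟩
    · rintro ⟨hx, hy, hj⟩
      exact (hW.Q.mem_outs hσ hW.sorted (.inl (hW.mem x hx))).2
        ⟨.inl ⟨hj.1, hx⟩, .inr ⟨hj.2.1, hy⟩, hj⟩
  constructor
  · refine hW.P.nodup_outs.append hW.Q.nodup_outs ?_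
    rintro ⟨x, y⟩ h₁ h₂
    exact hd y ((hP x y).1 h₁).2.1 ((hQ x y).1 h₂).2.1
  · intro x y
    rw [List.mem_append, hP, hQ]
    simp only [Set.mem_union]
    have := hd x
    have := hd y
    tauto

theorem outs_framesOf {ws : List (Option (Str E))} (hws : AllOk σ m h ws) :
    GoodStack (m * h + 2 * h + 4) (framesOf ws) ∧ (framesOf ws).flatMap Frame.outs =
      ws.flatMap fun w => w.elim [] fun W => W.P.outs ++ W.Q.outs := by
  induction ws with
  | nil => simp [framesOf, GoodStack]
  | cons w ws ih =>
    obtain ⟨h₁, h₂⟩ := ih hws.tail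
    cases w with
    | none => exact ⟨h₁, by simpa [framesOf] using h₂⟩
    | some W =>
      obtain ⟨T, lo, hW⟩ := hws W (by simp)
      refine ⟨(h₁.pushTree hW.Q.wf hW.Q.ht).pushTree hW.P.wf hW.P.ht, ?_⟩
      rw [framesOf, outs_pushTree hW.P.wf, outs_pushTree hW.Q.wf, h₂]
      simp

/-- Each pair is found by the last structure in the list that holds one of its members: that
structure knows the other member, and later structures omit pairs that lie entirely below them. -/
theorem Inv.outs {u : ℕ} {ws : List (Option (Str E))} {S lo : Set (Item E)}
    (hw : Inv σ m h lo u ws S) (hσ : σ.Ok m s) :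
    (ws.flatMap fun w => w.elim [] fun W => W.P.outs ++ W.Q.outs).Nodup ∧
      ∀ x y, (x, y) ∈ (ws.flatMap fun w => w.elim [] fun W => W.P.outs ++ W.Q.outs) ↔
        x ∈ S ∧ y ∈ S ∧ ¬(x ∈ lo ∧ y ∈ lo) ∧ Join σ x y := by
  induction ws generalizing lo u with
  | nil =>
    simp only [show S = lo from hw]
    simp
    tauto
  | cons w ws ih =>
    cases w with
    | none => simpa using ih hw
    | some W =>
      obtain ⟨T, -, hd, hT, -, hw⟩ := hw
      obtain ⟨h₁, h₂⟩ := ih hw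
      obtain ⟨h₃, h₄⟩ := hT.outs hσ hd
      have hsub := hw.subset
      rw [List.flatMap_cons]
      simp only [Option.elim_some]
      constructor
      · refine h₃.append h₁ ?_
        rintro ⟨x, y⟩ k₁ k₂
        have k₁ := (h₄ x y).1 k₁
        exact ((h₂ x y).1 k₂).2.2.1 ⟨k₁.1, k₁.2.1⟩
      · intro x y
        rw [List.mem_append, h₂, h₄]
        have k₁ := @hsub x
        have k₂ := @hsub y
        have k₃ : x ∈ lo → x ∈ lo ∪ T := .inl
        have k₄ : y ∈ lo → y ∈ lo ∪ T := .inl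
        tauto

/-- Without a carry nothing lies below the first slot, so no pair is omitted. -/
theorem State.Ok.outs {st : State E} {X : Finset E} (hst : st.Ok σ m s [] 0 X) (hσ : σ.Ok m s) :
    ∃ S : Set (Item E), Uniq S ∧ (∀ e, e ∈ X ↔ ∃ x ∈ S, x.1 = e) ∧
      GoodStack (m * st.h + 2 * st.h + 4) (framesOf st.strs) ∧
      ((framesOf st.strs).flatMap Frame.outs).Nodup ∧
      ∀ x y, (x, y) ∈ (framesOf st.strs).flatMap Frame.outs ↔ x ∈ S ∧ y ∈ S ∧ Join σ x y := by
  obtain ⟨S', S, hw, ht, hS, -, hX⟩ := hst.inv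
  obtain ⟨T, -, hd, hT, -, hST⟩ := ht
  obtain rfl : S = S' ∪ T := hST
  have hok : AllOk σ m st.h st.strs := by
    intro W hW
    rcases List.mem_cons.1 hW with h | h
    · cases h
      exact ⟨_, _, hT⟩
    · exact hw.allOk W h
  obtain ⟨h₁, h₂⟩ := outs_framesOf hok
  obtain ⟨h₃, h₄⟩ := hw.outs hσ
  obtain ⟨h₅, h₆⟩ := hT.outs hσ hd
  refine ⟨_, hS, hX, h₁, ?_, ?_⟩
  · rw [h₂, State.strs, List.flatMap_cons]
    refine h₅.append h₃ ?_
    rintro ⟨x, y⟩ k₁ k₂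
    have k₂ := (h₄ x y).1 k₂
    exact ((h₆ x y).1 k₁).2.2.1 ⟨k₂.1, k₂.2.1⟩
  · intro x y
    rw [h₂, State.strs, List.flatMap_cons, List.mem_append]
    simp only [Option.elim_some, h₆, h₄]
    simp only [Set.mem_union, List.not_mem_nil, Set.mem_ofPred_eq]
    tauto

end
end DynJoin

namespace DynJoin

/-! ## The data structure -/

section
variable {E : Type} {σ : Elems E} {m s c h : ℕ} {kB : Expr} {par : Val}

open Code

theorem size_encStrs {z : ℕ} {ws : List (Option (Str E))} (hw : SizeLe σ z ws) :
    (encStrs σ ws).size ≤ ws.length * (z + 2) + 1 := by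
  induction ws with
  | nil => simp [encStrs, Val.size]
  | cons w ws ih =>
    have ih := ih fun W hW => hw W (by simp [hW])
    rw [List.length_cons]
    cases w with
    | none =>
      simp only [encStrs, Val.size]
      nlinarith
    | some W =>
      have := hw W (by simp)
      simp only [encStrs, Val.size]
      nlinarith

/-- The identifier 0, which is the datum `nil`, is a placeholder; `rebuild` assigns the real ones.
-/
theorem call_wrap (b : Bool) (l : List E) (hb : ∀ e ∈ l, σ.side e = b)
    (hel : ∀ e, CallLE (prog kB) el (.pair (encBool (σ.side e)) (.pair par (σ.pay e))) (σ.enc e) c)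
    (acc : List (Item E)) :
    CallLE (prog kB) wrap (.pair (encBool b) (.pair par (.pair (.ofList (l.map σ.pay))
      (encItems σ acc)))) (encItems σ ((l.map fun e => (e, 0)).reverse ++ acc))
      ((c + 60) * (l.length + 1)) := by
  induction l generalizing acc with
  | nil =>
    refine .of_body (body := bWrap) rfl ?_
    simp [bWrap, cell]
  | cons e l ih =>
    have c₁ := hel e
    have c₂ := ih (fun e he => hb e (by simp [he])) ((e, 0) :: acc)
    rw [hb e (by simp)] at c₁
    refine .of_body (body := bWrap) rfl ?_
    simp [bWrap, cell, encItem] at c₂ ⊢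
    refine c₁.exec fun t₁ ht₁ => c₂.exec fun t₂ ht₂ => ?_
    simp
    nlinarith

/-- The expression for the side. -/
def sideExpr (b : Bool) : Expr := if b then tt else .nil

/-- An update. -/
def opExpr (f : ℕ) (b : Bool) : Expr :=
  .call f (.pair (.var 0) (.call el (.pair (sideExpr b) (.pair (fst (.var 0)) (.var 1)))))

theorem eval_opExpr {f T : ℕ} {st : State E} {e : E} {w : Val}
    (hel : CallLE (prog kB) el (.pair (encBool (σ.side e)) (.pair par (σ.pay e))) (σ.enc e) c)
    (hf : CallLE (prog kB) f (.pair (st.enc σ par) (σ.enc e)) w T) :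
    ∃ t ≤ T + c + 40,
      Eval (prog kB) [st.enc σ par, σ.pay e] (opExpr f (σ.side e)) w t := by
  have : WP (prog kB) [st.enc σ par, σ.pay e] (opExpr f (σ.side e))
      fun w' t => w' = w ∧ t ≤ T + c + 40 := by
    cases hs : σ.side e <;>
    · rw [hs] at hel
      simp [opExpr, sideExpr, tt, State.enc] at hel hf ⊢
      refine hel.exec fun t₁ ht₁ => hf.exec fun t₂ ht₂ => ?_
      simp
      omega
  obtain ⟨_, t, he, rfl, ht⟩ := this
  exact ⟨t, ht, he⟩

/-- The code of the data structure, up to the function that computes the keys of a box. -/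
def joinStructure (kB : Expr) : JoinStructure where
  prog := prog kB
  build := .call rebuild (.pair (.var 0) (.call wrap (.pair .nil (.pair (.var 0) (.pair (.var 2)
    (.call wrap (.pair tt (.pair (.var 0) (.pair (.var 1) .nil)))))))))
  insertA := opExpr ins true
  deleteA := opExpr rem true
  insertB := opExpr ins false
  deleteB := opExpr rem false
  start := .call next (.call frames (snd (snd (.var 0))))
  next := .call next (.var 0)

/-! ### Bounds -/

theorem one_le_log (n : ℕ) : 1 ≤ Nat.log 2 (n + 2) := Nat.log_pos (by simp) (by omega)

theorem unit_le {l : ℕ} (hl : 1 ≤ l) (hh : h ≤ l + 4) :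
    unit m h ≤ 7 * (m + 2) * 12 ^ m * l ^ (m + 1) := by
  -- From `h ≤ l + 4` and `1 ≤ l`: `h + 2 ≤ 7 * l` and `2 * h + 2 ≤ 12 * l`.
  calc unit m h ≤ (m + 2) * (7 * l) * (12 * l) ^ m := by unfold unit; gcongr <;> omega
    _ = _ := by ring

/-- The constant of the data structure. -/
def const (m s c : ℕ) : ℕ := 10000000 * (m + 2) * 12 ^ m * (s + c + 50)

theorem le_const_mul {a b l k : ℕ} (hl : 1 ≤ l) (hk : m + 3 ≤ k) (ha : a ≤ 10000000 * (s + c + 50))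
    (hb : b ≤ (m + 2) * 12 ^ m * l ^ (m + 3)) : a * b ≤ const m s c * l ^ k := by
  calc a * b ≤ 10000000 * (s + c + 50) * ((m + 2) * 12 ^ m * l ^ k) :=
        Nat.mul_le_mul ha (hb.trans (by gcongr))
    _ = _ := by rw [const]; ring

/-- The counter is at most `n0 / 2`, and `n0` is at most `X.card` plus the counter, so `n0 ≤ 2 *
X.card`. The slack in `hn` is for budgets in terms of the size after an update, while `X` is the set
before it. -/
theorem State.Ok.bounds {st : State E} {X : Finset E} (hst : st.Ok σ m s [] 0 X) {n : ℕ}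
    (hn : X.card ≤ n + 1) :
    st.h ≤ Nat.log 2 (n + 2) + 3 ∧ st.ws.length ≤ Nat.log 2 (n + 2) ∧
      st.n0 + cnt st.ws ≤ 3 * X.card + 1 := by
  have hcl := cnt_lt st.ws
  obtain ⟨hK, -⟩ := two_pow_log_half st.n0
  rw [← hst.len] at hK
  have hge := hst.ge
  refine ⟨?_, ?_, by omega⟩
  · have : Nat.log 2 (st.n0 + 2) ≤ Nat.log 2 (2 * (n + 2) + 1) := Nat.log_mono_right (by omega)
    rw [Nat.log_of_one_lt_of_le (n := 2 * (n + 2) + 1) (by simp) (by omega),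
      show (2 * (n + 2) + 1) / 2 = n + 2 by omega] at this
    rw [State.h]
    omega
  · rw [hst.len]
    exact Nat.log_mono_right (by omega)

theorem State.Ok.time_le {st : State E} {X : Finset E} (hst : st.Ok σ m s [] 0 X) {n k : ℕ}
    (hn : X.card ≤ n + 1) (hk : m + 3 ≤ k) :
    100000 * unit m (st.h + 1) * (st.ws.length + 3) + c + 40 ≤ const m s c * polylog k n := by
  obtain ⟨h₁, h₂, -⟩ := hst.bounds hn
  have hl := one_le_log n
  unfold polylog
  set l := Nat.log 2 (n + 2)
  have h₃ := unit_le (m := m) hl (h := st.h + 1) (by omega)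
  have hX : 1 ≤ (m + 2) * 12 ^ m * l ^ (m + 3) := Nat.mul_pos (by positivity) (by positivity)
  -- 2800000 is 100000 times 7 from `unit_le` times 4 from `ws.length + 3 ≤ 4 * l`.
  refine le_trans ?_ (le_const_mul (a := 2800000 + (c + 40))
    (b := (m + 2) * 12 ^ m * l ^ (m + 3)) hl hk (by omega) le_rfl)
  calc 100000 * unit m (st.h + 1) * (st.ws.length + 3) + c + 40
      ≤ 100000 * (7 * (m + 2) * 12 ^ m * l ^ (m + 1)) * (4 * l) + c + 40 := by gcongr; omega
    _ = 2800000 * ((m + 2) * 12 ^ m * l ^ (m + 2)) + (c + 40) * 1 := by ring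
    _ ≤ 2800000 * ((m + 2) * 12 ^ m * l ^ (m + 3)) +
        (c + 40) * ((m + 2) * 12 ^ m * l ^ (m + 3)) := by gcongr; omega
    _ = _ := by ring

theorem State.Ok.size_le {st : State E} {X : Finset E} (hst : st.Ok σ m s [] 0 X) {k : ℕ}
    (hk : m + 3 ≤ k) (hp : par.size ≤ s) :
    (st.enc σ par).size ≤ const m s c * (X.card + 1) * polylog k X.card := by
  obtain ⟨h₁, h₂, h₃⟩ := hst.bounds (Nat.le_succ _)
  have hl := one_le_log X.card
  unfold polylog
  set l := Nat.log 2 (X.card + 2)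
  have h₄ := unit_le (m := m) hl (h := st.h) (by omega)
  have hX : 1 ≤ (m + 2) * 12 ^ m * l ^ (m + 3) := Nat.mul_pos (by positivity) (by positivity)
  have hbits := size_encBits st.ctr.bits
  have hctr : st.ctr.bits.length ≤ st.h := bits_length_le (by
    have := hst.ctr
    have := st.two_mul_lt
    have hcl := cnt_lt st.ws
    obtain ⟨hK, -⟩ := two_pow_log_half st.n0
    rw [← hst.len] at hK
    omega)
  have hstrs := size_encStrs hst.size
  have hsize : sizeUnit m s st.h ≤ 28 * (s + 50) * ((m + 2) * 12 ^ m * l ^ (m + 2)) := by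
    calc sizeUnit m s st.h
        ≤ 4 * ((s + 50) * l) * (7 * (m + 2) * 12 ^ m * l ^ (m + 1)) := by
          unfold sizeUnit
          gcongr
          nlinarith
      _ = _ := by ring
  have hlen : st.strs.length ≤ 2 * l := by
    simp only [State.strs, List.length_cons]
    omega
  have hlX : l ≤ (m + 2) * 12 ^ m * l ^ (m + 3) := by
    calc l = 1 * l ^ 1 := by ring
      _ ≤ _ := by gcongr <;> first | exact hl | omega | exact Nat.mul_pos (by omega) (by positivity)
  have : (st.enc σ par).size ≤
      ((s + 50) * (X.card + 1)) * (1000 * ((m + 2) * 12 ^ m * l ^ (m + 3))) := by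
    simp only [State.enc, Val.size]
    -- By `h₃`, `2 * (n0 + 2) + cnt` is at most `6 * X.card + 6`.
    have e₁ : st.strs.length * ((2 * (st.n0 + 2) + cnt st.ws + 0) * sizeUnit m s st.h + 2) ≤
        2 * l * (7 * (X.card + 1) * (28 * (s + 50) * ((m + 2) * 12 ^ m * l ^ (m + 2))) + 2) := by
      gcongr
      omega
    have e₂ : 2 * l * (7 * (X.card + 1) * (28 * (s + 50) * ((m + 2) * 12 ^ m * l ^ (m + 2))) + 2) =
        ((s + 50) * (X.card + 1)) * (392 * ((m + 2) * 12 ^ m * l ^ (m + 3))) + 4 * l := by ring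
    have e₃ : s + 50 ≤ (s + 50) * (X.card + 1) := Nat.le_mul_of_pos_right _ (by omega)
    have e₄ : (s + 50) * l ≤ (s + 50) * (X.card + 1) * ((m + 2) * 12 ^ m * l ^ (m + 3)) :=
      Nat.mul_le_mul e₃ hlX
    nlinarith
  refine this.trans ?_
  have := le_const_mul (m := m) (s := s) (c := c) (a := 1000 * (s + 50))
    (b := (m + 2) * 12 ^ m * l ^ (m + 3)) hl hk (by omega) le_rfl
  nlinarith

theorem State.Ok.delay_le {st : State E} {X : Finset E} (hst : st.Ok σ m s [] 0 X) {k : ℕ}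
    (hk : m + 3 ≤ k) :
    100 * (m * st.h + 2 * st.h + 4 + 1) + (60 * (st.ws.length + 2) + 20) ≤
      const m s c * polylog k X.card := by
  obtain ⟨h₁, h₂, -⟩ := hst.bounds (Nat.le_succ _)
  have hl := one_le_log X.card
  unfold polylog
  set l := Nat.log 2 (X.card + 2)
  refine le_trans ?_ (le_const_mul (a := 1100) (b := (m + 2) * l) hl hk (by omega) ?_)
  · have : (m + 2) * st.h ≤ (m + 2) * (4 * l) := by gcongr; omega
    nlinarith
  · calc (m + 2) * l = (m + 2) * 1 * l ^ 1 := by ring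
      _ ≤ _ := by gcongr <;> first | exact hl | omega | exact Nat.one_le_pow _ _ (by omega)

/-! ### Correctness -/

variable {α β : Type} {encA : α → Val} {encB : β → Val}
  {keysA : α → List ℝ} {keysB : β → List ℝ} {k : ℕ}

/-- The elements of two sets. -/
def sumElems (encA : α → Val) (encB : β → Val) (keysA : α → List ℝ) (keysB : β → List ℝ) :
    Elems (α ⊕ β) :=
  ⟨Sum.isLeft, Sum.elim keysA keysB, Sum.elim encA encB⟩

theorem exists_update [DecidableEq α] [DecidableEq β] {σ : Elems (α ⊕ β)} (hσ' : σ = sumElems encA encB keysA keysB)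
    (hσ : σ.Ok m s) (hk : m + 3 ≤ k)
    (hel : ∀ e, CallLE (prog kB) el (.pair (encBool (σ.side e)) (.pair par (σ.pay e))) (σ.enc e) c)
    {st : State (α ⊕ β)} {I : Finset α × Finset β} (hst : st.Ok σ m s [] 0 (I.1.disjSum I.2))
    (u : Update α β) :
    ∃ (st' : State (α ⊕ β)) (t : ℕ),
      (joinStructure kB).UpdateStep encA encB (st.enc σ par) u (st'.enc σ par) t ∧
      st'.Ok σ m s [] 0 ((u.apply I).1.disjSum (u.apply I).2) ∧
      t + st'.pot m ≤ st.pot m + const m s c * polylog k (instSize (u.apply I)) := by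
  -- The set before the update has at most one element more than the set after it.
  have hcard := hst.time_le (c := c) (n := instSize (u.apply I)) (k := k) (by
    rw [Finset.card_disjSum]
    cases u with
    | insertA a =>
      have := Finset.card_le_card (Finset.subset_insert a I.1)
      simp only [Update.apply, instSize]
      omega
    | deleteA a =>
      have := I.1.pred_card_le_card_erase (a := a)
      simp only [Update.apply, instSize]
      omega
    | insertB b =>
      have := Finset.card_le_card (Finset.subset_insert b I.2)
      simp only [Update.apply, instSize]
      omega
    | deleteB b =>
      have := I.2.pred_card_le_card_erase (a := b)
      simp only [Update.apply, instSize]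
      omega) hk
  have key : ∀ {f : ℕ} {e : α ⊕ β} {Y : Finset (α ⊕ β)}
      (_ : ∃ (st' : State (α ⊕ β)) (T : ℕ), CallLE (prog kB) f (.pair (st.enc σ par) (σ.enc e))
        (st'.enc σ par) T ∧ st'.Ok σ m s [] 0 Y ∧
        T + st'.pot m ≤ st.pot m + 100000 * unit m (st.h + 1) * (st.ws.length + 3)),
      ∃ (st' : State (α ⊕ β)) (t : ℕ),
        Eval (prog kB) [st.enc σ par, σ.pay e] (opExpr f (σ.side e)) (st'.enc σ par) t ∧
        st'.Ok σ m s [] 0 Y ∧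
        t + st'.pot m ≤ st.pot m + const m s c * polylog k (instSize (u.apply I)) := by
    rintro f e Y ⟨st', T, h₁, h₂, h₃⟩
    obtain ⟨t, ht, h⟩ := eval_opExpr (hel e) h₁
    exact ⟨st', t, h, h₂, by omega⟩
  subst hσ'
  cases u with
  | insertA a =>
    have := key (hst.exists_ins (kB := kB) hσ par (.inl a))
    rwa [show insert (Sum.inl a) (I.1.disjSum I.2) = (insert a I.1).disjSum I.2 by
      ext (x | x) <;> simp] at this
  | deleteA a =>
    have := key (hst.exists_rem (kB := kB) hσ par (.inl a))
    rwa [show (I.1.disjSum I.2).erase (Sum.inl a) = (I.1.erase a).disjSum I.2 by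
      ext (x | x) <;> simp] at this
  | insertB a =>
    have := key (hst.exists_ins (kB := kB) hσ par (.inr a))
    rwa [show insert (Sum.inr a) (I.1.disjSum I.2) = I.1.disjSum (insert a I.2) by
      ext (x | x) <;> simp] at this
  | deleteB a =>
    have := key (hst.exists_rem (kB := kB) hσ par (.inr a))
    rwa [show (I.1.disjSum I.2).erase (Sum.inr a) = I.1.disjSum (I.2.erase a) by
      ext (x | x) <;> simp] at this

theorem exists_updates [DecidableEq α] [DecidableEq β]
    {σ : Elems (α ⊕ β)} (hσ' : σ = sumElems encA encB keysA keysB)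
    (hσ : σ.Ok m s) (hk : m + 3 ≤ k)
    (hel : ∀ e, CallLE (prog kB) el (.pair (encBool (σ.side e)) (.pair par (σ.pay e))) (σ.enc e) c)
    (us : List (Update α β)) {st : State (α ⊕ β)} {I : Finset α × Finset β}
    (hst : st.Ok σ m s [] 0 (I.1.disjSum I.2)) :
    ∃ (st' : State (α ⊕ β)) (t : ℕ),
      (joinStructure kB).UpdateSteps encA encB (st.enc σ par) us (st'.enc σ par) t ∧
      st'.Ok σ m s [] 0 ((us.foldl Update.apply I).1.disjSum (us.foldl Update.apply I).2) ∧
      t + st'.pot m ≤ st.pot m + amortizedBudget (fun n => const m s c * polylog k n) I us := by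
  induction us generalizing st I with
  | nil => exact ⟨st, 0, .nil, hst, by simp⟩
  | cons u us ih =>
    obtain ⟨st', t, h₁, h₂, h₃⟩ := exists_update (kB := kB) hσ' hσ hk hel hst u
    obtain ⟨st'', t', h₄, h₅, h₆⟩ := ih h₂
    refine ⟨st'', t + t', .cons h₁ h₄, h₅, ?_⟩
    rw [amortizedBudget]
    omega

theorem exists_list_of_sides (l : List (Item (α ⊕ β) × Item (α ⊕ β)))
    (hl : ∀ p ∈ l, p.1.1.isLeft = true ∧ p.2.1.isLeft = false) :
    ∃ out : List (α × β), l.map (fun p => (p.1.1, p.2.1)) =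
      out.map fun q => (Sum.inl q.1, Sum.inr q.2) := by
  induction l with
  | nil => exact ⟨[], rfl⟩
  | cons p l ih =>
    obtain ⟨out, ho⟩ := ih fun p hp => hl p (by simp [hp])
    obtain ⟨h₁, h₂⟩ := hl p (by simp)
    obtain ⟨⟨x, i⟩, ⟨y, j⟩⟩ := p
    cases x <;> cases y <;> simp at h₁ h₂
    rename_i a b
    exact ⟨(a, b) :: out, by simp [ho]⟩

theorem exists_enum {σ : Elems (α ⊕ β)} (hσ' : σ = sumElems encA encB keysA keysB)
    (hσ : σ.Ok m s) (hk : m + 3 ≤ k) {st : State (α ⊕ β)} {A : Finset α} {B : Finset β}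
    (hst : st.Ok σ m s [] 0 (A.disjSum B)) {R : α → β → Prop}
    (hR : ∀ a b, R a b ↔ List.Forall₂ (fun y x => y ≤ x) (keysB b) (keysA a)) :
    ∃ out : List (α × β), out.Nodup ∧ (∀ a b, (a, b) ∈ out ↔ a ∈ A ∧ b ∈ B ∧ R a b) ∧
      (joinStructure kB).EnumFrom (const m s c * polylog k (A.card + B.card))
        (joinStructure kB).start (st.enc σ par)
        (out.map fun p => Val.pair (encA p.1) (encB p.2)) := by
  obtain ⟨S, hS, hX, hg, hnd, hmem⟩ := hst.outs hσ
  have hdelay := hst.delay_le (c := c) hk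
  rw [Finset.card_disjSum] at hdelay
  subst hσ'
  set L := (framesOf st.strs).flatMap Frame.outs with hL
  obtain ⟨out, ho⟩ := exists_list_of_sides L fun p hp =>
    ⟨((hmem p.1 p.2).1 hp).2.2.1, ((hmem p.1 p.2).1 hp).2.2.2.1⟩
  have hinj : Function.Injective fun q : α × β => ((Sum.inl q.1 : α ⊕ β), (Sum.inr q.2 : α ⊕ β)) := by
    rintro ⟨a, b⟩ ⟨a', b'⟩ h
    simpa using h
  refine ⟨out, ?_, ?_, ?_⟩
  · refine List.Nodup.of_map (fun q : α × β => ((Sum.inl q.1 : α ⊕ β), (Sum.inr q.2 : α ⊕ β))) ?_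
    rw [← ho]
    refine hnd.map_on ?_
    rintro ⟨x, y⟩ hp ⟨x', y'⟩ hp' he
    obtain ⟨h₁, h₂, -⟩ := (hmem x y).1 hp
    obtain ⟨h₃, h₄, -⟩ := (hmem x' y').1 hp'
    simp only [Prod.mk.injEq] at he
    rw [(hS x h₁ x' h₃).1 he.1, (hS y h₂ y' h₄).1 he.2]
  · intro a b
    rw [← List.mem_map_of_injective hinj (a := (a, b)), ← ho, List.mem_map]
    constructor
    · rintro ⟨⟨x, y⟩, hp, he⟩
      simp only [Prod.mk.injEq] at he
      obtain ⟨h₁, h₂, -, -, h₃⟩ := (hmem x y).1 hp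
      rw [he.1, he.2] at h₃
      refine ⟨Finset.inl_mem_disjSum.1 ((hX _).2 ⟨x, h₁, he.1⟩),
        Finset.inr_mem_disjSum.1 ((hX _).2 ⟨y, h₂, he.2⟩), (hR a b).2 h₃⟩
    · rintro ⟨ha, hb, hab⟩
      obtain ⟨x, hx, hxa⟩ := (hX _).1 (Finset.inl_mem_disjSum.2 ha)
      obtain ⟨y, hy, hyb⟩ := (hX _).1 (Finset.inr_mem_disjSum.2 hb)
      refine ⟨(x, y), (hmem x y).2 ⟨hx, hy, ?_, ?_, ?_⟩, by simp [hxa, hyb]⟩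
      · rw [hxa]; rfl
      · rw [hyb]; rfl
      · rw [hxa, hyb]
        exact (hR a b).1 hab
  · have h := enumFrom_of_stack (D := joinStructure kB) (c := 60 * (st.ws.length + 2) + 20)
      (kB := kB) (σ := sumElems encA encB keysA keysB) (δ := const m s c * polylog k (A.card + B.card))
      rfl rfl (by omega) hdelay hg (joinStructure kB).start
      (st.enc (sumElems encA encB keysA keysB) par) ?_
    · convert h using 1
      have := congrArg (List.map fun q => Val.pair ((sumElems encA encB keysA keysB).pay q.1)
        ((sumElems encA encB keysA keysB).pay q.2)) ho
      rw [List.map_map, List.map_map] at this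
      exact this.symm
    · intro w T hw
      have cf := call_frames (kB := kB) (σ := sumElems encA encB keysA keysB) st.strs
      have : WP (prog kB) [st.enc (sumElems encA encB keysA keysB) par] (joinStructure kB).start
          fun w' t => w' = w ∧ t ≤ T + (60 * (st.ws.length + 2) + 20) := by
        simp [joinStructure, State.enc]
        refine cf.exec fun t₁ ht₁ => hw.exec fun t₂ ht₂ => ?_
        simp [State.strs] at ht₁ ⊢
        omega
      obtain ⟨_, t, he, rfl, ht⟩ := this
      exact ⟨t, ht, he⟩

/-- The data structure works if the keys are computed in constant time and express the relation. -/
theorem solves [DecidableEq α] [DecidableEq β]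
    (hA : ∀ a, CallLE (prog kB) keyA (.pair par (encA a)) (encReals (keysA a)) c)
    (hB : ∀ b, CallLE (prog kB) keyB (.pair par (encB b)) (encReals (keysB b)) c)
    (hσ : (sumElems encA encB keysA keysB).Ok m s) (hp : par.size ≤ s) (hk : m + 3 ≤ k)
    {R : α → β → Prop}
    (hR : ∀ a b, R a b ↔ List.Forall₂ (fun y x => y ≤ x) (keysB b) (keysA a)) :
    (joinStructure kB).Solves par encA encB R (const m s (c + 40)) k := by
  intro la lb hla hlb
  set σ := sumElems encA encB keysA keysB with hσ'
  have hel : ∀ e, CallLE (prog kB) el (.pair (encBool (σ.side e)) (.pair par (σ.pay e))) (σ.enc e)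
      (c + 40) := by
    rintro (a | b) <;> refine .of_body (body := bEl) rfl ?_
    · simp [bEl, cell, hσ', sumElems, Elems.enc, tt]
      refine (hA a).exec fun t ht => ?_
      simp
      omega
    · simp [bEl, cell, hσ', sumElems, Elems.enc]
      refine (hB b).exec fun t ht => ?_
      simp
      omega
  set l : List (Item (α ⊕ β)) := ((lb.map Sum.inr).map fun e => (e, 0)).reverse ++
    (((la.map Sum.inl).map fun e => (e, 0)).reverse ++ []) with hl
  have hfst : l.map Prod.fst = (lb.map Sum.inr).reverse ++ (la.map Sum.inl).reverse := by
    simp [hl, Function.comp_def]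
  obtain ⟨st, cr, h₁, h₂, h₃⟩ := exists_rebuild (kB := kB) hσ par l
    (X := la.toFinset.disjSum lb.toFinset) (by
      rw [hfst]
      refine List.Nodup.append (List.nodup_reverse.2 (hlb.map Sum.inr_injective))
        (List.nodup_reverse.2 (hla.map Sum.inl_injective)) ?_
      intro x hx hx'
      simp at hx hx'
      obtain ⟨_, -, rfl⟩ := hx
      simp at hx')
    (by
      rw [hfst]
      rintro (a | b) <;> simp)
  have hlen : l.length = la.length + lb.length := by
    simp [hl]
    omega
  have cA := call_wrap (kB := kB) (σ := σ) true (la.map Sum.inl) (by simp [hσ', sumElems]) hel []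
  have cB := call_wrap (kB := kB) (σ := σ) false (lb.map Sum.inr) (by simp [hσ', sumElems]) hel
    (((la.map Sum.inl).map fun e => (e, 0)).reverse ++ [])
  rw [← hl] at cB
  set n := la.length + lb.length with hn
  have hbuild : WP (prog kB) [par, Val.ofList (la.map encA), Val.ofList (lb.map encB)]
      (joinStructure kB).build fun w t => w = st.enc σ par ∧
        t ≤ const m s (c + 40) * (n + 1) * polylog k n := by
    have eA : (la.map Sum.inl).map σ.pay = la.map encA := by
      simp [hσ', sumElems, Function.comp_def]
    have eB : (lb.map Sum.inr).map σ.pay = lb.map encB := by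
      simp [hσ', sumElems, Function.comp_def]
    rw [eA, List.length_map] at cA
    rw [eB, List.length_map] at cB
    simp only [encBool_true, encBool_false, encItems_nil] at cA cB
    simp [joinStructure, tt]
    refine cA.exec fun t₁ ht₁ => cB.exec fun t₂ ht₂ => cr.exec fun t₃ ht₃ => ⟨rfl, ?_⟩
    have hlog := one_le_log n
    have hh : st.h = Nat.log 2 (n + 2) + 2 := by rw [State.h, h₁, hlen]
    unfold polylog
    set lg := Nat.log 2 (n + 2)
    have hu := unit_le (m := m) hlog (h := st.h) (by omega)
    have hX : 1 ≤ (m + 2) * 12 ^ m * lg ^ (m + 3) := Nat.mul_pos (by positivity) (by positivity)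
    have hu' : unit m st.h ≤ 7 * ((m + 2) * 12 ^ m * lg ^ (m + 3)) := by
      refine hu.trans ?_
      rw [mul_assoc, mul_assoc, ← mul_assoc (m + 2)]
      gcongr; omega
    -- 28000 is 4000 times 7, from `rebuild` and the bound for `unit`; the rest comes from wrapping
    -- the two lists.
    have := le_const_mul (m := m) (s := s) (c := c + 40) (a := 28000 + 2 * (c + 40 + 60) + 100)
      (b := (m + 2) * 12 ^ m * lg ^ (m + 3)) hlog hk (by omega) le_rfl
    calc _ ≤ (28000 + 2 * (c + 40 + 60) + 100) * ((m + 2) * 12 ^ m * lg ^ (m + 3)) * (n + 1) := by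
          rw [hlen] at ht₃
          have e₁ : 4000 * unit m st.h * (n + 1) ≤
              4000 * (7 * ((m + 2) * 12 ^ m * lg ^ (m + 3))) * (n + 1) := by gcongr
          have e₂ : (c + 40 + 60) * (la.length + 1) + (c + 40 + 60) * (lb.length + 1) + 100 ≤
              (2 * (c + 40 + 60) + 100) * (n + 1) := by nlinarith
          have e₃ : (2 * (c + 40 + 60) + 100) * (n + 1) * 1 ≤ (2 * (c + 40 + 60) + 100) * (n + 1) *
              ((m + 2) * 12 ^ m * lg ^ (m + 3)) := by gcongr
          linarith
      _ ≤ _ := by nlinarith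
  obtain ⟨_, t₀, hev, rfl, ht₀⟩ := hbuild
  refine ⟨_, t₀, hev, ht₀, fun us => ?_⟩
  obtain ⟨st', t, k₁, k₂, k₃⟩ := exists_updates (kB := kB) (I := (la.toFinset, lb.toFinset)) hσ' hσ hk
    hel us h₂
  obtain ⟨out, o₁, o₂, o₃⟩ := exists_enum (kB := kB) (par := par) (c := c + 40) hσ' hσ hk k₂ hR
  refine ⟨_, t, _, _, out, rfl, k₁, ?_, ?_, o₁, o₂, o₃⟩
  -- The potential vanishes after the construction, so the budget of the updates alone bounds their
  -- total time.
  · rw [State.pot, State.pot, h₃] at k₃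
    omega
  · have := k₂.size_le (c := c + 40) hk hp
    rwa [Finset.card_disjSum] at this

end
end DynJoin

namespace DynJoin

/-! ## Keys -/

theorem size_encReals (l : List ℝ) : (encReals l).size = 2 * l.length + 1 := by
  induction l with
  | nil => rfl
  | cons x l ih =>
    simp only [encReals_cons, Val.size, ih, List.length_cons]
    ring

/-- The list of the numbers of a sequence of pairs. -/
def keyList {d : ℕ} (u : Fin d → ℝ × ℝ) : List ℝ := (List.ofFn u).flatMap fun p => [p.1, p.2]

theorem forall₂_keyList {R : ℝ → ℝ → Prop} {d : ℕ} (u v : Fin d → ℝ × ℝ) :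
    List.Forall₂ R (keyList u) (keyList v) ↔ ∀ i, R (u i).1 (v i).1 ∧ R (u i).2 (v i).2 := by
  induction d with
  | zero => simp [keyList]
  | succ d ih =>
    rw [Fin.forall_fin_succ, ← ih]
    simp [keyList, List.ofFn_succ, and_assoc]

theorem keyList_injective {d : ℕ} :
    Function.Injective (keyList : (Fin d → ℝ × ℝ) → List ℝ) := by
  intro u v h
  have : List.Forall₂ (· = ·) (keyList u) (keyList v) := List.forall₂_eq_eq_eq ▸ h
  exact funext fun i => Prod.ext ((forall₂_keyList u v).1 this i).1 ((forall₂_keyList u v).1 this i).2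

theorem length_keyList {d : ℕ} (u : Fin d → ℝ × ℝ) : (keyList u).length = 2 * d := by
  simp [keyList, List.length_flatMap, Function.comp_def, mul_comm]

/-- Negation turns the upper bound `a i ≤ y i` into another lower bound, so each coordinate gives
two conditions of the same kind. -/
theorem forall₂_le_keyList {d : ℕ} (a x y : Fin d → ℝ) :
    List.Forall₂ (fun y x => y ≤ x) (keyList fun i => (x i, 0 - y i))
      (keyList fun i => (a i, 0 - a i)) ↔ ∀ i, x i ≤ a i ∧ a i ≤ y i := by
  rw [forall₂_keyList]
  simp

namespace Code
open DynJoin.Expr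

/-- The argument is a radius and the list of coordinates of the centre of a ball. -/
def bBall : Expr :=
  cell (var 0) <| cell (var 1) <|
    pair (sub (var 0) (var 2)) (pair (sub zero (Expr.add (var 0) (var 2)))
      (call keyB (pair (var 2) (var 1))))

/-- The argument is a parameter and a box. -/
def bBox : Expr :=
  cell (var 0) <| cell (var 1) <| cell (var 0) <| cell (var 3) <|
    pair (sub (var 2) (var 0)) (pair (sub zero (Expr.add (var 2) (var 0)))
      (call keyB (pair (var 6) (pair (var 3) (var 1)))))

end Code

open Code

theorem call_keyA {kB : Expr} (par : Val) (l : List ℝ) :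
    CallLE (prog kB) keyA (.pair par (encReals l))
      (encReals (l.flatMap fun x => [x, 0 - x])) (40 * (l.length + 1)) := by
  induction l with
  | nil =>
    refine .of_body (body := bKeyA) rfl ?_
    simp [bKeyA, cell]
  | cons x l ih =>
    refine .of_body (body := bKeyA) rfl ?_
    simp [bKeyA, cell] at ih ⊢
    refine ih.exec fun t ht => ?_
    simp
    omega

theorem call_ball (r : ℝ) (l : List ℝ) :
    CallLE (prog bBall) keyB (.pair (.real r) (encReals l))
      (encReals (l.flatMap fun x => [x - r, 0 - (x + r)])) (40 * (l.length + 1)) := by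
  induction l with
  | nil =>
    refine .of_body (body := bBall) rfl ?_
    simp [bBall, cell]
  | cons x l ih =>
    refine .of_body (body := bBall) rfl ?_
    simp [bBall, cell] at ih ⊢
    refine ih.exec fun t ht => ?_
    simp
    omega

theorem call_box (par : Val) (l : List (ℝ × ℝ)) :
    CallLE (prog bBox) keyB
      (.pair par (.pair (encReals (l.map Prod.fst)) (encReals (l.map Prod.snd))))
      (encReals (l.flatMap fun p => [p.1 - p.2, 0 - (p.1 + p.2)])) (40 * (l.length + 1)) := by
  induction l with
  | nil =>
    refine .of_body (body := bBox) rfl ?_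
    simp [bBox, cell]
  | cons x l ih =>
    refine .of_body (body := bBox) rfl ?_
    simp [bBox, cell] at ih ⊢
    refine ih.exec fun t ht => ?_
    simp
    omega

theorem call_keyA_encPoint {kB : Expr} {d : ℕ} (par : Val) (a : Fin d → ℝ) :
    CallLE (prog kB) keyA (.pair par (encPoint a)) (encReals (keyList fun i => (a i, 0 - a i)))
      (40 * (d + 1)) := by
  have := call_keyA (kB := kB) par (List.ofFn a)
  rwa [List.length_ofFn, show (List.ofFn a).flatMap (fun x => [x, 0 - x]) =
    keyList fun i => (a i, 0 - a i) by
      rw [keyList, ← Function.comp_def (fun x : ℝ => (x, 0 - x)) a, ← List.map_ofFn,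
        List.flatMap_map]] at this

theorem call_ball_encPoint {d : ℕ} (r : ℝ) (b : Fin d → ℝ) :
    CallLE (prog bBall) keyB (.pair (.real r) (encPoint b))
      (encReals (keyList fun i => (b i - r, 0 - (b i + r)))) (40 * (d + 1)) := by
  have := call_ball r (List.ofFn b)
  rwa [List.length_ofFn, show (List.ofFn b).flatMap (fun x => [x - r, 0 - (x + r)]) =
    keyList fun i => (b i - r, 0 - (b i + r)) by
      rw [keyList, ← Function.comp_def (fun x : ℝ => (x - r, 0 - (x + r))) b, ← List.map_ofFn,
        List.flatMap_map]] at this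

theorem call_box_encBox {d : ℕ} (par : Val) (b : Box d) :
    CallLE (prog bBox) keyB (.pair par (encBox b))
      (encReals (keyList fun i => (b.1 i - b.2 i, 0 - (b.1 i + b.2 i)))) (40 * (d + 1)) := by
  have := call_box par (List.ofFn fun i => (b.1 i, b.2 i))
  rw [List.length_ofFn, List.map_ofFn, List.map_ofFn] at this
  rwa [show (List.ofFn fun i => (b.1 i, b.2 i)).flatMap
      (fun p => [p.1 - p.2, 0 - (p.1 + p.2)]) =
    keyList fun i => (b.1 i - b.2 i, 0 - (b.1 i + b.2 i)) by
      rw [keyList, ← Function.comp_def (fun p : ℝ × ℝ => (p.1 - p.2, 0 - (p.1 + p.2)))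
        (fun i => (b.1 i, b.2 i)), ← List.map_ofFn, List.flatMap_map]] at this

theorem size_encPoint {d : ℕ} (x : Fin d → ℝ) : (encPoint x).size = 2 * d + 1 := by
  simpa [encReals, encPoint] using size_encReals (List.ofFn x)

/-- The dictionary finds elements by their keys, so keys must determine the element on each side;
for points they do, as the coordinates are among them. -/
theorem sumElems_ok {β : Type} {d s : ℕ} {encB : β → Val} {keysB : β → Fin d → ℝ × ℝ}
    (hinj : Function.Injective keysB) (hs : ∀ b, (encB b).size ≤ s) (hd : 2 * d + 1 ≤ s) :
    (sumElems (encPoint (d := d)) encB (fun a => keyList fun i => (a i, 0 - a i))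
      fun b => keyList (keysB b)).Ok (2 * d) (s + 4 * d + 10) := by
  have hb : ∀ b : Bool, (encBool b).size ≤ 3 := by rintro (_ | _) <;> simp [Val.size]
  refine ⟨?_, ?_, ?_⟩
  · rintro (a | b) <;> exact length_keyList _
  · rintro (a | b) (a' | b') h₁ h₂ <;> simp [sumElems] at h₁
    · have := keyList_injective h₂
      congr 1
      ext i
      exact congrArg Prod.fst (congrFun this i)
    · rw [hinj (keyList_injective h₂)]
  · rintro (a | b)
    · have := hb true
      simp only [sumElems, Elems.enc, Sum.elim_inl, Val.size, size_encReals, length_keyList,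
        size_encPoint, Sum.isLeft_inl]
      omega
    · have := hb false
      have := hs b
      simp only [sumElems, Elems.enc, Sum.elim_inr, Val.size, size_encReals, length_keyList,
        Sum.isLeft_inr]
      omega

theorem norm_sub_le_iff_forall₂ {d : ℕ} {r : ℝ} (hr : 0 < r) (a b : Fin d → ℝ) :
    ‖a - b‖ ≤ r ↔ List.Forall₂ (fun y x => y ≤ x) (keyList fun i => (b i - r, 0 - (b i + r)))
      (keyList fun i => (a i, 0 - a i)) := by
  rw [forall₂_le_keyList a (fun i => b i - r) (fun i => b i + r), pi_norm_le_iff_of_nonneg hr.le]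
  refine forall_congr' fun i => ?_
  rw [Pi.sub_apply, Real.norm_eq_abs, abs_le]
  constructor <;> rintro ⟨h₁, h₂⟩ <;> constructor <;> linarith

/-- No sign condition is needed: with a negative half side length both conditions are unsatisfiable.
-/
theorem mem_toSet_iff_forall₂ {d : ℕ} (a : Fin d → ℝ) (b : Box d) :
    a ∈ b.toSet ↔ List.Forall₂ (fun y x => y ≤ x)
      (keyList fun i => (b.1 i - b.2 i, 0 - (b.1 i + b.2 i))) (keyList fun i => (a i, 0 - a i)) := by
  rw [forall₂_le_keyList a (fun i => b.1 i - b.2 i) (fun i => b.1 i + b.2 i), Box.toSet,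
    Set.mem_Icc, Pi.le_def, Pi.le_def, ← forall_and]
  rfl

end DynJoin

/- `Fin d → ℝ` carries the maximum norm. -/
theorem mainTheorem1 :
    ∃ c : ℕ, ∀ d : ℕ, 1 ≤ d →
      (∃ (D : DynJoin.JoinStructure) (C : ℕ), ∀ r : ℝ, 0 < r →
        D.Solves (DynJoin.Val.real r) DynJoin.encPoint DynJoin.encPoint
          (fun a b : Fin d → ℝ => ‖a - b‖ ≤ r) C (c * d)) ∧
      (∃ (D : DynJoin.JoinStructure) (C : ℕ),
        D.Solves DynJoin.Val.nil DynJoin.encPoint DynJoin.encBox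
          (fun (a : Fin d → ℝ) (b : DynJoin.Box d) => a ∈ DynJoin.Box.toSet b) C (c * d)) := by
  -- The exponent needed for `m = 2 * d` keys is `m + 3`, and `2 * d + 3 ≤ 5 * d` since `1 ≤ d`.
  refine ⟨5, fun d hd => ⟨⟨DynJoin.joinStructure DynJoin.Code.bBall,
      DynJoin.const (2 * d) (2 * d + 1 + 4 * d + 10) (40 * (d + 1) + 40), fun r hr => ?_⟩,
    ⟨DynJoin.joinStructure DynJoin.Code.bBox,
      DynJoin.const (2 * d) (4 * d + 3 + 4 * d + 10) (40 * (d + 1) + 40), ?_⟩⟩⟩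
  · refine DynJoin.solves (m := 2 * d) (s := 2 * d + 1 + 4 * d + 10)
      (DynJoin.call_keyA_encPoint _) (DynJoin.call_ball_encPoint r)
      (DynJoin.sumElems_ok ?_ (fun b => (DynJoin.size_encPoint b).le) le_rfl)
      (by simp [DynJoin.Val.size]) (by omega) fun a b => DynJoin.norm_sub_le_iff_forall₂ hr a b
    intro b b' h
    ext i
    simpa using congrArg Prod.fst (congrFun h i)
  -- `4 * d + 3` is the size of an encoded box, which is a cell with two points of size `2 * d + 1`.
  · refine DynJoin.solves (m := 2 * d) (s := 4 * d + 3 + 4 * d + 10)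
      (DynJoin.call_keyA_encPoint _) (DynJoin.call_box_encBox _)
      (DynJoin.sumElems_ok ?_ (fun b => ?_) (by omega))
      (by simp [DynJoin.Val.size]) (by omega) fun a b => DynJoin.mem_toSet_iff_forall₂ a b
    -- Centre and half side lengths are recovered from `b - w` and `b + w`, so even empty boxes with
    -- different data have different keys.
    · rintro ⟨b, w⟩ ⟨b', w'⟩ h
      have h₁ : ∀ i, b i - w i = b' i - w' i := fun i => congrArg Prod.fst (congrFun h i)
      have h₂ : ∀ i, 0 - (b i + w i) = 0 - (b' i + w' i) :=
        fun i => congrArg Prod.snd (congrFun h i)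
      refine Prod.ext (funext fun i => ?_) (funext fun i => ?_) <;>
        linarith [h₁ i, h₂ i]
    · simp only [DynJoin.encBox, DynJoin.Val.size, DynJoin.size_encPoint]
      omega
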